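/- Let $g$ be a smooth Riemannian metric on $S^2$, and fix an orientation of $S^2$. Identify $S^3$ with $SU(2)$ via $(z,w)\simeq\begin{pmatrix} z&w\\-\bar w&\bar z\end{pmatrix}$, $|z|^2+|w|^2=1$, identify $S^2$ with $\{\operatorname{Re} z=0\}\subset SU(2)$ with its round metric $g_0$, and let $\lambda_0$ be the restriction to $S^3$ of $\tfrac12(x\,dy-y\,dx+u\,dv-v\,du)$, where $z=x+iy$, $w=u+iv$; put $\xi=\ker\lambda_0$. Let $D_0:S^3\to T^1_{g_0}S^2$, $D_0(Z)=(Z^{-1}jZ,\,-Z^{-1}kZ)$, with $j=\begin{pmatrix}0&1\\-1&0\end{pmatrix}$, $k=\begin{pmatrix}0&i\\i&0\end{pmatrix}$, and let $D_g=\mathcal L_g^{-1}\circ\Pi_g\circ\mathcal L_{g_0}\circ D_0:S^3\to T^1_gS^2$ be the induced double covering, where $\mathcal L_h(x,v)=(x,h(x)(v,\cdot))$ is the Legendre transform of a metric $h$, and $\Pi_g$ rescales a nonzero covector to $g$-norm one. Let $\phi^t$ be the flow on $S^3$ that lifts the geodesic flow $\phi_g^t$ of $g$ on $T^1_gS^2$,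 i.e. $D_g\circ\phi^t=\phi^t_g\circ D_g$. For $(x,v)\in T^1_gS^2$ let $v^\perp$ be the $g$-unit vector $g$-orthogonal to $v$ such that $\{v,v^\perp\}$ is positive, and let $\sigma_g(x,v)=\{(v^\perp)^{\mathrm{vert}},(v^\perp)^{\mathrm{hor}}\}$ be the geodesic frame, where vert and hor denote the vertical lift and the horizontal lift with respect to the Levi-Civita connection of $g$. Let $\tilde\sigma_g=\{\tilde\sigma_1,\tilde\sigma_2\}$ be its lift to $S^3$, i.e. $dD_g\cdot\tilde\sigma_i=(\sigma_g)_i\circ D_g$. Then $\tilde\sigma_g$ is a global frame of $\xi$ and $D\phi^t$ preserves $\xi$. Let $\Theta_{\tilde\sigma_g}:(\xi\setminus0)/\mathbb R_+\to\mathbb R/2\pi\mathbb Z$ be the angle coordinate, for which $\zeta$ is a positive multiple of $\cos\theta\,\tilde\sigma_1+\sin\theta\,\tilde\sigma_2$ with $\theta=\Theta_{\tilde\sigma_g}(\zeta)$, and let $\tilde X$ be the vector field on $(\xi\setminus 0)/\mathbb R_+$ generating the flow induced by the linearised flow $D\phi^t$. Then, everywhere on $(\xi\setminus0)/\mathbb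 R_+$, $$\min\{1,K_{\min}\}\ \le\ i_{\tilde X}d\Theta_{\tilde\sigma_g}\ \le\ \max\{1,K_{\max}\},$$ where $K_{\min}$ and $K_{\max}$ are the minimum and the maximum of the Gaussian curvature of $(S^2,g)$. In other words, for every $p\in S^3$ and $\zeta\in\xi_p\setminus0$, the derivative at $t=0$ of $t\mapsto\Theta_{\tilde\sigma_g}(D\phi^t\cdot\zeta)$ exists and lies between these two numbers. -/

import Mathlib

open scoped Manifold ContDiff

noncomputable section

namespace GeodesicLift

/-- The two-sphere, as the unit sphere of `ℝ³` with coordinates `(y, u, v)`. -/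
abbrev S2 : Type := Metric.sphere (0 : EuclideanSpace ℝ (Fin 3)) 1

/-- The three-sphere, as the unit sphere of `ℝ⁴ = ℂ²` with coordinates `(x, y, u, v)`,
`z = x + i y`, `w = u + i v`. -/
abbrev S3 : Type := Metric.sphere (0 : EuclideanSpace ℝ (Fin 4)) 1

/-- The coordinate plane in which the charts of the two-sphere take their values. -/
abbrev E2 : Type := EuclideanSpace ℝ (Fin 2)

/-- The tangent bundle of the two-sphere. -/
abbrev TS2 : Type := TangentBundle (𝓡 2) S2

/-- Smooth Riemannian metrics on the two-sphere. -/
abbrev Metric2 : Type :=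
  Bundle.ContMDiffRiemannianMetric (𝓡 2) ∞ E2 (fun x : S2 => TangentSpace (𝓡 2) x)

/-! ### Tangent vectors of the two-sphere as vectors of `ℝ³` -/

/-- The differential at `x` of the inclusion of the two-sphere in `ℝ³`. -/
def ambient (x : S2) : TangentSpace (𝓡 2) x →L[ℝ] EuclideanSpace ℝ (Fin 3) :=
  mvfderiv (𝓡 2) (fun q : S2 => (q : EuclideanSpace ℝ (Fin 3))) x

theorem ambient_injective (x : S2) : Function.Injective (ambient x) :=
  have := Fact.mk (@finrank_euclideanSpace_fin ℝ _ 3)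
  injective_mvfderiv_subtypeVal_sphere (n := 2) x

/-- The tangent vector at `x` which is the vector `w` of `ℝ³` (meaningful if `w` is orthogonal
to `x`). -/
def ofAmbient (x : S2) (w : EuclideanSpace ℝ (Fin 3)) : TangentSpace (𝓡 2) x :=
  Function.invFun (ambient x) w

theorem ambient_ofAmbient (x : S2) (w : EuclideanSpace ℝ (Fin 3))
    (hw : inner ℝ (x : EuclideanSpace ℝ (Fin 3)) w = 0) : ambient x (ofAmbient x w) = w := by
  have := Fact.mk (@finrank_euclideanSpace_fin ℝ _ 3)
  have h := range_mvfderiv_subtypeVal (n := 2) x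
  have hw' : w ∈ (Submodule.span ℝ {(x : EuclideanSpace ℝ (Fin 3))})ᗮ :=
    Submodule.mem_orthogonal_singleton_iff_inner_right.2 hw
  rw [← h] at hw'
  obtain ⟨v, hv⟩ := hw'
  exact Function.invFun_eq ⟨v, hv⟩

/-! ### The Levi-Civita connection and the Gaussian curvature in charts -/

/-- The coefficients `g_{ij}` of the metric in the preferred chart at `x`, as functions on the
coordinate plane. -/
def metricCoeff (g : Metric2) (x : S2) (i j : Fin 2) (a : E2) : ℝ :=
  let q : S2 := (extChartAt (𝓡 2) x).symm a
  let d := mfderiv 𝓘(ℝ, E2) (𝓡 2) (extChartAt (𝓡 2) x).symm a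
  g.inner q (d (EuclideanSpace.single i 1)) (d (EuclideanSpace.single j 1))

/-- The Gram matrix `(g_{ij})` of the metric in the preferred chart at `x`. -/
def metricMatrix (g : Metric2) (x : S2) (a : E2) : Matrix (Fin 2) (Fin 2) ℝ :=
  Matrix.of fun i j => metricCoeff g x i j a

/-- The partial derivative `∂ᵢ f`. -/
def pd (i : Fin 2) (f : E2 → ℝ) (a : E2) : ℝ := fderiv ℝ f a (EuclideanSpace.single i 1)

/-- The Christoffel symbols `Γᵏᵢⱼ = ½ ∑ₗ gᵏˡ (∂ᵢ gⱼₗ + ∂ⱼ gᵢₗ - ∂ₗ gᵢⱼ)` in the preferred chart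
at `x`. -/
def christoffel (g : Metric2) (x : S2) (k i j : Fin 2) (a : E2) : ℝ :=
  (1 / 2) * ∑ l, (metricMatrix g x a)⁻¹ k l *
    (pd i (metricCoeff g x j l) a + pd j (metricCoeff g x i l) a - pd l (metricCoeff g x i j) a)

/-- The coefficients of the curvature tensor,
`R(∂ᵢ, ∂ⱼ) ∂ₖ = ∑ₗ Rˡᵢⱼₖ ∂ₗ` where `R(U, V) W = ∇_U ∇_V W - ∇_V ∇_U W - ∇_[U, V] W`. -/
def curvatureCoeff (g : Metric2) (x : S2) (l i j k : Fin 2) (a : E2) : ℝ :=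
  pd i (christoffel g x l j k) a - pd j (christoffel g x l i k) a +
    ∑ m, (christoffel g x m j k a * christoffel g x l i m a -
      christoffel g x m i k a * christoffel g x l j m a)

/-- The Gaussian curvature `g(R(∂₀, ∂₁) ∂₁, ∂₀) / (g₀₀ g₁₁ - g₀₁²)`. -/
def gaussianCurvature (g : Metric2) (x : S2) : ℝ :=
  let a : E2 := extChartAt (𝓡 2) x x
  (∑ l, curvatureCoeff g x l 0 1 1 a * metricCoeff g x l 0 a) / (metricMatrix g x a).det

/-! ### Horizontal and vertical lifts

With Mathlib's conventions the elements of `TangentSpace (𝓡 2) x` are coordinate vectors in the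
preferred chart at `x`, and the tangent space of the tangent bundle at `(x, v)` consists of pairs
`(δx, δv)` of coordinate vectors, with respect to the chart of the tangent bundle that the preferred
chart at `x` induces. -/

/-- The tangent space of the tangent bundle at a point. -/
abbrev TTS2 (p : TS2) : Type := TangentSpace (𝓡 2).tangent p

/-- `Γ(x)(u, w) = ∑ Γᵏᵢⱼ(x) uⁱ wʲ ∂ₖ`, in the preferred chart at `x`. -/
def christoffelMap (g : Metric2) (x : S2) (u w : E2) : E2 :=
  WithLp.toLp 2 fun k => ∑ i, ∑ j, christoffel g x k i j (extChartAt (𝓡 2) x x) * u i * w j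

/-- The connection map `K(x, v, δx, δv) = (x, δv + Γ(x)(v, δx))`. -/
def connectionMap (g : Metric2) (p : TS2) (η : TTS2 p) : TangentSpace (𝓡 2) p.proj :=
  let η' : E2 × E2 := η
  let v : E2 := p.snd
  let r : E2 := η'.2 + christoffelMap g p.proj v η'.1
  r

/-- The horizontal lift of `w` to the point `p = (x, v)`: it projects to `w` and lies in the kernel
of the connection map. -/
def horizontalLift (g : Metric2) (p : TS2) (w : TangentSpace (𝓡 2) p.proj) : TTS2 p :=
  let η : E2 × E2 := (w, -christoffelMap g p.proj p.snd w)
  η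

/-- The vertical lift of `w` to the point `p = (x, v)`: the velocity at `0` of `t ↦ v + t w`. -/
def verticalLift (p : TS2) (w : TangentSpace (𝓡 2) p.proj) : TTS2 p :=
  let η : E2 × E2 := (0, w)
  η

theorem connectionMap_horizontalLift (g : Metric2) (p : TS2) (w : TangentSpace (𝓡 2) p.proj) :
    connectionMap g p (horizontalLift g p w) = 0 :=
  neg_add_cancel (christoffelMap g p.proj p.snd w)

theorem connectionMap_verticalLift (g : Metric2) (p : TS2) (w : TangentSpace (𝓡 2) p.proj) :
    connectionMap g p (verticalLift p w) = w := by
  have h (v : E2) : christoffelMap g p.proj v (0 : E2) = (0 : E2) := by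
    ext k
    simp [christoffelMap]
  let w' : E2 := w
  let v : E2 := p.snd
  have e : w' + christoffelMap g p.proj v (0 : E2) = w' := by rw [h, add_zero]
  exact e

/-- The vector field `(x, v) ↦ v^hor` on the tangent bundle, which generates the geodesic flow. -/
def geodesicField (g : Metric2) (p : TS2) : TTS2 p := horizontalLift g p p.snd

/-! ### The geodesic frame -/

/-- The norm `√g(u, u)`. -/
def gnorm (g : Metric2) (x : S2) (u : TangentSpace (𝓡 2) x) : ℝ := √(g.inner x u u)

/-- The standard area form `det(x, v, w)` of the unit sphere (outward normal first). The pair `v`,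
`w` is positive for the orientation `o = ±1` of the two-sphere iff `0 < o * areaForm x v w`. -/
def areaForm (x : S2) (v w : TangentSpace (𝓡 2) x) : ℝ :=
  Matrix.det (Matrix.of
    ![fun i => (x : EuclideanSpace ℝ (Fin 3)) i, fun i => ambient x v i, fun i => ambient x w i])

/-- The tangent vector at `x` obtained from `v` by a quarter turn in `ℝ³` around the axis `x`,
in the sense given by the orientation `o`. -/
def quarterTurn (o : ℤˣ) (x : S2) (v : TangentSpace (𝓡 2) x) : TangentSpace (𝓡 2) x :=
  ((o : ℤ) : ℝ) • ofAmbient x (WithLp.toLp 2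
    (crossProduct (x : EuclideanSpace ℝ (Fin 3)).ofLp (ambient x v).ofLp))

/-- The vector `v^⊥`: the `g`-unit vector which is `g`-orthogonal to `v ≠ 0` and such that `v`,
`v^⊥` is a positive basis (see `perp_spec`), obtained from the Gram-Schmidt process. -/
def perp (g : Metric2) (o : ℤˣ) (x : S2) (v : TangentSpace (𝓡 2) x) : TangentSpace (𝓡 2) x :=
  let w := quarterTurn o x v - (g.inner x (quarterTurn o x v) v / g.inner x v v) • v
  (gnorm g x w)⁻¹ • w

theorem perp_spec (g : Metric2) (o : ℤˣ) (x : S2) (v : TangentSpace (𝓡 2) x) (hv : v ≠ 0) :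
    g.inner x (perp g o x v) (perp g o x v) = 1 ∧ g.inner x (perp g o x v) v = 0 ∧
      0 < ((o : ℤ) : ℝ) * areaForm x v (perp g o x v) := by
  set n : EuclideanSpace ℝ (Fin 3) := WithLp.toLp 2
    (crossProduct (x : EuclideanSpace ℝ (Fin 3)).ofLp (ambient x v).ofLp) with hn
  have hxn : inner ℝ (x : EuclideanSpace ℝ (Fin 3)) n = 0 := by
    simp [hn, PiLp.inner_apply, Fin.sum_univ_three, cross_apply]
    ring
  have ha : ambient x (ofAmbient x n) = n := ambient_ofAmbient x n hxn
  have hx : ‖(x : EuclideanSpace ℝ (Fin 3))‖ = 1 := norm_eq_of_mem_sphere x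
  have hxv : inner ℝ (x : EuclideanSpace ℝ (Fin 3)) (ambient x v) = 0 := by
    have := Fact.mk (@finrank_euclideanSpace_fin ℝ _ 3)
    have h := range_mvfderiv_subtypeVal (n := 2) x
    refine Submodule.mem_orthogonal_singleton_iff_inner_right.1 ?_
    rw [← h]
    exact ⟨v, rfl⟩
  have hav : ambient x v ≠ 0 := fun h => hv (ambient_injective x (h.trans (map_zero _).symm))
  set w := quarterTurn o x v - (g.inner x (quarterTurn o x v) v / g.inner x v v) • v with hw
  have ho : ((o : ℤ) : ℝ) * ((o : ℤ) : ℝ) = 1 := by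
    rcases Int.units_eq_one_or o with h | h <;> simp [h]
  have hgv := g.pos x v hv
  have hperp : g.inner x w v = 0 := by
    simp only [hw, map_sub, map_smul, sub_apply,
      smul_apply, smul_eq_mul]
    field_simp
    ring
  have hareaw : ((o : ℤ) : ℝ) * areaForm x v w = ‖ambient x v‖ ^ 2 := by
    have e : ambient x w = ((o : ℤ) : ℝ) • n -
        (g.inner x (quarterTurn o x v) v / g.inner x v v) • ambient x v := by
      rw [hw, map_sub, map_smul, quarterTurn, map_smul, ← hn, ha]
    have hx2 : ‖(x : EuclideanSpace ℝ (Fin 3))‖ ^ 2 = 1 := by rw [hx]; norm_num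
    simp only [areaForm, e]
    rw [EuclideanSpace.norm_sq_eq] at hx2 ⊢
    simp only [PiLp.inner_apply, Fin.sum_univ_three, Real.norm_eq_abs, sq_abs] at hx2 hxv ⊢
    simp [Matrix.det_fin_three, hn, cross_apply] at hxv ⊢
    generalize ambient x v = V at *
    generalize (x : EuclideanSpace ℝ (Fin 3)) = X at *
    linear_combination (((X 0) ^ 2 + (X 1) ^ 2 + (X 2) ^ 2) *
      ((V 0) ^ 2 + (V 1) ^ 2 + (V 2) ^ 2) -
      (X 0 * V 0 + X 1 * V 1 + X 2 * V 2) ^ 2) * ho +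
      ((V 0) ^ 2 + (V 1) ^ 2 + (V 2) ^ 2) * hx2 -
      (X 0 * V 0 + X 1 * V 1 + X 2 * V 2) * hxv
  have hvpos : 0 < ‖ambient x v‖ ^ 2 := by positivity
  have hw0 : w ≠ 0 := by
    intro h
    rw [h] at hareaw
    simp [areaForm, Matrix.det_fin_three] at hareaw
    exact hav (by simpa using hareaw.symm)
  have hgw := g.pos x w hw0
  have hs : gnorm g x w * gnorm g x w = g.inner x w w := Real.mul_self_sqrt hgw.le
  have hs0 : 0 < gnorm g x w := Real.sqrt_pos.2 hgw
  have hp : perp g o x v = (gnorm g x w)⁻¹ • w := rfl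
  refine ⟨?_, ?_, ?_⟩
  · simp only [hp, map_smul, smul_apply, smul_eq_mul, ← hs]
    field_simp
  · simp only [hp, map_smul, smul_apply, smul_eq_mul, hperp, mul_zero]
  · have e : areaForm x v (perp g o x v) = (gnorm g x w)⁻¹ * areaForm x v w := by
      simp only [areaForm, hp, map_smul, Matrix.det_fin_three]
      simp
      ring
    rw [e, mul_left_comm, hareaw]
    positivity

/-- The geodesic frame `σ_g(x, v) = {(v^⊥)^vert, (v^⊥)^hor}`. -/
def geodesicFrame (g : Metric2) (o : ℤˣ) (p : TS2) : Fin 2 → TTS2 p :=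
  ![verticalLift p (perp g o p.proj p.snd), horizontalLift g p (perp g o p.proj p.snd)]

/-! ### The double covering of the unit tangent bundle by the three-sphere -/

/-- The identification of the three-sphere with `SU(2)`. -/
def toSU2 (Z : S3) : Matrix (Fin 2) (Fin 2) ℂ :=
  let z : ℂ := ⟨(Z : EuclideanSpace ℝ (Fin 4)) 0, (Z : EuclideanSpace ℝ (Fin 4)) 1⟩
  let w : ℂ := ⟨(Z : EuclideanSpace ℝ (Fin 4)) 2, (Z : EuclideanSpace ℝ (Fin 4)) 3⟩
  !![z, w; -(starRingEnd ℂ) w, (starRingEnd ℂ) z]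

/-- The coordinates `(y, u, v)` of a matrix with first row `(x + i y, u + i v)`; they identify the
elements of `SU(2)` with `x = 0` with the points of the two-sphere. -/
def imCoord (A : Matrix (Fin 2) (Fin 2) ℂ) : EuclideanSpace ℝ (Fin 3) :=
  !₂[(A 0 0).im, (A 0 1).re, (A 0 1).im]

/-- The matrix `j`. -/
def matJ : Matrix (Fin 2) (Fin 2) ℂ := !![0, 1; -1, 0]

/-- The matrix `k`. -/
def matK : Matrix (Fin 2) (Fin 2) ℂ := !![0, Complex.I; Complex.I, 0]

theorem sum_sq_eq_one (Z : S3) :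
    (Z : EuclideanSpace ℝ (Fin 4)) 0 ^ 2 + (Z : EuclideanSpace ℝ (Fin 4)) 1 ^ 2 +
      (Z : EuclideanSpace ℝ (Fin 4)) 2 ^ 2 + (Z : EuclideanSpace ℝ (Fin 4)) 3 ^ 2 = 1 := by
  have h : ‖(Z : EuclideanSpace ℝ (Fin 4))‖ ^ 2 = 1 := by rw [norm_eq_of_mem_sphere]; norm_num
  rw [EuclideanSpace.norm_sq_eq] at h
  simpa [Fin.sum_univ_four] using h

theorem toSU2_inv (Z : S3) : (toSU2 Z)⁻¹ = (toSU2 Z).conjTranspose := by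
  have h := sum_sq_eq_one Z
  refine Matrix.inv_eq_right_inv ?_
  ext i j
  fin_cases i <;> fin_cases j <;>
    simp [toSU2, Matrix.mul_apply, Complex.ext_iff] <;>
    constructor <;> linarith

theorem norm_imCoord_j (Z : S3) : ‖imCoord ((toSU2 Z)⁻¹ * matJ * toSU2 Z)‖ = 1 := by
  have h := sum_sq_eq_one Z
  have e : ‖imCoord ((toSU2 Z)⁻¹ * matJ * toSU2 Z)‖ ^ 2 = 1 := by
    rw [EuclideanSpace.norm_sq_eq, toSU2_inv]
    simp [Fin.sum_univ_three, imCoord, matJ, toSU2, Matrix.mul_apply]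
    generalize (Z : EuclideanSpace ℝ (Fin 4)) = p at *
    linear_combination ((p 0) ^ 2 + (p 1) ^ 2 + (p 2) ^ 2 + (p 3) ^ 2 + 1) * h
  nlinarith [norm_nonneg (imCoord ((toSU2 Z)⁻¹ * matJ * toSU2 Z))]

/-- The foot point `Z⁻¹ j Z` of `D₀(Z)`. -/
def coverBase (Z : S3) : S2 :=
  ⟨imCoord ((toSU2 Z)⁻¹ * matJ * toSU2 Z), mem_sphere_zero_iff_norm.2 (norm_imCoord_j Z)⟩

/-- The double covering `D₀(Z) = (Z⁻¹ j Z, -Z⁻¹ k Z)` of the unit tangent bundle of the round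
sphere. -/
def roundCover (Z : S3) : TS2 :=
  ⟨coverBase Z, ofAmbient (coverBase Z) (imCoord (-((toSU2 Z)⁻¹ * matK * toSU2 Z)))⟩

theorem ambient_roundCover (Z : S3) :
    ambient (coverBase Z) (roundCover Z).snd = imCoord (-((toSU2 Z)⁻¹ * matK * toSU2 Z)) := by
  refine ambient_ofAmbient _ _ ?_
  have e : ((coverBase Z : S2) : EuclideanSpace ℝ (Fin 3)) =
      imCoord ((toSU2 Z)⁻¹ * matJ * toSU2 Z) := rfl
  rw [e, toSU2_inv]
  simp [PiLp.inner_apply, Fin.sum_univ_three, imCoord, matJ, matK, toSU2, Matrix.mul_apply]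
  ring

/-- The Legendre transform `v ↦ g₀(v, ·)` of the round metric. -/
def roundLegendre (x : S2) (v : TangentSpace (𝓡 2) x) : TangentSpace (𝓡 2) x →L[ℝ] ℝ :=
  (innerSL ℝ (ambient x v)).comp (ambient x)

/-- The inverse of the Legendre transform of `g`: the tangent vector `u` with `g(u, ·) = α`. -/
def sharp (g : Metric2) (x : S2) (α : TangentSpace (𝓡 2) x →L[ℝ] ℝ) : TangentSpace (𝓡 2) x :=
  Function.invFun (g.inner x) α

theorem inner_sharp (g : Metric2) (x : S2) (α : TangentSpace (𝓡 2) x →L[ℝ] ℝ) :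
    g.inner x (sharp g x α) = α := by
  let L : E2 →ₗ[ℝ] (E2 →L[ℝ] ℝ) :=
    { toFun := fun v => g.inner x v
      map_add' := fun v w => map_add (g.inner x) v w
      map_smul' := fun c v => map_smul (g.inner x) c v }
  have hinj : Function.Injective L := by
    refine (injective_iff_map_eq_zero L).2 fun v hv => ?_
    by_contra hne
    have h1 := g.pos x v hne
    have h2 : g.inner x v v = 0 := congrArg (fun f : E2 →L[ℝ] ℝ => f v) hv
    exact h1.ne' h2
  have hdim : Module.finrank ℝ E2 = Module.finrank ℝ (E2 →L[ℝ] ℝ) :=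
    Subspace.dual_finrank_eq.symm.trans
      (LinearMap.toContinuousLinearMap (𝕜 := ℝ) (E := E2) (F' := ℝ)).finrank_eq
  exact Function.invFun_eq
    ((LinearMap.injective_iff_surjective_of_finrank_eq_finrank hdim).1 hinj α)

/-- The projection `α ↦ α / F_g(α)` of the nonzero covectors to the unit ones, where `F_g` is the
norm dual to `g`. -/
def unitCovector (g : Metric2) (x : S2) (α : TangentSpace (𝓡 2) x →L[ℝ] ℝ) :
    TangentSpace (𝓡 2) x →L[ℝ] ℝ :=
  (gnorm g x (sharp g x α))⁻¹ • α

/-- The double covering `D_g` of the unit tangent bundle of `g`: apply `D₀`, the Legendre transform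
of the round metric, the projection to the unit covectors of `g` and the inverse of the Legendre
transform of `g`. -/
def cover (g : Metric2) (Z : S3) : TS2 :=
  let q := roundCover Z
  ⟨q.proj, sharp g q.proj (unitCovector g q.proj (roundLegendre q.proj q.snd))⟩

/-- The restriction to the three-sphere of the form `λ₀ = ½ (x dy - y dx + u dv - v du)`. -/
def liouville (Z : S3) : TangentSpace (𝓡 3) Z →ₗ[ℝ] ℝ where
  toFun ζ :=
    let p : EuclideanSpace ℝ (Fin 4) := Z
    let η := mvfderiv (𝓡 3) (fun q : S3 => (q : EuclideanSpace ℝ (Fin 4))) Z ζ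
    (1 / 2) * (p 0 * η 1 - p 1 * η 0 + p 2 * η 3 - p 3 * η 2)
  map_add' ζ η := by simp only [map_add, PiLp.add_apply]; ring
  map_smul' c ζ := by simp only [map_smul, PiLp.smul_apply, smul_eq_mul, RingHom.id_apply]; ring

/-- The contact structure `ξ = ker λ₀`. -/
def contactPlane (Z : S3) : Submodule ℝ (TangentSpace (𝓡 3) Z) := LinearMap.ker (liouville Z)

/-- The differential of `D_g`. -/
def coverDeriv (g : Metric2) (Z : S3) : TangentSpace (𝓡 3) Z →L[ℝ] TTS2 (cover g Z) :=
  mfderiv (𝓡 3) (𝓡 2).tangent (cover g) Z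

/-- The lift to the three-sphere by `D_g` of the geodesic frame: `dD_g` maps it to the geodesic
frame. -/
def liftedFrame (g : Metric2) (o : ℤˣ) (Z : S3) (i : Fin 2) : TangentSpace (𝓡 3) Z :=
  Function.invFun (coverDeriv g Z) (geodesicFrame g o (cover g Z) i)

/-! ### The lifted geodesic flow and its linearisation -/

/-- `φ` is the lift by `D_g` of the geodesic flow of `g`: it is smooth, and `D_g` maps its
trajectories to trajectories of the geodesic flow. -/
structure IsLiftedGeodesicFlow (g : Metric2) (φ : Flow ℝ S3) : Prop where
  smooth : ContMDiff (𝓘(ℝ, ℝ).prod (𝓡 3)) (𝓡 3) ∞ (fun q : ℝ × S3 => φ q.1 q.2)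
  lift (Z : S3) : IsMIntegralCurve (I := (𝓡 2).tangent) (fun t : ℝ => cover g (φ t Z))
    (geodesicField g)

/-- The linearised flow `Dφᵗ`. -/
def linearised (φ : Flow ℝ S3) (t : ℝ) (Z : S3) :
    TangentSpace (𝓡 3) Z →L[ℝ] TangentSpace (𝓡 3) (φ t Z) :=
  mfderiv (𝓡 3) (𝓡 3) (φ t) Z

open Classical in
/-- The circle coordinate on nonzero vectors of a plane spanned by `e 0` and `e 1`: the angle `θ`
such that `ζ` is a positive multiple of `cos θ e₀ + sin θ e₁`. It depends only on the ray of
`ζ`. -/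
def circleCoord {V : Type*} [AddCommGroup V] [Module ℝ V] (e : Fin 2 → V) (ζ : V) : Real.Angle :=
  if h : ∃ θ : Real.Angle, ∃ r : ℝ, 0 < r ∧ ζ = r • (θ.cos • e 0 + θ.sin • e 1) then h.choose else 0

/-- The circle-valued curve `α` is differentiable at `t` with angular velocity `c`: near `t` it has
a real-valued lift with derivative `c` at `t`. -/
def HasAngularVelocityAt (α : ℝ → Real.Angle) (c t : ℝ) : Prop :=
  ∃ θ : ℝ → ℝ, (∀ᶠ s in nhds t, (θ s : Real.Angle) = α s) ∧ HasDerivAt θ c t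

end GeodesicLift

end

noncomputable section

namespace GeodesicLift

open Filter Topology

/-! Write a contact vector as `ζ = a σ̃₁ + b σ̃₂`. Its image under `dD_g` is a variation of a unit
speed geodesic with horizontal part `J = b v^⊥` and connection part `K = a v^⊥`. Along the flow `∇J
= K` and `∇K = R(v, J) v = -κ b v^⊥`, while `v^⊥` is parallel. So `b' = a`, `a' = -κ b`, and the
angle of `(a, b)` has derivative `(a b' - b a') / (a² + b²) = (a² + κ b²) / (a² + b²)`. This is a
weighted mean of `1` and `κ`, whence the bounds.

The computation is made in one stereographic chart, fixed at the foot point at time zero.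
`IsLeviCivita` abstracts a metric and its Christoffel map on a vector space, and
`IsLeviCivita.jacobi` is the Jacobi equation there. No derivative of `v^⊥` is taken: `a` and `b` are
read off from the coordinate determinants `A = v ∧ K` and `B = v ∧ J`, which are `a` and `b` times
`v ∧ v^⊥`. Differentiation produces extra terms `-τ A` and `-τ B`, where `τ` is the trace of `Γ(v,
·)` (`IsLeviCivita.hasDerivAt_wedge_variation`); they cancel in `A B' - B A'`. The factor `v ∧ v^⊥`
has locally constant sign because `v, v^⊥` is positively oriented, so it does not disturb the
angular velocity (`exists_hasAngularVelocityAt_of_coords`).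

For the statements on `ξ`: `dD_g` is injective (`eq_zero_of_coverVel`), and by dimension its image
is the hyperplane `g(K, v) = 0` (`exists_coverVel_eq`), which contains the geodesic frame. The
vector `v` is `g`-dual to a positive multiple of `⟪V, ·⟫`, where `V` is the vector component of
`D₀`, and `⟪V, dX⟫ = 4 λ₀` for the foot point `X`. Hence `ξ` is the plane `g(v, J) = 0`, spanned by
the lifted frame. The function `g(v, J)` is constant along the flow, since its derivative is `g(v,
K) = 0`; so `Dφᵗ` preserves `ξ`. -/

theorem minSmoothness_le_infty : minSmoothness ℝ 2 ≤ ∞ := by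
  rw [minSmoothness_of_isRCLikeNormedField]
  exact WithTop.coe_le_coe.2 (le_top : (2 : ℕ∞) ≤ ⊤)

/-! ### Levi-Civita calculus on a vector space: Koszul formula, curvature, Jacobi equation. -/

section LeviCivita

variable {E : Type*} [NormedAddCommGroup E] [NormedSpace ℝ E]

/-- `Γ` is the Christoffel map of the Riemannian metric `G` on the vector space `E`. -/
structure IsLeviCivita (G : E → E →L[ℝ] E →L[ℝ] ℝ) (Γ : E → E →L[ℝ] E →L[ℝ] E) : Prop where
  contDiff_metric : ContDiff ℝ ∞ G
  contDiff_christoffel : ContDiff ℝ ∞ Γ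
  symm (a U V : E) : G a U V = G a V U
  pos (a U : E) : U ≠ 0 → 0 < G a U U
  koszul (a U V W : E) : 2 * G a (Γ a U V) W =
    fderiv ℝ G a U V W + fderiv ℝ G a V U W - fderiv ℝ G a W U V

/-- The curvature `R(U, V) W` of a Christoffel map. -/
def localCurvature (Γ : E → E →L[ℝ] E →L[ℝ] E) (a U V W : E) : E :=
  fderiv ℝ Γ a U V W - fderiv ℝ Γ a V U W + Γ a U (Γ a V W) - Γ a V (Γ a U W)

variable {G G' : E → E →L[ℝ] E →L[ℝ] ℝ} {Γ Γ' : E → E →L[ℝ] E →L[ℝ] E}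

theorem fderiv_clm₂_apply {F : Type*} [NormedAddCommGroup F] [NormedSpace ℝ F]
    {B : E → E →L[ℝ] E →L[ℝ] F} {a : E} (h : DifferentiableAt ℝ B a) (V W U : E) :
    fderiv ℝ (fun q => B q V W) a U = fderiv ℝ B a U V W := by
  have h1 : HasFDerivAt (fun q => B q V W) _ a :=
    (h.hasFDerivAt.clm_apply (hasFDerivAt_const V a)).clm_apply (hasFDerivAt_const W a)
  rw [h1.fderiv]
  simp

namespace IsLeviCivita

theorem differentiableAt_metric (h : IsLeviCivita G Γ) (a : E) : DifferentiableAt ℝ G a :=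
  h.contDiff_metric.differentiable (by simp) a

theorem differentiableAt_christoffel (h : IsLeviCivita G Γ) (a : E) : DifferentiableAt ℝ Γ a :=
  h.contDiff_christoffel.differentiable (by simp) a

theorem fderiv_symm (h : IsLeviCivita G Γ) (a U V W : E) :
    fderiv ℝ G a U V W = fderiv ℝ G a U W V := by
  rw [← fderiv_clm₂_apply (h.differentiableAt_metric a) V W,
    ← fderiv_clm₂_apply (h.differentiableAt_metric a) W V]
  simp only [h.symm _ V W]

theorem eq_of_inner_eq (h : IsLeviCivita G Γ) {a U V : E} (huv : ∀ W, G a U W = G a V W) :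
    U = V := by
  by_contra hne
  have h1 := h.pos a (U - V) (sub_ne_zero.2 hne)
  have h2 : G a (U - V) (U - V) = G a U (U - V) - G a V (U - V) := by
    rw [(G a).map_sub, sub_apply]
  linarith [huv (U - V)]

/-- Exchanging `U` and `V` swaps the first two terms of the Koszul formula and fixes the third. -/
theorem christoffel_symm (h : IsLeviCivita G Γ) (a U V : E) : Γ a U V = Γ a V U := by
  refine h.eq_of_inner_eq (a := a) fun W => ?_
  have h1 := h.koszul a U V W
  have h2 := h.koszul a V U W
  have h3 := h.fderiv_symm a W U V
  linarith

theorem fderiv_christoffel_symm (h : IsLeviCivita G Γ) (a U V W : E) :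
    fderiv ℝ Γ a U V W = fderiv ℝ Γ a U W V := by
  rw [← fderiv_clm₂_apply (h.differentiableAt_christoffel a) V W,
    ← fderiv_clm₂_apply (h.differentiableAt_christoffel a) W V]
  simp only [h.christoffel_symm _ V W]

/-- The Koszul formulas for `(U, V, W)` and `(U, W, V)` add up to twice the left-hand side. -/
theorem compat (h : IsLeviCivita G Γ) (a U V W : E) :
    fderiv ℝ G a U V W = G a (Γ a U V) W + G a V (Γ a U W) := by
  have h1 := h.koszul a U V W
  have h2 := h.koszul a U W V
  have h3 := h.fderiv_symm a U V W
  have h4 := h.fderiv_symm a V U W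
  have h5 := h.fderiv_symm a W U V
  rw [h.symm a V]
  linarith

/-- By compatibility, the second derivative of `q ↦ G q W W` in the directions `V`, `U` is an
expression in `Γ` and its derivative. Its antisymmetric part in `U`, `V` is a multiple of the
left-hand side, and it vanishes because second derivatives commute. -/
theorem inner_localCurvature_self (h : IsLeviCivita G Γ) (a U V W : E) :
    G a (localCurvature Γ a U V W) W = 0 := by
  set φ : E → ℝ := fun q => G q W W with hφ
  have hφs : ContDiff ℝ ∞ φ :=
    (h.contDiff_metric.clm_apply contDiff_const).clm_apply contDiff_const
  have hφ1 (q U : E) : fderiv ℝ φ q U = 2 * G q (Γ q U W) W := by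
    rw [hφ, fderiv_clm₂_apply (h.differentiableAt_metric q), h.compat, h.symm q W]
    ring
  have key (U V : E) : fderiv ℝ (fderiv ℝ φ) a V U =
      2 * (G a (Γ a V (Γ a U W)) W + G a (Γ a U W) (Γ a V W) +
        G a (fderiv ℝ Γ a V U W) W) := by
    have hφ2 : DifferentiableAt ℝ (fderiv ℝ φ) a :=
      (hφs.fderiv_right (m := ∞) (by simp)).differentiable (by simp) a
    have h1 : HasFDerivAt (fun q => fderiv ℝ φ q U) _ a :=
      hφ2.hasFDerivAt.clm_apply (hasFDerivAt_const U a)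
    have h2 : HasFDerivAt (fun q => 2 * G q (Γ q U W) W) _ a :=
      (((h.differentiableAt_metric a).hasFDerivAt.clm_apply
        (((h.differentiableAt_christoffel a).hasFDerivAt.clm_apply
          (hasFDerivAt_const U a)).clm_apply (hasFDerivAt_const W a))).clm_apply
          (hasFDerivAt_const W a)).const_mul 2
    simp only [hφ1] at h1
    have := congrArg (fun L => L V) (h1.unique h2)
    simp at this
    rw [this, h.compat]
    ring
  have hs : fderiv ℝ (fderiv ℝ φ) a V U = fderiv ℝ (fderiv ℝ φ) a U V :=
    (hφs.contDiffAt.isSymmSndFDerivAt minSmoothness_le_infty).eq V U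
  have h1 := key U V
  have h2 := key V U
  rw [hs] at h1
  have h3 := h.symm a (Γ a U W) (Γ a V W)
  simp only [localCurvature, map_add, map_sub, add_apply, sub_apply]
  linarith

theorem inner_localCurvature_skew (h : IsLeviCivita G Γ) (a U V W X : E) :
    G a (localCurvature Γ a U V W) X = - G a (localCurvature Γ a U V X) W := by
  have h1 := h.inner_localCurvature_self a U V (W + X)
  have h2 := h.inner_localCurvature_self a U V W
  have h3 := h.inner_localCurvature_self a U V X
  have e : localCurvature Γ a U V (W + X) =
      localCurvature Γ a U V W + localCurvature Γ a U V X := by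
    simp only [localCurvature, map_add]
    abel
  simp only [e, map_add, add_apply] at h1
  linarith

/-- The transformation law of the Christoffel map under a change of coordinates. -/
theorem map_christoffel (h : IsLeviCivita G Γ) (h' : IsLeviCivita G' Γ') {ψ : E → E} {a : E}
    (hψ : ContDiffAt ℝ ∞ ψ a) (hsurj : Function.Surjective (fderiv ℝ ψ a))
    (hG : ∀ᶠ q in 𝓝 a, ∀ U V, G' q U V = G (ψ q) (fderiv ℝ ψ q U) (fderiv ℝ ψ q V)) (U V : E) :
    fderiv ℝ ψ a (Γ' a U V) =
      Γ (ψ a) (fderiv ℝ ψ a U) (fderiv ℝ ψ a V) + fderiv ℝ (fderiv ℝ ψ) a U V := by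
  have hψ1 : HasFDerivAt ψ (fderiv ℝ ψ a) a := (hψ.differentiableAt (by simp)).hasFDerivAt
  have hψ2 : HasFDerivAt (fderiv ℝ ψ) (fderiv ℝ (fderiv ℝ ψ) a) a :=
    ((hψ.fderiv_right (m := ∞) (by simp)).differentiableAt (by simp)).hasFDerivAt
  have hsy (U V : E) : fderiv ℝ (fderiv ℝ ψ) a U V = fderiv ℝ (fderiv ℝ ψ) a V U :=
    (hψ.isSymmSndFDerivAt minSmoothness_le_infty).eq U V
  -- Derivative at `a`, in the direction `W`, of the isometry relation `hG`.
  have key (U V W : E) : fderiv ℝ G' a W U V =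
      fderiv ℝ G (ψ a) (fderiv ℝ ψ a W) (fderiv ℝ ψ a U) (fderiv ℝ ψ a V) +
      G (ψ a) (fderiv ℝ (fderiv ℝ ψ) a W U) (fderiv ℝ ψ a V) +
      G (ψ a) (fderiv ℝ ψ a U) (fderiv ℝ (fderiv ℝ ψ) a W V) := by
    have h1 : HasFDerivAt (fun q => G' q U V) _ a :=
      ((h'.differentiableAt_metric a).hasFDerivAt.clm_apply (hasFDerivAt_const U a)).clm_apply
        (hasFDerivAt_const V a)
    have h2 : HasFDerivAt (fun q => G (ψ q) (fderiv ℝ ψ q U) (fderiv ℝ ψ q V)) _ a :=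
      (((h.differentiableAt_metric (ψ a)).hasFDerivAt.comp a hψ1).clm_apply
        (hψ2.clm_apply (hasFDerivAt_const U a))).clm_apply
        (hψ2.clm_apply (hasFDerivAt_const V a))
    have h3 := h2.congr_of_eventuallyEq (f₁ := fun q => G' q U V) (hG.mono fun q hq => hq U V)
    have := congrArg (fun L => L W) (h1.unique h3)
    simp at this
    rw [this]
    ring
  refine h.eq_of_inner_eq (a := ψ a) fun W' => ?_
  obtain ⟨W, rfl⟩ := hsurj W'
  have hk' := h'.koszul a U V W
  have hk := h.koszul (ψ a) (fderiv ℝ ψ a U) (fderiv ℝ ψ a V) (fderiv ℝ ψ a W)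
  rw [hG.self_of_nhds, key, key, key] at hk'
  rw [map_add, add_apply]
  -- In the Koszul combination the second derivative terms cancel, by the symmetry of `D²ψ` and `G`,
  -- except for twice `G (D²ψ(U, V)) (dψ W)`.
  have s1 := hsy V U
  have s2 := hsy W U
  have s3 := hsy W V
  rw [s1, s2, s3, h.symm _ (fderiv ℝ ψ a U) (fderiv ℝ (fderiv ℝ ψ) a V W),
    h.symm _ (fderiv ℝ ψ a V) (fderiv ℝ (fderiv ℝ ψ) a U W)] at hk'
  linarith

end IsLeviCivita

set_option maxSynthPendingDepth 10 in
/-- The Jacobi equation for a variation `f(s, ε) = (x, v)` of solutions of the geodesic equation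
`x' = v`, `v' = -Γ(v, v)`. -/
theorem IsLeviCivita.jacobi (h : IsLeviCivita G Γ) {f : ℝ × ℝ → E × E}
    (hf : ContDiffAt ℝ ∞ f 0)
    (hgeo : ∀ᶠ p in 𝓝 (0 : ℝ × ℝ),
      fderiv ℝ f p (1, 0) = ((f p).2, - Γ (f p).1 (f p).2 (f p).2)) :
    let x := (f 0).1
    let v := (f 0).2
    let ξ := (fderiv ℝ f 0 (0, 1)).1
    let K := (fderiv ℝ f 0 (0, 1)).2 + Γ x v ξ
    HasDerivAt (fun s : ℝ => (f (s, 0)).1) v 0 ∧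
    HasDerivAt (fun s : ℝ => (f (s, 0)).2) (- Γ x v v) 0 ∧
    HasDerivAt (fun s : ℝ => (fderiv ℝ f (s, 0) (0, 1)).1) (K - Γ x v ξ) 0 ∧
    HasDerivAt (fun s : ℝ => (fderiv ℝ f (s, 0) (0, 1)).2 +
        Γ (f (s, 0)).1 (f (s, 0)).2 (fderiv ℝ f (s, 0) (0, 1)).1)
      (localCurvature Γ x v ξ v - Γ x v K) 0 := by
  intro x v ξ K
  have hline : HasDerivAt (fun s : ℝ => ((s, 0) : ℝ × ℝ)) (1, 0) 0 :=
    (hasDerivAt_id (0 : ℝ)).prodMk (hasDerivAt_const (0 : ℝ) (0 : ℝ))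
  have hf1 : HasFDerivAt f (fderiv ℝ f 0) 0 := (hf.differentiableAt (by simp)).hasFDerivAt
  have hf2 : HasFDerivAt (fderiv ℝ f) (fderiv ℝ (fderiv ℝ f) 0) 0 :=
    ((hf.fderiv_right (m := ∞) (by simp)).differentiableAt (by simp)).hasFDerivAt
  have hsy : fderiv ℝ (fderiv ℝ f) 0 (1, 0) (0, 1) = fderiv ℝ (fderiv ℝ f) 0 (0, 1) (1, 0) :=
    (hf.isSymmSndFDerivAt minSmoothness_le_infty).eq _ _
  have h0 : HasDerivAt (fun s : ℝ => f (s, 0)) (v, - Γ x v v) 0 := by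
    have := HasFDerivAt.comp_hasDerivAt (f := fun s : ℝ => ((s, 0) : ℝ × ℝ)) (0 : ℝ) hf1 hline
    rwa [hgeo.self_of_nhds] at this
  have hΓ : HasFDerivAt Γ (fderiv ℝ Γ x) x := (h.differentiableAt_christoffel x).hasFDerivAt
  have hx : HasDerivAt (fun s : ℝ => (f (s, 0)).1) v 0 := h0.fst
  have hv : HasDerivAt (fun s : ℝ => (f (s, 0)).2) (- Γ x v v) 0 := h0.snd
  have hJ : HasDerivAt (fun s : ℝ => fderiv ℝ f (s, 0) (0, 1))
      (fderiv ℝ (fderiv ℝ f) 0 (1, 0) (0, 1)) 0 := by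
    have := (HasFDerivAt.comp_hasDerivAt (f := fun s : ℝ => ((s, 0) : ℝ × ℝ)) (0 : ℝ) hf2 hline).clm_apply (hasDerivAt_const (0 : ℝ) (0, 1))
    simpa using this
  -- The mixed derivative is found by exchanging the order and differentiating the geodesic equation
  -- in `ε`.
  have e : fderiv ℝ (fderiv ℝ f) 0 (1, 0) (0, 1) = ((fderiv ℝ f 0 (0, 1)).2,
      - (fderiv ℝ Γ x ξ v v + Γ x (fderiv ℝ f 0 (0, 1)).2 v + Γ x v (fderiv ℝ f 0 (0, 1)).2)) := by
    rw [hsy]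
    have h1 : HasFDerivAt (fun p => fderiv ℝ f p (1, 0)) _ 0 :=
      hf2.clm_apply (hasFDerivAt_const (1, 0) 0)
    have h2 : HasFDerivAt (fun p => ((f p).2, - Γ (f p).1 (f p).2 (f p).2)) _ 0 :=
      hf1.snd.prodMk (((HasFDerivAt.comp (0 : ℝ × ℝ) (f := fun p => (f p).1) hΓ hf1.fst).clm_apply
        hf1.snd).clm_apply hf1.snd).neg
    have h3 := h2.congr_of_eventuallyEq (f₁ := fun p => fderiv ℝ f p (1, 0)) hgeo
    have := congrArg (fun L => L (0, 1)) (h1.unique h3)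
    simp at this
    rw [this]
    refine Prod.ext rfl ?_
    simp only [ξ, v, x]
    abel
  rw [e] at hJ
  have hξ : HasDerivAt (fun s : ℝ => (fderiv ℝ f (s, 0) (0, 1)).1) (fderiv ℝ f 0 (0, 1)).2 0 :=
    hJ.fst
  have hη : HasDerivAt (fun s : ℝ => (fderiv ℝ f (s, 0) (0, 1)).2) _ 0 := hJ.snd
  have hΓx : HasDerivAt (fun s : ℝ => Γ (f (s, 0)).1) (fderiv ℝ Γ x v) 0 :=
    HasFDerivAt.comp_hasDerivAt (f := fun s : ℝ => (f (s, 0)).1) (0 : ℝ) hΓ hx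
  refine ⟨hx, hv, hξ.congr_deriv (by simp [K]), ?_⟩
  refine (hη.add ((hΓx.clm_apply hv).clm_apply hξ)).congr_deriv ?_
  have e0 : f (0, 0) = f 0 := rfl
  have e1 : fderiv ℝ f (0, 0) = fderiv ℝ f 0 := rfl
  simp only [localCurvature, K, map_add, map_neg, add_apply, neg_apply, e0, e1]
  -- The symmetry of `Γ` and of its derivative puts all terms in the order in which they occur in
  -- `R(v, ξ) v`; the remaining ones form `-Γ(v, K)`.
  rw [h.christoffel_symm x ξ (Γ x v v), h.christoffel_symm x (fderiv ℝ f 0 (0, 1)).2 v,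
    h.fderiv_christoffel_symm x v ξ v]
  rw [h.christoffel_symm x ξ v]
  simp only [ξ, v, x]
  abel

end LeviCivita

/-! ### Determinants and curvature in dimension two. -/

section Plane

/-- The standard basis vectors of the coordinate plane. -/
abbrev e2 (i : Fin 2) : E2 := EuclideanSpace.single i 1

theorem eq_sum_e2 (u : E2) : u = u 0 • e2 0 + u 1 • e2 1 := by
  ext i
  fin_cases i <;> simp

/-- The determinant of a pair of vectors of the coordinate plane. -/
def wedge (u w : E2) : ℝ := u 0 * w 1 - u 1 * w 0

/-- The infinitesimal form of `det (L u, L w) = det L · det (u, w)`; the factor on the right is the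
trace of `L`. It is what makes the Christoffel terms in `A'` and `B'` a common multiple of `A` and
`B`. -/
theorem wedge_map_add (L : E2 →L[ℝ] E2) (u w : E2) :
    wedge (L u) w + wedge u (L w) = (L (e2 0) 0 + L (e2 1) 1) * wedge u w := by
  have hu : L u = u 0 • L (e2 0) + u 1 • L (e2 1) := by
    conv_lhs => rw [eq_sum_e2 u]
    simp
  have hw : L w = w 0 • L (e2 0) + w 1 • L (e2 1) := by
    conv_lhs => rw [eq_sum_e2 w]
    simp
  rw [hu, hw]
  simp only [wedge, PiLp.add_apply, PiLp.smul_apply, smul_eq_mul]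
  ring

theorem clm₂_apply_eq (B : E2 →L[ℝ] E2 →L[ℝ] ℝ) (u w : E2) :
    B u w = u 0 * w 0 * B (e2 0) (e2 0) + u 0 * w 1 * B (e2 0) (e2 1) +
      u 1 * w 0 * B (e2 1) (e2 0) + u 1 * w 1 * B (e2 1) (e2 1) := by
  conv_lhs => rw [eq_sum_e2 u, eq_sum_e2 w]
  simp only [map_add, map_smul, add_apply, smul_apply, smul_eq_mul]
  ring

/-- The determinant of the Gram matrix of a bilinear form on the coordinate plane. -/
def gram (B : E2 →L[ℝ] E2 →L[ℝ] ℝ) : ℝ :=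
  B (e2 0) (e2 0) * B (e2 1) (e2 1) - B (e2 0) (e2 1) * B (e2 1) (e2 0)

theorem wedge_sq_mul_gram (B : E2 →L[ℝ] E2 →L[ℝ] ℝ) (u w : E2) :
    wedge u w ^ 2 * gram B = B u u * B w w - B u w * B w u := by
  rw [clm₂_apply_eq B u u, clm₂_apply_eq B w w, clm₂_apply_eq B u w, clm₂_apply_eq B w u, gram,
    wedge]
  ring

/-- In a plane the skew maps are the multiples of the quarter turn of `B`, so `v ∧ S v` is
proportional to `B v v`; the constant is seen on basis vectors. -/
theorem gram_mul_wedge_skew (B : E2 →L[ℝ] E2 →L[ℝ] ℝ) (hB : ∀ u w, B u w = B w u)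
    (S : E2 →L[ℝ] E2) (hS : ∀ u w, B (S u) w = - B (S w) u) (v : E2) :
    gram B * wedge v (S v) = - (B (S (e2 1)) (e2 0) * B v v) := by
  have h00 := hS (e2 0) (e2 0)
  have h11 := hS (e2 1) (e2 1)
  have h01 := hS (e2 0) (e2 1)
  have hSv : S v = v 0 • S (e2 0) + v 1 • S (e2 1) := by
    conv_lhs => rw [eq_sum_e2 v]
    simp
  rw [hSv]
  rw [clm₂_apply_eq B (S (e2 0))] at h00 h01
  rw [clm₂_apply_eq B (S (e2 1))] at h11 h01
  rw [clm₂_apply_eq B (S (e2 1)), clm₂_apply_eq B v v, gram, hB (e2 1) (e2 0)]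
  rw [hB (e2 1) (e2 0)] at h00 h01 h11
  simp only [wedge, PiLp.add_apply, PiLp.smul_apply, smul_eq_mul]
  simp at h00 h11 h01
  generalize S (e2 0) = p at *
  generalize S (e2 1) = r at *
  simp at *
  generalize B (e2 0) (e2 0) = g00 at *
  generalize B (e2 0) (e2 1) = g01 at *
  generalize B (e2 1) (e2 1) = g11 at *
  -- The entries of the skewness condition on the basis: two diagonal ones and the off-diagonal one.
  have k00 : p 0 * g00 + p 1 * g01 = 0 := by linarith
  have k11 : r 0 * g01 + r 1 * g11 = 0 := by linarith
  have k01 : p 0 * g01 + p 1 * g11 = - (r 0 * g00 + r 1 * g01) := by linarith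
  linear_combination (v 0 * v 0 * g00 + v 0 * v 1 * g01) * k01 +
    (- v 0 * v 0 * g01 - v 0 * v 1 * g11) * k00 + (v 0 * v 1 * g00 + v 1 * v 1 * g01) * k11

/-- The Gaussian curvature of a metric on the coordinate plane. -/
def planeCurvature (G : E2 → E2 →L[ℝ] E2 →L[ℝ] ℝ) (Γ : E2 → E2 →L[ℝ] E2 →L[ℝ] E2) (a : E2) : ℝ :=
  G a (localCurvature Γ a (e2 0) (e2 1) (e2 1)) (e2 0) / gram (G a)

variable {G : E2 → E2 →L[ℝ] E2 →L[ℝ] ℝ} {Γ : E2 → E2 →L[ℝ] E2 →L[ℝ] E2}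

theorem gram_pos {B : E2 →L[ℝ] E2 →L[ℝ] ℝ} (hs : ∀ u w, B u w = B w u)
    (hp : ∀ u, u ≠ 0 → 0 < B u u) : 0 < gram B := by
  have h0 := hp (e2 0) (by simp)
  -- The Gram-Schmidt vector orthogonal to `e2 0`, cleared of denominators.
  set w : E2 := B (e2 0) (e2 0) • e2 1 - B (e2 0) (e2 1) • e2 0 with hw
  have hw0 : w ≠ 0 := by
    intro h1
    have := congrArg (fun u : E2 => u 1) h1
    simp [hw] at this
    exact h0.ne' this
  have h1 := hp w hw0
  have e : B w w = B (e2 0) (e2 0) * gram B := by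
    rw [gram, hw]
    simp only [map_sub, map_smul, sub_apply, smul_apply, smul_eq_mul]
    rw [hs (e2 1) (e2 0)]
    ring
  rw [e] at h1
  exact pos_of_mul_pos_right h1 h0.le

/-- `R(v, ξ)` is alternating in `(v, ξ)`, hence equals `v ∧ ξ` times `S = R(e₀, e₁)`. As `S` is skew
and `v` has length one, `v ∧ S v` does not depend on `v` and is minus the Gaussian curvature. -/
theorem IsLeviCivita.wedge_localCurvature (h : IsLeviCivita G Γ) {a v : E2} (hv : G a v v = 1)
    (ξ : E2) : wedge v (localCurvature Γ a v ξ v) = - planeCurvature G Γ a * wedge v ξ := by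
  let S : E2 →L[ℝ] E2 := fderiv ℝ Γ a (e2 0) (e2 1) - fderiv ℝ Γ a (e2 1) (e2 0) +
    (Γ a (e2 0)).comp (Γ a (e2 1)) - (Γ a (e2 1)).comp (Γ a (e2 0))
  have hS (W : E2) : S W = localCurvature Γ a (e2 0) (e2 1) W := rfl
  have e (W : E2) : localCurvature Γ a v ξ W = wedge v ξ • S W := by
    rw [hS]
    conv_lhs => rw [eq_sum_e2 v, eq_sum_e2 ξ]
    simp only [localCurvature, map_add, map_smul, add_apply, smul_apply, wedge]
    module
  have h1 := gram_mul_wedge_skew (G a) (h.symm a) S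
    (fun u w => h.inner_localCurvature_skew a (e2 0) (e2 1) u w) v
  have hg := gram_pos (h.symm a) (h.pos a)
  have h2 : wedge v (S v) = - planeCurvature G Γ a := by
    rw [planeCurvature, ← hS]
    field_simp
    rw [hv] at h1
    linarith
  rw [e v, ← h2]
  simp only [wedge, PiLp.smul_apply, smul_eq_mul]
  ring

theorem hasDerivAt_wedge {u w : ℝ → E2} {u' w' : E2} {t : ℝ} (hu : HasDerivAt u u' t)
    (hw : HasDerivAt w w' t) : HasDerivAt (fun s => wedge (u s) (w s))
      (wedge u' (w t) + wedge (u t) w') t := by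
  have hc (i : Fin 2) {u : ℝ → E2} {u' : E2} (hu : HasDerivAt u u' t) :
      HasDerivAt (fun s => u s i) (u' i) t :=
    (EuclideanSpace.proj i : E2 →L[ℝ] ℝ).hasFDerivAt.comp_hasDerivAt t hu
  refine (((hc 0 hu).mul (hc 1 hw)).sub ((hc 1 hu).mul (hc 0 hw))).congr_deriv ?_
  simp only [wedge]
  ring

/-- Along a variation of unit speed geodesics, the components of the variation field satisfy, up
to a common factor `-τ`, the equations `b' = a`, `a' = -κ b`. -/
theorem IsLeviCivita.hasDerivAt_wedge_variation (h : IsLeviCivita G Γ) {f : ℝ × ℝ → E2 × E2}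
    (hf : ContDiffAt ℝ ∞ f 0)
    (hgeo : ∀ᶠ p in 𝓝 (0 : ℝ × ℝ),
      fderiv ℝ f p (1, 0) = ((f p).2, - Γ (f p).1 (f p).2 (f p).2))
    (hv : G (f 0).1 (f 0).2 (f 0).2 = 1) :
    let a : ℝ → ℝ := fun s => wedge (f (s, 0)).2 ((fderiv ℝ f (s, 0) (0, 1)).2 +
        Γ (f (s, 0)).1 (f (s, 0)).2 (fderiv ℝ f (s, 0) (0, 1)).1)
    let b : ℝ → ℝ := fun s => wedge (f (s, 0)).2 (fderiv ℝ f (s, 0) (0, 1)).1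
    ∃ τ : ℝ, HasDerivAt a (- planeCurvature G Γ (f 0).1 * b 0 - τ * a 0) 0 ∧
      HasDerivAt b (a 0 - τ * b 0) 0 := by
  obtain ⟨-, hv', hξ, hK⟩ := h.jacobi hf hgeo
  intro a b
  set L := Γ (f 0).1 (f 0).2
  -- `τ` is the trace of `Γ(v, ·)`: the terms `-Γ(v, v)` in `v'` and `-Γ(v, K)`, `-Γ(v, ξ)` in the
  -- derivatives of the second factors combine by `wedge_map_add`.
  refine ⟨L (e2 0) 0 + L (e2 1) 1, (hasDerivAt_wedge hv' hK).congr_deriv ?_, (hasDerivAt_wedge hv' hξ).congr_deriv ?_⟩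
  · have h1 := h.wedge_localCurvature hv (fderiv ℝ f 0 (0, 1)).1
    have h2 := wedge_map_add L (f 0).2 ((fderiv ℝ f 0 (0, 1)).2 + L (fderiv ℝ f 0 (0, 1)).1)
    have e0 : f (0, 0) = f 0 := rfl
    have e1 : fderiv ℝ f (0, 0) = fderiv ℝ f 0 := rfl
    simp only [a, b, e0, e1]
    rw [← h1, ← h2]
    simp only [wedge, PiLp.sub_apply, PiLp.neg_apply, L]
    ring
  · have h2 := wedge_map_add L (f 0).2 (fderiv ℝ f 0 (0, 1)).1
    have e0 : f (0, 0) = f 0 := rfl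
    have e1 : fderiv ℝ f (0, 0) = fderiv ℝ f 0 := rfl
    simp only [a, b, e0, e1]
    rw [← h2]
    simp only [wedge, PiLp.sub_apply, PiLp.neg_apply, L]
    ring

end Plane

/-! ### Angle coordinates and angular velocity. -/

section Angle

/-- The angle chosen in `circleCoord` is the only possible one: independence identifies the two
pairs of coefficients, their sums of squares give equal radii, and then cosine and sine agree. -/
theorem circleCoord_eq {V : Type*} [AddCommGroup V] [Module ℝ V] {e : Fin 2 → V}
    (he : LinearIndependent ℝ e) {r θ : ℝ} (hr : 0 < r) :
    circleCoord e (r • (Real.cos θ • e 0 + Real.sin θ • e 1)) = θ := by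
  have hex : ∃ θ' : Real.Angle, ∃ r' : ℝ, 0 < r' ∧
      r • (Real.cos θ • e 0 + Real.sin θ • e 1) = r' • (θ'.cos • e 0 + θ'.sin • e 1) :=
    ⟨θ, r, hr, by simp⟩
  rw [circleCoord, dif_pos hex]
  obtain ⟨r', hr', h⟩ := hex.choose_spec
  obtain ⟨θ', hθ'⟩ := Real.Angle.induction_on
    (p := fun α => ∃ θ' : ℝ, (θ' : Real.Angle) = α) hex.choose fun x => ⟨x, rfl⟩
  rw [← hθ'] at h ⊢
  simp only [Real.Angle.cos_coe, Real.Angle.sin_coe] at h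
  have he' : LinearIndependent ℝ ![e 0, e 1] := by
    convert he using 1
    ext i
    fin_cases i <;> rfl
  obtain ⟨h1, h2⟩ := LinearIndependent.pair_iff.1 he'
    (r * Real.cos θ - r' * Real.cos θ') (r * Real.sin θ - r' * Real.sin θ') (by
      have h0 := sub_eq_zero.2 h
      rw [← h0]
      module)
  have hrr : r = r' := by
    have h3 : r ^ 2 = r' ^ 2 := by
      linear_combination (r * Real.cos θ + r' * Real.cos θ') * h1 +
        (r * Real.sin θ + r' * Real.sin θ') * h2 - r ^ 2 * Real.sin_sq_add_cos_sq θ +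
        r' ^ 2 * Real.sin_sq_add_cos_sq θ'
    exact (sq_eq_sq₀ hr.le hr'.le).1 h3
  subst hrr
  have hc : Real.cos θ = Real.cos θ' := mul_left_cancel₀ hr.ne' (sub_eq_zero.1 h1)
  have hs : Real.sin θ = Real.sin θ' := mul_left_cancel₀ hr.ne' (sub_eq_zero.1 h2)
  exact (Real.Angle.cos_sin_inj hc hs).symm

/-- With `z = a + b i`, a local lift of the angle is the imaginary part of a branch of `log z`, and
its derivative is `Im (z' / z)`. The positive factor `c` affects only the length, so it needs no
regularity. -/
theorem hasAngularVelocityAt_circleCoord {V : ℝ → Type*} [∀ s, AddCommGroup (V s)]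
    [∀ s, Module ℝ (V s)] {e : ∀ s, Fin 2 → V s} {ζ : ∀ s, V s} {c a b : ℝ → ℝ} {a' b' t : ℝ}
    (he : ∀ s, LinearIndependent ℝ (e s))
    (hζ : ∀ᶠ s in 𝓝 t, 0 < c s ∧ ζ s = c s • (a s • e s 0 + b s • e s 1))
    (ha : HasDerivAt a a' t) (hb : HasDerivAt b b' t) (h0 : 0 < a t ^ 2 + b t ^ 2) :
    HasAngularVelocityAt (fun s => circleCoord (e s) (ζ s))
      ((a t * b' - b t * a') / (a t ^ 2 + b t ^ 2)) t := by
  set z : ℝ → ℂ := fun s => (a s : ℂ) + b s * Complex.I with hz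
  have hz' : HasDerivAt z (a' + b' * Complex.I) t :=
    ha.ofReal_comp.add (hb.ofReal_comp.mul_const Complex.I)
  have hz0 : z t ≠ 0 := by
    intro h
    have h1 := congrArg Complex.re h
    have h2 := congrArg Complex.im h
    simp [hz] at h1 h2
    rw [h1, h2] at h0
    simp at h0
  have hq : HasDerivAt (fun s => z s / z t) ((a' + b' * Complex.I) / z t) t := hz'.div_const _
  -- Dividing by `z t` moves the curve to the point `1`, where the principal logarithm is
  -- differentiable, whatever the position of `z t`.
  have hslit : z t / z t ∈ Complex.slitPlane := by
    rw [div_self hz0]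
    exact Complex.one_mem_slitPlane
  have hlog : HasDerivAt (fun s => Complex.log (z s / z t) + Complex.log (z t))
      ((a' + b' * Complex.I) / z t) t := by
    have := (hq.clog_real hslit).add_const (Complex.log (z t))
    rwa [div_self hz0, div_one] at this
  refine ⟨fun s => (Complex.log (z s / z t) + Complex.log (z t)).im, ?_, ?_⟩
  · have hne : ∀ᶠ s in 𝓝 t, z s ≠ 0 := hz'.continuousAt.eventually_ne hz0
    filter_upwards [hζ, hne] with s hs hne
    set w := Complex.log (z s / z t) + Complex.log (z t) with hw
    have hexp : Complex.exp w = z s := by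
      rw [hw, Complex.exp_add, Complex.exp_log (div_ne_zero hne hz0), Complex.exp_log hz0,
        div_mul_cancel₀ _ hz0]
    have h1 : a s = Real.exp w.re * Real.cos w.im := by
      have := congrArg Complex.re hexp
      rw [Complex.exp_re] at this
      rw [this]
      simp [hz]
    have h2 : b s = Real.exp w.re * Real.sin w.im := by
      have := congrArg Complex.im hexp
      rw [Complex.exp_im] at this
      rw [this]
      simp [hz]
    have h3 : ζ s = (c s * Real.exp w.re) • (Real.cos w.im • e s 0 + Real.sin w.im • e s 1) := by
      rw [hs.2, h1, h2]
      module
    rw [h3, circleCoord_eq (he s) (mul_pos hs.1 (Real.exp_pos _))]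
  · have h1 := (Complex.imCLM.hasFDerivAt (x := _)).comp_hasDerivAt t hlog
    refine h1.congr_deriv ?_
    simp [hz, Complex.div_im, Complex.normSq_apply]
    field_simp

/-- The quotient is the mean of `1` and `κ` with weights `a²` and `b²`. -/
theorem min_le_div_le_max {a b κ m M : ℝ} (h0 : 0 < a ^ 2 + b ^ 2) (hm : m ≤ κ) (hM : κ ≤ M) :
    min 1 m ≤ (a ^ 2 + κ * b ^ 2) / (a ^ 2 + b ^ 2) ∧
      (a ^ 2 + κ * b ^ 2) / (a ^ 2 + b ^ 2) ≤ max 1 M := by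
  constructor
  · rw [le_div_iff₀ h0]
    nlinarith [min_le_left 1 m, (min_le_right 1 m).trans hm, sq_nonneg a, sq_nonneg b]
  · rw [div_le_iff₀ h0]
    nlinarith [le_max_left 1 M, hM.trans (le_max_right 1 M), sq_nonneg a, sq_nonneg b]

end Angle

/-! ### The metric and its Christoffel symbols in a stereographic chart. -/

section Charts

/-- The preferred chart at `x` is the stereographic projection from `-x`. Since its target is the
whole plane, the metric coefficients form a metric on all of `E2` and `IsLeviCivita` applies without
domains. -/
theorem extChartAt_target_S2 (x : S2) : (extChartAt (𝓡 2) x).target = Set.univ := by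
  have := Fact.mk (@finrank_euclideanSpace_fin ℝ _ 3)
  rw [extChartAt_target]
  have h : (chartAt (EuclideanSpace ℝ (Fin 2)) x).target = Set.univ :=
    stereographic'_target (n := 2) (-x)
  rw [h]
  simp

theorem contMDiff_extChartAt_symm_S2 (x : S2) :
    ContMDiff 𝓘(ℝ, E2) (𝓡 2) ∞ (extChartAt (𝓡 2) x).symm := by
  have h := contMDiffOn_extChartAt_symm (I := 𝓡 2) (n := ∞) x
  rwa [extChartAt_target_S2, contMDiffOn_univ] at h

/-- The differential of the inverse of the preferred chart at `x`. -/
abbrev symmDeriv (x : S2) (a : E2) : E2 →L[ℝ] TangentSpace (𝓡 2) ((extChartAt (𝓡 2) x).symm a) :=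
  mfderiv 𝓘(ℝ, E2) (𝓡 2) (extChartAt (𝓡 2) x).symm a

theorem contMDiff_constSection {E : Type*} [NormedAddCommGroup E] [NormedSpace ℝ E] (u : E) :
    ContMDiff 𝓘(ℝ, E) 𝓘(ℝ, E).tangent ∞ (fun a : E => (⟨a, u⟩ : TangentBundle 𝓘(ℝ, E) E)) :=
  (contMDiff_vectorSpace_iff_contDiff (V := fun _ : E => u)).2 contDiff_const

theorem contMDiff_mfderiv_apply {E F H M : Type*} [NormedAddCommGroup E] [NormedSpace ℝ E]
    [NormedAddCommGroup F] [NormedSpace ℝ F] [TopologicalSpace H] {I : ModelWithCorners ℝ F H}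
    [TopologicalSpace M] [ChartedSpace H M] [IsManifold I ∞ M] [IsManifold I 1 M] {f : E → M}
    (hf : ContMDiff 𝓘(ℝ, E) I ∞ f) (u : E) :
    ContMDiff 𝓘(ℝ, E) I.tangent ∞
      (fun a : E => (⟨f a, mfderiv 𝓘(ℝ, E) I f a u⟩ : TangentBundle I M)) :=
  (hf.contMDiff_tangentMap (m := ∞) (by simp)).comp (contMDiff_constSection u)

theorem contMDiff_symmDeriv (x : S2) (u : E2) :
    ContMDiff 𝓘(ℝ, E2) (𝓡 2).tangent ∞
      (fun a : E2 => (⟨(extChartAt (𝓡 2) x).symm a, symmDeriv x a u⟩ : TS2)) :=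
  contMDiff_mfderiv_apply (contMDiff_extChartAt_symm_S2 x) u

theorem contDiff_metricCoeff (g : Metric2) (x : S2) (i j : Fin 2) :
    ContDiff ℝ ∞ (metricCoeff g x i j) := by
  rw [← contMDiff_iff_contDiff]
  have h1 := contMDiff_symmDeriv x (EuclideanSpace.single i 1)
  have h2 := contMDiff_symmDeriv x (EuclideanSpace.single j 1)
  have h3 := g.contMDiff.comp (contMDiff_extChartAt_symm_S2 x)
  have h4 := ContMDiff.clm_bundle_apply₂ (F₁ := E2) (F₂ := E2) (F₃ := ℝ)
    (E₃ := Bundle.Trivial S2 ℝ) h3 h1 h2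
  intro a
  have h5 := (Bundle.contMDiffAt_totalSpace.1 (h4 a)).2
  exact h5

/-- The metric in the preferred chart at `x`. -/
def chartMetric (g : Metric2) (x : S2) (a : E2) : E2 →L[ℝ] E2 →L[ℝ] ℝ :=
  ∑ i, ∑ j, metricCoeff g x i j a •
    (EuclideanSpace.proj i : E2 →L[ℝ] ℝ).smulRight (EuclideanSpace.proj j : E2 →L[ℝ] ℝ)

theorem chartMetric_apply (g : Metric2) (x : S2) (a u w : E2) :
    chartMetric g x a u w = ∑ i, ∑ j, metricCoeff g x i j a * (u i * w j) := by
  simp [chartMetric, Fin.sum_univ_two]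

theorem chartMetric_single (g : Metric2) (x : S2) (a : E2) (i j : Fin 2) :
    chartMetric g x a (e2 i) (e2 j) = metricCoeff g x i j a := by
  rw [chartMetric_apply]
  fin_cases i <;> fin_cases j <;> simp

theorem chartMetric_eq_inner (g : Metric2) (x : S2) (a u w : E2) :
    chartMetric g x a u w =
      g.inner ((extChartAt (𝓡 2) x).symm a) (symmDeriv x a u) (symmDeriv x a w) := by
  rw [chartMetric_apply]
  conv_rhs => rw [eq_sum_e2 u, eq_sum_e2 w]
  have e (i j : Fin 2) : metricCoeff g x i j a =
    g.inner ((extChartAt (𝓡 2) x).symm a) (symmDeriv x a (e2 i)) (symmDeriv x a (e2 j)) := rfl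
  simp only [map_add, map_smul, add_apply, smul_apply, smul_eq_mul, Fin.sum_univ_two, e]
  ring

/-- The Christoffel symbols in the preferred chart at `x`, as a bilinear map. -/
def chartChristoffel (g : Metric2) (x : S2) (a : E2) : E2 →L[ℝ] E2 →L[ℝ] E2 :=
  ∑ k, ∑ i, ∑ j, christoffel g x k i j a •
    (EuclideanSpace.proj i : E2 →L[ℝ] ℝ).smulRight
      ((EuclideanSpace.proj j : E2 →L[ℝ] ℝ).smulRight (e2 k))

theorem chartChristoffel_apply (g : Metric2) (x : S2) (a u w : E2) :
    chartChristoffel g x a u w =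
      WithLp.toLp 2 fun k => ∑ i, ∑ j, christoffel g x k i j a * u i * w j := by
  ext k
  fin_cases k <;> simp [chartChristoffel, Fin.sum_univ_two] <;> ring

theorem chartChristoffel_center (g : Metric2) (x : S2) (u w : E2) :
    chartChristoffel g x (extChartAt (𝓡 2) x x) u w = christoffelMap g x u w :=
  chartChristoffel_apply g x _ u w

theorem chartChristoffel_single (g : Metric2) (x : S2) (a : E2) (i j k : Fin 2) :
    chartChristoffel g x a (e2 i) (e2 j) k = christoffel g x k i j a := by
  rw [chartChristoffel_apply]
  fin_cases i <;> fin_cases j <;> simp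

/-! ### Tangent coordinate changes -/

theorem symmDeriv_injective (x : S2) (a : E2) : Function.Injective (symmDeriv x a) := by
  have ha : a ∈ (extChartAt (𝓡 2) x).target := by rw [extChartAt_target_S2]; trivial
  have h := isInvertible_mfderivWithin_extChartAt_symm (I := 𝓡 2) ha
  rw [ModelWithCorners.range_eq_univ, mfderivWithin_univ] at h
  exact h.injective

theorem chartMetric_pos (g : Metric2) (x : S2) (a u : E2) (hu : u ≠ 0) :
    0 < chartMetric g x a u u := by
  rw [chartMetric_eq_inner]
  refine g.pos _ _ fun h => hu ?_
  exact symmDeriv_injective x a (h.trans (map_zero _).symm)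

theorem chartMetric_symm (g : Metric2) (x : S2) (a u w : E2) :
    chartMetric g x a u w = chartMetric g x a w u := by
  rw [chartMetric_eq_inner, chartMetric_eq_inner]
  exact g.symm _ _ _

theorem metricCoeff_symm (g : Metric2) (x : S2) (i j : Fin 2) :
    metricCoeff g x i j = metricCoeff g x j i := by
  ext a
  rw [← chartMetric_single, ← chartMetric_single]
  exact chartMetric_symm g x a _ _

theorem gram_chartMetric (g : Metric2) (x : S2) (a : E2) :
    gram (chartMetric g x a) = (metricMatrix g x a).det := by
  simp only [gram, chartMetric_single, metricMatrix, Matrix.det_fin_two, Matrix.of_apply]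

theorem det_metricMatrix_pos (g : Metric2) (x : S2) (a : E2) : 0 < (metricMatrix g x a).det :=
  gram_chartMetric g x a ▸ gram_pos (chartMetric_symm g x a) (chartMetric_pos g x a)

set_option maxSynthPendingDepth 10 in
theorem contDiff_chartMetric (g : Metric2) (x : S2) : ContDiff ℝ ∞ (chartMetric g x) := by
  unfold chartMetric
  exact ContDiff.sum fun i _ => ContDiff.sum fun j _ =>
    (contDiff_metricCoeff g x i j).smul contDiff_const

theorem contDiff_pd {f : E2 → ℝ} (hf : ContDiff ℝ ∞ f) (i : Fin 2) : ContDiff ℝ ∞ (pd i f) :=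
  (hf.fderiv_right (m := ∞) (by simp)).clm_apply contDiff_const

theorem contDiff_metricMatrix_det (g : Metric2) (x : S2) :
    ContDiff ℝ ∞ (fun a => (metricMatrix g x a).det) := by
  simp only [Matrix.det_fin_two, metricMatrix, Matrix.of_apply]
  exact ((contDiff_metricCoeff g x 0 0).mul (contDiff_metricCoeff g x 1 1)).sub
    ((contDiff_metricCoeff g x 0 1).mul (contDiff_metricCoeff g x 1 0))

theorem contDiff_metricMatrix_inv (g : Metric2) (x : S2) (k l : Fin 2) :
    ContDiff ℝ ∞ (fun a => (metricMatrix g x a)⁻¹ k l) := by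
  have hdet := (contDiff_metricMatrix_det g x).inv fun a => (det_metricMatrix_pos g x a).ne'
  simp only [Matrix.inv_def, Ring.inverse_eq_inv', Matrix.adjugate_fin_two, Matrix.smul_apply,
    smul_eq_mul]
  refine hdet.mul ?_
  fin_cases k <;> fin_cases l <;>
    simp [metricMatrix] <;>
    first
      | exact contDiff_metricCoeff g x _ _
      | exact (contDiff_metricCoeff g x _ _).neg

theorem contDiff_christoffel (g : Metric2) (x : S2) (k i j : Fin 2) :
    ContDiff ℝ ∞ (christoffel g x k i j) := by
  unfold christoffel
  refine contDiff_const.mul (ContDiff.sum fun l _ => ?_)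
  refine (contDiff_metricMatrix_inv g x k l).mul ?_
  exact ((contDiff_pd (contDiff_metricCoeff g x _ _) _).add
    (contDiff_pd (contDiff_metricCoeff g x _ _) _)).sub (contDiff_pd (contDiff_metricCoeff g x _ _) _)

set_option maxSynthPendingDepth 10 in
theorem contDiff_chartChristoffel (g : Metric2) (x : S2) :
    ContDiff ℝ ∞ (chartChristoffel g x) := by
  unfold chartChristoffel
  exact ContDiff.sum fun k _ => ContDiff.sum fun i _ => ContDiff.sum fun j _ =>
    (contDiff_christoffel g x k i j).smul contDiff_const

theorem fderiv_chartMetric_single (g : Metric2) (x : S2) (a : E2) (i j k : Fin 2) :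
    fderiv ℝ (chartMetric g x) a (e2 i) (e2 j) (e2 k) = pd i (metricCoeff g x j k) a := by
  rw [← fderiv_clm₂_apply ((contDiff_chartMetric g x).differentiable (by simp) a)]
  simp only [chartMetric_single]
  rfl

/-- The Koszul formula on basis vectors: the Gram matrix cancels the inverse matrix in the
definition of the Christoffel symbols. -/
theorem koszul_single (g : Metric2) (x : S2) (a : E2) (i j l : Fin 2) :
    2 * ∑ k, christoffel g x k i j a * metricCoeff g x k l a =
      pd i (metricCoeff g x j l) a + pd j (metricCoeff g x i l) a - pd l (metricCoeff g x i j) a := by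
  have hu : IsUnit (metricMatrix g x a).det := (det_metricMatrix_pos g x a).ne'.isUnit
  have h1 := Matrix.mul_nonsing_inv (metricMatrix g x a) hu
  have hm (l m : Fin 2) : ∑ k, metricCoeff g x k l a * (metricMatrix g x a)⁻¹ k m =
      (1 : Matrix (Fin 2) (Fin 2) ℝ) l m := by
    rw [← h1, Matrix.mul_apply]
    refine Finset.sum_congr rfl fun k _ => ?_
    rw [metricCoeff_symm]
    rfl
  have h0 := hm l 0
  have h1 := hm l 1
  simp only [Fin.sum_univ_two] at h0 h1 ⊢
  simp only [christoffel, Fin.sum_univ_two]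
  set c : Fin 2 → ℝ := fun l => pd i (metricCoeff g x j l) a + pd j (metricCoeff g x i l) a -
    pd l (metricCoeff g x i j) a with hc
  have e (l : Fin 2) : pd i (metricCoeff g x j l) a + pd j (metricCoeff g x i l) a -
    pd l (metricCoeff g x i j) a = c l := rfl
  simp only [e]
  have : c l = (1 : Matrix (Fin 2) (Fin 2) ℝ) l 0 * c 0 +
      (1 : Matrix (Fin 2) (Fin 2) ℝ) l 1 * c 1 := by
    obtain rfl | rfl : l = 0 ∨ l = 1 := by omega
    all_goals simp
  rw [this]
  linear_combination c 0 * h0 + c 1 * h1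

/-- Both sides of the Koszul formula are trilinear, so it follows from its eight instances on basis
vectors. -/
theorem isLeviCivita_chart (g : Metric2) (x : S2) :
    IsLeviCivita (chartMetric g x) (chartChristoffel g x) where
  contDiff_metric := contDiff_chartMetric g x
  contDiff_christoffel := contDiff_chartChristoffel g x
  symm := chartMetric_symm g x
  pos := chartMetric_pos g x
  koszul a U V W := by
    have key (i j l : Fin 2) : 2 * chartMetric g x a (chartChristoffel g x a (e2 i) (e2 j)) (e2 l) =
        fderiv ℝ (chartMetric g x) a (e2 i) (e2 j) (e2 l) +
        fderiv ℝ (chartMetric g x) a (e2 j) (e2 i) (e2 l) -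
        fderiv ℝ (chartMetric g x) a (e2 l) (e2 i) (e2 j) := by
      simp only [fderiv_chartMetric_single]
      rw [← koszul_single, chartMetric_apply]
      simp only [chartChristoffel_single]
      obtain rfl | rfl : l = 0 ∨ l = 1 := by omega
      all_goals simp [Fin.sum_univ_two, mul_comm]
    rw [eq_sum_e2 U, eq_sum_e2 V, eq_sum_e2 W]
    simp only [map_add, map_smul, add_apply, smul_apply, smul_eq_mul]
    linear_combination U 0 * V 0 * W 0 * key 0 0 0 + U 0 * V 0 * W 1 * key 0 0 1 +
      U 0 * V 1 * W 0 * key 0 1 0 + U 0 * V 1 * W 1 * key 0 1 1 +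
      U 1 * V 0 * W 0 * key 1 0 0 + U 1 * V 0 * W 1 * key 1 0 1 +
      U 1 * V 1 * W 0 * key 1 1 0 + U 1 * V 1 * W 1 * key 1 1 1

/-- The bridge from the chart computation to the curvature in the theorem. It is stated at the
centre of the chart, the only point of the chart that `gaussianCurvature g x` uses. -/
theorem planeCurvature_chart (g : Metric2) (x : S2) :
    planeCurvature (chartMetric g x) (chartChristoffel g x) (extChartAt (𝓡 2) x x) =
      gaussianCurvature g x := by
  set a := extChartAt (𝓡 2) x x with ha
  have hΓ := (contDiff_chartChristoffel g x).differentiable (by simp) a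
  have hd (i j k l : Fin 2) : fderiv ℝ (chartChristoffel g x) a (e2 i) (e2 j) (e2 k) l =
      pd i (christoffel g x l j k) a := by
    have h1 := fderiv_clm₂_apply hΓ (e2 j) (e2 k) (e2 i)
    have h2 : DifferentiableAt ℝ (fun q => chartChristoffel g x q (e2 j) (e2 k)) a :=
      (hΓ.clm_apply (differentiableAt_const _)).clm_apply (differentiableAt_const _)
    have h3 := ((EuclideanSpace.proj l : E2 →L[ℝ] ℝ).hasFDerivAt.comp a h2.hasFDerivAt).fderiv
    have h4 : (⇑(EuclideanSpace.proj l : E2 →L[ℝ] ℝ) ∘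
        fun q => chartChristoffel g x q (e2 j) (e2 k)) = christoffel g x l j k := by
      ext q
      exact chartChristoffel_single g x q j k l
    rw [h4] at h3
    rw [pd, h3, ← h1]
    rfl
  have hc (l : Fin 2) : localCurvature (chartChristoffel g x) a (e2 0) (e2 1) (e2 1) l =
      curvatureCoeff g x l 0 1 1 a := by
    simp only [localCurvature, PiLp.add_apply, PiLp.sub_apply, hd, curvatureCoeff]
    rw [chartChristoffel_apply g x a (e2 0) (chartChristoffel g x a _ _),
      chartChristoffel_apply g x a (e2 1) (chartChristoffel g x a _ _)]
    simp only [chartChristoffel_single]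
    simp [Fin.sum_univ_two]
    ring
  rw [planeCurvature, gram_chartMetric, gaussianCurvature]
  congr 1
  rw [chartMetric_apply]
  simp only [hc, ← ha]
  simp only [Fin.sum_univ_two]
  simp
  ring

end Charts

/-! ### Coordinate changes for tangent vectors and for the connection map. -/

section TangentCharts

/-- The transition map from the preferred chart at `x` to the preferred chart at `x₀`. -/
def transition (x x₀ : S2) : E2 → E2 := extChartAt (𝓡 2) x₀ ∘ (extChartAt (𝓡 2) x).symm

theorem extChartAt_right_inv_S2 (x : S2) (a : E2) :
    extChartAt (𝓡 2) x ((extChartAt (𝓡 2) x).symm a) = a :=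
  (extChartAt (𝓡 2) x).right_inv (by rw [extChartAt_target_S2]; trivial)

theorem extChartAt_symm_mem_source_S2 (x : S2) (a : E2) :
    (extChartAt (𝓡 2) x).symm a ∈ (extChartAt (𝓡 2) x).source :=
  (extChartAt (𝓡 2) x).map_target (by rw [extChartAt_target_S2]; trivial)

/-- An element of the tangent space at `q` is a coordinate vector in the preferred chart at `q`
itself. The differential of the inverse chart at `x` is therefore the change from the chart at `x`
to the chart at the image point. -/
theorem symmDeriv_eq_tangentCoordChange (x : S2) (a : E2) :
    symmDeriv x a = tangentCoordChange (𝓡 2) x ((extChartAt (𝓡 2) x).symm a)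
      ((extChartAt (𝓡 2) x).symm a) := by
  have h := (contMDiff_extChartAt_symm_S2 x).mdifferentiableAt (x := a) (by simp)
  rw [tangentCoordChange_def, extChartAt_right_inv_S2, symmDeriv, h.mfderiv]
  rfl

theorem tangentCoordChange_eq_fderiv (x x₀ : S2) (a : E2) :
    tangentCoordChange (𝓡 2) x x₀ ((extChartAt (𝓡 2) x).symm a) =
      fderiv ℝ (transition x x₀) a := by
  rw [tangentCoordChange_def, extChartAt_right_inv_S2, ModelWithCorners.range_eq_univ,
    fderivWithin_univ]
  rfl

theorem tangentCoordChange_symmDeriv {x x₀ : S2} {a : E2}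
    (h : (extChartAt (𝓡 2) x).symm a ∈ (extChartAt (𝓡 2) x₀).source) (u : E2) :
    tangentCoordChange (𝓡 2) ((extChartAt (𝓡 2) x).symm a) x₀ ((extChartAt (𝓡 2) x).symm a)
      (symmDeriv x a u) = fderiv ℝ (transition x x₀) a u := by
  rw [symmDeriv_eq_tangentCoordChange, ← tangentCoordChange_eq_fderiv]
  exact tangentCoordChange_comp
    ⟨⟨extChartAt_symm_mem_source_S2 x a, mem_extChartAt_source _⟩, h⟩

theorem chartMetric_tangentCoordChange (g : Metric2) {x q : S2}
    (h : q ∈ (extChartAt (𝓡 2) x).source) (u w : TangentSpace (𝓡 2) q) :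
    chartMetric g x (extChartAt (𝓡 2) x q) (tangentCoordChange (𝓡 2) q x q u)
      (tangentCoordChange (𝓡 2) q x q w) = g.inner q u w := by
  obtain ⟨a, rfl⟩ : ∃ a, q = (extChartAt (𝓡 2) x).symm a :=
    ⟨_, ((extChartAt (𝓡 2) x).left_inv h).symm⟩
  have e (u : E2) : symmDeriv x a (tangentCoordChange (𝓡 2) ((extChartAt (𝓡 2) x).symm a) x
      ((extChartAt (𝓡 2) x).symm a) u) = u := by
    rw [symmDeriv_eq_tangentCoordChange]
    refine (tangentCoordChange_comp ⟨⟨mem_extChartAt_source _, h⟩, mem_extChartAt_source _⟩).trans ?_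
    exact tangentCoordChange_self (mem_extChartAt_source _)
  rw [extChartAt_right_inv_S2, chartMetric_eq_inner]
  exact congrArg₂ (fun u w => g.inner _ u w) (e u) (e w)

theorem eventually_symm_mem_source {x x₀ : S2} {a : E2}
    (h : (extChartAt (𝓡 2) x).symm a ∈ (extChartAt (𝓡 2) x₀).source) :
    ∀ᶠ b in 𝓝 a, (extChartAt (𝓡 2) x).symm b ∈ (extChartAt (𝓡 2) x₀).source :=
  (contMDiff_extChartAt_symm_S2 x).continuous.continuousAt.eventually
    ((isOpen_extChartAt_source x₀).mem_nhds h)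

theorem eventually_prod_symm_mem_source {x x₀ : S2} {a : E2} (v : E2)
    (h : (extChartAt (𝓡 2) x).symm a ∈ (extChartAt (𝓡 2) x₀).source) :
    ∀ᶠ y : E2 × E2 in 𝓝 (a, v), (extChartAt (𝓡 2) x).symm y.1 ∈ (extChartAt (𝓡 2) x₀).source :=
  ((continuous_fst (X := E2) (Y := E2)).tendsto (a, v)).eventually (eventually_symm_mem_source h)

theorem contDiffAt_transition {x x₀ : S2} {a : E2}
    (h : (extChartAt (𝓡 2) x).symm a ∈ (extChartAt (𝓡 2) x₀).source) :
    ContDiffAt ℝ ∞ (transition x x₀) a := by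
  rw [← contMDiffAt_iff_contDiffAt]
  exact (contMDiffAt_extChartAt' (by rwa [← extChartAt_source (𝓡 2)])).comp a
    (contMDiff_extChartAt_symm_S2 x a)

theorem surjective_fderiv_transition {x x₀ : S2} {a : E2}
    (h : (extChartAt (𝓡 2) x).symm a ∈ (extChartAt (𝓡 2) x₀).source) :
    Function.Surjective (fderiv ℝ (transition x x₀) a) := by
  intro w
  set q := (extChartAt (𝓡 2) x).symm a
  have hx := extChartAt_symm_mem_source_S2 x a
  refine ⟨tangentCoordChange (𝓡 2) x₀ x q w, ?_⟩
  rw [← tangentCoordChange_eq_fderiv, tangentCoordChange_comp ⟨⟨h, hx⟩, h⟩]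
  exact tangentCoordChange_self h

theorem chartMetric_transition (g : Metric2) {x x₀ : S2} {a : E2}
    (h : (extChartAt (𝓡 2) x).symm a ∈ (extChartAt (𝓡 2) x₀).source) (u w : E2) :
    chartMetric g x a u w = chartMetric g x₀ (transition x x₀ a)
      (fderiv ℝ (transition x x₀) a u) (fderiv ℝ (transition x x₀) a w) := by
  rw [chartMetric_eq_inner, ← tangentCoordChange_symmDeriv h, ← tangentCoordChange_symmDeriv h]
  exact (chartMetric_tangentCoordChange g h _ _).symm

/-- Transition maps are isometries for the chart metrics, so the general transformation law applies.
-/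
theorem christoffel_transition (g : Metric2) {x x₀ : S2} {a : E2}
    (h : (extChartAt (𝓡 2) x).symm a ∈ (extChartAt (𝓡 2) x₀).source) (u w : E2) :
    fderiv ℝ (transition x x₀) a (chartChristoffel g x a u w) =
      chartChristoffel g x₀ (transition x x₀ a) (fderiv ℝ (transition x x₀) a u)
        (fderiv ℝ (transition x x₀) a w) + fderiv ℝ (fderiv ℝ (transition x x₀)) a u w :=
  (isLeviCivita_chart g x₀).map_christoffel (isLeviCivita_chart g x) (contDiffAt_transition h)
    (surjective_fderiv_transition h)
    ((eventually_symm_mem_source h).mono fun _ hb => chartMetric_transition g hb) u w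

theorem extChartAt_TS2_apply (p₀ p : TS2) :
    extChartAt (𝓡 2).tangent p₀ p =
      (extChartAt (𝓡 2) p₀.1 p.1, tangentCoordChange (𝓡 2) p.1 p₀.1 p.1 p.2) := by
  rw [FiberBundle.extChartAt]
  rfl

theorem mem_extChartAt_TS2_source {p₀ p : TS2} :
    p ∈ (extChartAt (𝓡 2).tangent p₀).source ↔ p.1 ∈ (extChartAt (𝓡 2) p₀.1).source := by
  rw [extChartAt_source, extChartAt_source]
  exact TangentBundle.mem_chart_source_iff p p₀

theorem extChartAt_TS2_symm_apply (p : TS2) (y : E2 × E2) :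
    (extChartAt (𝓡 2).tangent p).symm y =
      ⟨(extChartAt (𝓡 2) p.1).symm y.1, symmDeriv p.1 y.1 y.2⟩ := by
  set q : TS2 := ⟨(extChartAt (𝓡 2) p.1).symm y.1, symmDeriv p.1 y.1 y.2⟩ with hq
  have hs : q ∈ (extChartAt (𝓡 2).tangent p).source :=
    mem_extChartAt_TS2_source.2 (extChartAt_symm_mem_source_S2 p.1 y.1)
  -- It suffices to apply the chart to the candidate `q`, because the chart is injective on its
  -- source.
  have e : extChartAt (𝓡 2).tangent p q = y := by
    rw [extChartAt_TS2_apply]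
    refine Prod.ext (extChartAt_right_inv_S2 _ _) ?_
    refine (tangentCoordChange_symmDeriv (extChartAt_symm_mem_source_S2 p.1 y.1) y.2).trans ?_
    rw [← tangentCoordChange_eq_fderiv]
    exact tangentCoordChange_self (extChartAt_symm_mem_source_S2 p.1 y.1)
  rw [← e, (extChartAt (𝓡 2).tangent p).left_inv hs]

/-- The second derivative of `ψ` enters here; it is matched by the inhomogeneous term in the
transformation law of the Christoffel map. -/
theorem fderiv_tangentMap {E F : Type*} [NormedAddCommGroup E] [NormedSpace ℝ E]
    [NormedAddCommGroup F] [NormedSpace ℝ F] {ψ : E → F} {a : E} (hψ : ContDiffAt ℝ ∞ ψ a)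
    (v : E) (η : E × E) :
    fderiv ℝ (fun y : E × E => (ψ y.1, fderiv ℝ ψ y.1 y.2)) (a, v) η =
      (fderiv ℝ ψ a η.1, fderiv ℝ (fderiv ℝ ψ) a η.1 v + fderiv ℝ ψ a η.2) := by
  have hψ1 : HasFDerivAt ψ (fderiv ℝ ψ a) a := (hψ.differentiableAt (by simp)).hasFDerivAt
  have hψ2 : HasFDerivAt (fderiv ℝ ψ) (fderiv ℝ (fderiv ℝ ψ) a) a :=
    ((hψ.fderiv_right (m := ∞) (by simp)).differentiableAt (by simp)).hasFDerivAt
  have hd : HasFDerivAt (fun y : E × E => (ψ y.1, fderiv ℝ ψ y.1 y.2)) _ (a, v) :=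
    (HasFDerivAt.comp (a, v) (f := Prod.fst) hψ1 hasFDerivAt_fst).prodMk
      ((HasFDerivAt.comp (a, v) (f := Prod.fst) hψ2 hasFDerivAt_fst).clm_apply hasFDerivAt_snd)
  rw [hd.fderiv]
  refine Prod.ext rfl ?_
  exact add_comm _ _

theorem extChartAt_TS2_comp_symm (p₀ p : TS2) (y : E2 × E2)
    (h : (extChartAt (𝓡 2) p.1).symm y.1 ∈ (extChartAt (𝓡 2) p₀.1).source) :
    extChartAt (𝓡 2).tangent p₀ ((extChartAt (𝓡 2).tangent p).symm y) =
      (transition p.1 p₀.1 y.1, fderiv ℝ (transition p.1 p₀.1) y.1 y.2) :=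
  (congrArg (extChartAt (𝓡 2).tangent p₀) (extChartAt_TS2_symm_apply p y)).trans
    ((extChartAt_TS2_apply _ _).trans (Prod.ext rfl (tangentCoordChange_symmDeriv h y.2)))

/-- The fibre component of a tangent vector, as a vector of the coordinate plane. -/
def fiberCoord (p : TS2) : E2 := p.2

theorem extChartAt_TS2_self (p : TS2) :
    extChartAt (𝓡 2).tangent p p = (extChartAt (𝓡 2) p.1 p.1, fiberCoord p) :=
  (extChartAt_TS2_apply p p).trans
    (Prod.ext rfl (tangentCoordChange_self (mem_extChartAt_source _)))

theorem tangentCoordChange_TS2_eq_fderiv (p₀ p : TS2) :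
    tangentCoordChange (𝓡 2).tangent p p₀ p =
      fderiv ℝ (fun y => extChartAt (𝓡 2).tangent p₀ ((extChartAt (𝓡 2).tangent p).symm y))
        (extChartAt (𝓡 2).tangent p p) := by
  have hr : Set.range (𝓡 2).tangent = Set.univ := ModelWithCorners.range_eq_univ _
  rw [tangentCoordChange_def, hr, fderivWithin_univ]
  rfl

theorem tangentCoordChange_TS2 {p₀ p : TS2} (h : p.1 ∈ (extChartAt (𝓡 2) p₀.1).source)
    (η : E2 × E2) :
    tangentCoordChange (𝓡 2).tangent p p₀ p η =
      (fderiv ℝ (transition p.1 p₀.1) (extChartAt (𝓡 2) p.1 p.1) η.1,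
        fderiv ℝ (fderiv ℝ (transition p.1 p₀.1)) (extChartAt (𝓡 2) p.1 p.1) η.1 (fiberCoord p) +
          fderiv ℝ (transition p.1 p₀.1) (extChartAt (𝓡 2) p.1 p.1) η.2) := by
  have h' : (extChartAt (𝓡 2) p.1).symm (extChartAt (𝓡 2) p.1 p.1) ∈
      (extChartAt (𝓡 2) p₀.1).source := by rwa [extChartAt_to_inv]
  have hev : (fun y => extChartAt (𝓡 2).tangent p₀ ((extChartAt (𝓡 2).tangent p).symm y))
      =ᶠ[𝓝 (extChartAt (𝓡 2) p.1 p.1, fiberCoord p)]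
      fun y : E2 × E2 => (transition p.1 p₀.1 y.1, fderiv ℝ (transition p.1 p₀.1) y.1 y.2) :=
    (eventually_prod_symm_mem_source (fiberCoord p) h').mono fun y hy => extChartAt_TS2_comp_symm p₀ p y hy
  rw [tangentCoordChange_TS2_eq_fderiv, extChartAt_TS2_self, hev.fderiv_eq]
  exact fderiv_tangentMap (contDiffAt_transition h') (fiberCoord p) η

theorem tangentCoordChange_S2_eq_fderiv (x₀ x : S2) :
    tangentCoordChange (𝓡 2) x x₀ x = fderiv ℝ (transition x x₀) (extChartAt (𝓡 2) x x) := by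
  have := tangentCoordChange_eq_fderiv x x₀ (extChartAt (𝓡 2) x x)
  rwa [extChartAt_to_inv] at this

/-- The first component of a tangent vector of the tangent bundle in a nearby chart. -/
theorem tangentCoordChange_TS2_fst {p₀ p : TS2} (h : p.1 ∈ (extChartAt (𝓡 2) p₀.1).source)
    (η : E2 × E2) :
    (tangentCoordChange (𝓡 2).tangent p p₀ p η).1 = tangentCoordChange (𝓡 2) p.1 p₀.1 p.1 η.1 := by
  rw [tangentCoordChange_TS2 h, tangentCoordChange_S2_eq_fderiv]

/-- The connection map in a nearby chart. -/
theorem tangentCoordChange_connectionMap (g : Metric2) {p₀ p : TS2}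
    (h : p.1 ∈ (extChartAt (𝓡 2) p₀.1).source) (η : E2 × E2) :
    (tangentCoordChange (𝓡 2).tangent p p₀ p η).2 +
      chartChristoffel g p₀.1 (extChartAt (𝓡 2) p₀.1 p.1)
        (tangentCoordChange (𝓡 2) p.1 p₀.1 p.1 (fiberCoord p))
        (tangentCoordChange (𝓡 2) p.1 p₀.1 p.1 η.1) =
      tangentCoordChange (𝓡 2) p.1 p₀.1 p.1
        (η.2 + christoffelMap g p.1 (fiberCoord p) η.1) := by
  have h' : (extChartAt (𝓡 2) p.1).symm (extChartAt (𝓡 2) p.1 p.1) ∈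
      (extChartAt (𝓡 2) p₀.1).source := by rwa [extChartAt_to_inv]
  have hψa : extChartAt (𝓡 2) p₀.1 p.1 = transition p.1 p₀.1 (extChartAt (𝓡 2) p.1 p.1) := by
    rw [transition, Function.comp_apply, extChartAt_to_inv]
  -- The second derivative of the transition map occurs on the two sides with its arguments
  -- exchanged.
  have hsy := ((contDiffAt_transition h').isSymmSndFDerivAt minSmoothness_le_infty).eq
    η.1 (fiberCoord p)
  rw [tangentCoordChange_TS2 h, tangentCoordChange_S2_eq_fderiv, hψa, map_add,
    ← chartChristoffel_center, christoffel_transition g h', hsy]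
  have key (u v w : E2) : u + v + w = v + (w + u) := by abel
  exact key _ _ _

end TangentCharts

/-! ### The round covering as a pair of quadratic maps. -/

section Hopf

/-- The foot point of the round covering, as a quadratic map. -/
def hopfBase (p : EuclideanSpace ℝ (Fin 4)) : EuclideanSpace ℝ (Fin 3) :=
  !₂[2 * (p 0 * p 3 + p 1 * p 2), p 0 * p 0 - p 1 * p 1 + p 2 * p 2 - p 3 * p 3,
    2 * (p 2 * p 3 - p 0 * p 1)]

/-- The vector component of the round covering, as a quadratic map. -/
def hopfVec (p : EuclideanSpace ℝ (Fin 4)) : EuclideanSpace ℝ (Fin 3) :=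
  !₂[2 * (p 0 * p 2 - p 1 * p 3), - (2 * (p 2 * p 3 + p 0 * p 1)),
    p 2 * p 2 - p 3 * p 3 - p 0 * p 0 + p 1 * p 1]

/-- The differential of `hopfBase`. -/
def hopfBaseDeriv (p η : EuclideanSpace ℝ (Fin 4)) : EuclideanSpace ℝ (Fin 3) :=
  !₂[2 * (η 0 * p 3 + p 0 * η 3 + η 1 * p 2 + p 1 * η 2),
    2 * (p 0 * η 0 - p 1 * η 1 + p 2 * η 2 - p 3 * η 3),
    2 * (η 2 * p 3 + p 2 * η 3 - η 0 * p 1 - p 0 * η 1)]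

/-- The differential of `hopfVec`. -/
def hopfVecDeriv (p η : EuclideanSpace ℝ (Fin 4)) : EuclideanSpace ℝ (Fin 3) :=
  !₂[2 * (η 0 * p 2 + p 0 * η 2 - η 1 * p 3 - p 1 * η 3),
    - (2 * (η 2 * p 3 + p 2 * η 3 + η 0 * p 1 + p 0 * η 1)),
    2 * (p 2 * η 2 - p 3 * η 3 - p 0 * η 0 + p 1 * η 1)]

/-- The third vector of the orthonormal frame which begins with `hopfBase` and `hopfVec`. -/
def hopfNormal (p : EuclideanSpace ℝ (Fin 4)) : EuclideanSpace ℝ (Fin 3) :=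
  !₂[p 0 * p 0 + p 1 * p 1 - p 2 * p 2 - p 3 * p 3, 2 * (p 1 * p 2 - p 0 * p 3),
    2 * (p 0 * p 2 + p 1 * p 3)]

theorem imCoord_eq_hopfBase (Z : S3) :
    imCoord ((toSU2 Z)⁻¹ * matJ * toSU2 Z) = hopfBase Z := by
  rw [toSU2_inv]
  ext i
  fin_cases i <;> simp [imCoord, matJ, toSU2, Matrix.mul_apply, hopfBase] <;> ring

theorem imCoord_eq_hopfVec (Z : S3) :
    imCoord (-((toSU2 Z)⁻¹ * matK * toSU2 Z)) = hopfVec Z := by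
  rw [toSU2_inv]
  ext i
  fin_cases i <;> simp [imCoord, matK, toSU2, Matrix.mul_apply, hopfVec] <;> ring

theorem contDiff_hopfBase : ContDiff ℝ ∞ hopfBase := by
  rw [contDiff_euclidean]
  intro i
  fin_cases i <;> simp [hopfBase] <;> fun_prop

theorem contDiff_hopfVec : ContDiff ℝ ∞ hopfVec := by
  rw [contDiff_euclidean]
  intro i
  fin_cases i <;> simp [hopfVec] <;> fun_prop

theorem hasDerivAt_toLp_three {f : ℝ → Fin 3 → ℝ} {f' : Fin 3 → ℝ} {t : ℝ}
    (h : ∀ i, HasDerivAt (fun s => f s i) (f' i) t) :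
    HasDerivAt (fun s => (WithLp.toLp 2 (f s) : EuclideanSpace ℝ (Fin 3))) (WithLp.toLp 2 f') t :=
  (PiLp.continuousLinearEquiv 2 ℝ (fun _ : Fin 3 => ℝ)).symm.hasFDerivAt.comp_hasDerivAt t
    (hasDerivAt_pi.2 h)

variable {c : ℝ → EuclideanSpace ℝ (Fin 4)} {η : EuclideanSpace ℝ (Fin 4)} {t : ℝ}

theorem hasDerivAt_hopfBase (hc : HasDerivAt c η t) :
    HasDerivAt (fun s => hopfBase (c s)) (hopfBaseDeriv (c t) η) t := by
  have h (i : Fin 4) : HasDerivAt (fun s => c s i) (η i) t :=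
    (EuclideanSpace.proj i : EuclideanSpace ℝ (Fin 4) →L[ℝ] ℝ).hasFDerivAt.comp_hasDerivAt t hc
  refine hasDerivAt_toLp_three fun i => ?_
  fin_cases i
  · exact ((((h 0).mul (h 3)).add ((h 1).mul (h 2))).const_mul 2).congr_deriv (by simp; ring)
  · exact (((((h 0).mul (h 0)).sub ((h 1).mul (h 1))).add ((h 2).mul (h 2))).sub
      ((h 3).mul (h 3))).congr_deriv (by simp; ring)
  · exact ((((h 2).mul (h 3)).sub ((h 0).mul (h 1))).const_mul 2).congr_deriv (by simp; ring)

theorem hasDerivAt_hopfVec (hc : HasDerivAt c η t) :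
    HasDerivAt (fun s => hopfVec (c s)) (hopfVecDeriv (c t) η) t := by
  have h (i : Fin 4) : HasDerivAt (fun s => c s i) (η i) t :=
    (EuclideanSpace.proj i : EuclideanSpace ℝ (Fin 4) →L[ℝ] ℝ).hasFDerivAt.comp_hasDerivAt t hc
  refine hasDerivAt_toLp_three fun i => ?_
  fin_cases i
  · exact ((((h 0).mul (h 2)).sub ((h 1).mul (h 3))).const_mul 2).congr_deriv (by simp; ring)
  · exact ((((h 2).mul (h 3)).add ((h 0).mul (h 1))).const_mul 2).neg.congr_deriv (by simp; ring)
  · exact (((((h 2).mul (h 2)).sub ((h 3).mul (h 3))).sub ((h 0).mul (h 0))).add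
      ((h 1).mul (h 1))).congr_deriv (by simp; ring)

theorem inner_three (a b : EuclideanSpace ℝ (Fin 3)) :
    inner ℝ a b = a 0 * b 0 + a 1 * b 1 + a 2 * b 2 := by
  simp [PiLp.inner_apply, Fin.sum_univ_three, mul_comm]

variable (p : EuclideanSpace ℝ (Fin 4))

/-- On the sphere the right-hand side is four times `λ₀`: up to this factor, `D₀` pulls the contact
form of the round metric back to `λ₀`. -/
theorem inner_hopfVec_hopfBaseDeriv :
    inner ℝ (hopfVec p) (hopfBaseDeriv p η) =
      2 * (p 0 ^ 2 + p 1 ^ 2 + p 2 ^ 2 + p 3 ^ 2) *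
        (p 0 * η 1 - p 1 * η 0 + p 2 * η 3 - p 3 * η 2) := by
  rw [inner_three]
  simp [hopfVec, hopfBaseDeriv]
  ring

theorem inner_hopfVec_self :
    inner ℝ (hopfVec p) (hopfVec p) = (p 0 ^ 2 + p 1 ^ 2 + p 2 ^ 2 + p 3 ^ 2) ^ 2 := by
  rw [inner_three]
  simp [hopfVec]
  ring

theorem inner_hopfBase_hopfVec : inner ℝ (hopfBase p) (hopfVec p) = 0 := by
  rw [inner_three]
  simp [hopfVec, hopfBase]
  ring

theorem inner_hopfBase_hopfNormal : inner ℝ (hopfBase p) (hopfNormal p) = 0 := by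
  rw [inner_three]
  simp [hopfNormal, hopfBase]
  ring

theorem inner_hopfVec_hopfVecDeriv :
    inner ℝ (hopfVecDeriv p η) (hopfVec p) = 2 * (p 0 ^ 2 + p 1 ^ 2 + p 2 ^ 2 + p 3 ^ 2) *
      (p 0 * η 0 + p 1 * η 1 + p 2 * η 2 + p 3 * η 3) := by
  rw [inner_three]
  simp [hopfVec, hopfVecDeriv]
  ring

/-- The hypotheses make `η` orthogonal to `p` and to three vectors obtained from `p` by permuting
coordinates with signs (`hA`, `hB`, `hC`). These four vectors form an orthonormal basis, and the
final linear combinations expand `η` in it. -/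
theorem eq_zero_of_hopf_deriv (hp : p 0 ^ 2 + p 1 ^ 2 + p 2 ^ 2 + p 3 ^ 2 = 1)
    (hη : p 0 * η 0 + p 1 * η 1 + p 2 * η 2 + p 3 * η 3 = 0) (hX : hopfBaseDeriv p η = 0)
    (hV : inner ℝ (hopfVecDeriv p η) (hopfNormal p) = 0) : η = 0 := by
  have hA := inner_hopfVec_hopfBaseDeriv (η := η) p
  rw [hX, inner_zero_right, hp] at hA
  have hB : inner ℝ (hopfBaseDeriv p η) (hopfNormal p) =
      2 * (p 0 ^ 2 + p 1 ^ 2 + p 2 ^ 2 + p 3 ^ 2) *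
        (- p 3 * η 0 - p 2 * η 1 + p 1 * η 2 + p 0 * η 3) := by
    rw [inner_three]
    simp [hopfNormal, hopfBaseDeriv]
    ring
  have hC : inner ℝ (hopfVecDeriv p η) (hopfNormal p) =
      2 * (p 0 ^ 2 + p 1 ^ 2 + p 2 ^ 2 + p 3 ^ 2) *
        (- p 2 * η 0 + p 3 * η 1 + p 0 * η 2 - p 1 * η 3) := by
    rw [inner_three]
    simp [hopfNormal, hopfVecDeriv]
    ring
  rw [hX, inner_zero_left, hp] at hB
  rw [hV, hp] at hC
  ext i
  fin_cases i
  · simp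
    linear_combination p 0 * hη + (1 / 2) * p 1 * hA + (1 / 2) * p 3 * hB + (1 / 2) * p 2 * hC -
      η 0 * hp
  · simp
    linear_combination p 1 * hη - (1 / 2) * p 0 * hA + (1 / 2) * p 2 * hB - (1 / 2) * p 3 * hC -
      η 1 * hp
  · simp
    linear_combination p 2 * hη + (1 / 2) * p 3 * hA - (1 / 2) * p 1 * hB - (1 / 2) * p 0 * hC -
      η 2 * hp
  · simp
    linear_combination p 3 * hη - (1 / 2) * p 2 * hA - (1 / 2) * p 0 * hB + (1 / 2) * p 1 * hC -
      η 3 * hp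

end Hopf

/-! ### Curves in the three-sphere with prescribed velocity. -/

section Curves

theorem extChartAt_target_S3 (Z : S3) : (extChartAt (𝓡 3) Z).target = Set.univ := by
  have := Fact.mk (@finrank_euclideanSpace_fin ℝ _ 4)
  rw [extChartAt_target]
  have h : (chartAt (EuclideanSpace ℝ (Fin 3)) Z).target = Set.univ :=
    stereographic'_target (n := 3) (-Z)
  rw [h]
  simp

/-- A curve through `Z` with velocity `ζ`. -/
def sphereCurve (Z : S3) (ζ : EuclideanSpace ℝ (Fin 3)) (ε : ℝ) : S3 :=
  (extChartAt (𝓡 3) Z).symm (extChartAt (𝓡 3) Z Z + ε • ζ)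

theorem sphereCurve_zero (Z : S3) (ζ : EuclideanSpace ℝ (Fin 3)) : sphereCurve Z ζ 0 = Z := by
  rw [sphereCurve, zero_smul, add_zero, extChartAt_to_inv]

theorem contMDiff_sphereCurve (Z : S3) (ζ : EuclideanSpace ℝ (Fin 3)) :
    ContMDiff 𝓘(ℝ, ℝ) (𝓡 3) ∞ (sphereCurve Z ζ) := by
  have h := contMDiffOn_extChartAt_symm (I := 𝓡 3) (n := ∞) Z
  rw [extChartAt_target_S3, contMDiffOn_univ] at h
  refine h.comp (ContDiff.contMDiff ?_)
  fun_prop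

/-- The manifold derivative at `Z` is the derivative read in the chart at `Z`, where the curve is a
straight line. This turns differentials on the three-sphere into ordinary derivatives in `ε`. -/
theorem hasDerivAt_comp_sphereCurve {F : Type*} [NormedAddCommGroup F] [NormedSpace ℝ F]
    {H : S3 → F} {Z : S3} {L : EuclideanSpace ℝ (Fin 3) →L[ℝ] F}
    (hH : HasMFDerivAt (𝓡 3) 𝓘(ℝ, F) H Z L) (ζ : EuclideanSpace ℝ (Fin 3)) :
    HasDerivAt (fun ε => H (sphereCurve Z ζ ε)) (L ζ) 0 := by
  have h1 : HasFDerivAt (fun b => H ((extChartAt (𝓡 3) Z).symm b)) L (extChartAt (𝓡 3) Z Z) := by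
    have := hH.2
    rw [ModelWithCorners.range_eq_univ] at this
    exact hasFDerivWithinAt_univ.1 this
  have h2 : HasDerivAt (fun ε : ℝ => extChartAt (𝓡 3) Z Z + ε • ζ) ζ 0 := by
    have := ((hasDerivAt_id (0 : ℝ)).smul_const ζ).const_add (extChartAt (𝓡 3) Z Z)
    simpa using this
  have h1' : HasFDerivAt (fun b => H ((extChartAt (𝓡 3) Z).symm b)) L
      (extChartAt (𝓡 3) Z Z + (0 : ℝ) • ζ) := by
    rwa [zero_smul, add_zero]
  exact h1'.comp_hasDerivAt (0 : ℝ) h2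

/-- The differential of a map from the three-sphere, seen along curves and in charts. -/
theorem hasDerivAt_extChartAt_comp_sphereCurve {E H M : Type*} [NormedAddCommGroup E]
    [NormedSpace ℝ E] [TopologicalSpace H] {I : ModelWithCorners ℝ E H} [TopologicalSpace M]
    [ChartedSpace H M] [IsManifold I 1 M] {F : S3 → M} {Z : S3}
    (hF : MDifferentiableAt (𝓡 3) I F Z) {q : M} (hq : F Z ∈ (extChartAt I q).source)
    (ζ : EuclideanSpace ℝ (Fin 3)) :
    HasDerivAt (fun ε => extChartAt I q (F (sphereCurve Z ζ ε)))
      (tangentCoordChange I (F Z) q (F Z) (mfderiv (𝓡 3) I F Z ζ)) 0 := by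
  rw [extChartAt_source] at hq
  have h := (hasMFDerivAt_extChartAt (I := I) hq).comp Z hF.hasMFDerivAt
  rw [mfderiv_chartAt_eq_tangentCoordChange hq] at h
  exact hasDerivAt_comp_sphereCurve h ζ

/-- The velocity in `ℝ⁴` of a tangent vector of the three-sphere. -/
def ambientS3 (Z : S3) (ζ : EuclideanSpace ℝ (Fin 3)) : EuclideanSpace ℝ (Fin 4) :=
  mvfderiv (𝓡 3) (fun q : S3 => (q : EuclideanSpace ℝ (Fin 4))) Z ζ

theorem hasDerivAt_coe_sphereCurve (Z : S3) (ζ : EuclideanSpace ℝ (Fin 3)) :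
    HasDerivAt (fun ε => (sphereCurve Z ζ ε : EuclideanSpace ℝ (Fin 4))) (ambientS3 Z ζ) 0 := by
  have := Fact.mk (@finrank_euclideanSpace_fin ℝ _ 4)
  have h := ((contMDiff_coe_sphere (m := ∞) (n := 3) (E := EuclideanSpace ℝ (Fin 4))
    Z).mdifferentiableAt (by simp)).hasMFDerivAt
  exact hasDerivAt_comp_sphereCurve h ζ

theorem eq_zero_of_ambientS3 {Z : S3} {ζ : EuclideanSpace ℝ (Fin 3)} (h : ambientS3 Z ζ = 0) :
    ζ = 0 := by
  have := Fact.mk (@finrank_euclideanSpace_fin ℝ _ 4)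
  have hi := injective_mvfderiv_subtypeVal_sphere (n := 3) (E := EuclideanSpace ℝ (Fin 4)) Z
  exact hi (h.trans (map_zero _).symm)

theorem ambientS3_orthogonal (Z : S3) (ζ : EuclideanSpace ℝ (Fin 3)) :
    (Z : EuclideanSpace ℝ (Fin 4)) 0 * ambientS3 Z ζ 0 +
      (Z : EuclideanSpace ℝ (Fin 4)) 1 * ambientS3 Z ζ 1 +
      (Z : EuclideanSpace ℝ (Fin 4)) 2 * ambientS3 Z ζ 2 +
      (Z : EuclideanSpace ℝ (Fin 4)) 3 * ambientS3 Z ζ 3 = 0 := by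
  have := Fact.mk (@finrank_euclideanSpace_fin ℝ _ 4)
  have h := range_mvfderiv_subtypeVal (n := 3) (E := EuclideanSpace ℝ (Fin 4)) Z
  have h2 : ambientS3 Z ζ ∈ (Submodule.span ℝ {(Z : EuclideanSpace ℝ (Fin 4))})ᗮ := by
    rw [← h]
    exact ⟨ζ, rfl⟩
  have h3 := Submodule.mem_orthogonal_singleton_iff_inner_right.1 h2
  simp [PiLp.inner_apply, Fin.sum_univ_four] at h3
  linarith

theorem liouville_eq (Z : S3) (ζ : EuclideanSpace ℝ (Fin 3)) :
    liouville Z ζ = (1 / 4) *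
      inner ℝ (hopfVec Z) (hopfBaseDeriv Z (ambientS3 Z ζ)) := by
  rw [inner_hopfVec_hopfBaseDeriv, sum_sq_eq_one Z]
  change (1 / 2 : ℝ) * _ = _
  rw [ambientS3]
  ring

end Curves

/-! ### The covering in charts, and its smoothness. -/

section Cover

/-- The inclusion of the two-sphere in `ℝ³`, in the preferred chart at `x`. -/
def sphereIncl (x : S2) (a : E2) : EuclideanSpace ℝ (Fin 3) := ((extChartAt (𝓡 2) x).symm a : S2)

theorem contMDiff_coe_S2 :
    ContMDiff (𝓡 2) 𝓘(ℝ, EuclideanSpace ℝ (Fin 3)) ∞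
      (fun q : S2 => (q : EuclideanSpace ℝ (Fin 3))) :=
  have := Fact.mk (@finrank_euclideanSpace_fin ℝ _ 3)
  contMDiff_coe_sphere (m := ∞) (n := 2) (E := EuclideanSpace ℝ (Fin 3))

theorem contDiff_sphereIncl (x : S2) : ContDiff ℝ ∞ (sphereIncl x) := by
  rw [← contMDiff_iff_contDiff]
  exact contMDiff_coe_S2.comp (contMDiff_extChartAt_symm_S2 x)

theorem ambient_symmDeriv (x : S2) (a u : E2) :
    ambient ((extChartAt (𝓡 2) x).symm a) (symmDeriv x a u) = fderiv ℝ (sphereIncl x) a u := by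
  have h1 := (contMDiff_coe_S2 ((extChartAt (𝓡 2) x).symm a)).mdifferentiableAt (by simp)
  have h2 := (contMDiff_extChartAt_symm_S2 x a).mdifferentiableAt (by simp)
  have h3 := h1.hasMFDerivAt.comp a h2.hasMFDerivAt
  let L : E2 →L[ℝ] EuclideanSpace ℝ (Fin 3) :=
    (ambient ((extChartAt (𝓡 2) x).symm a)).comp (symmDeriv x a)
  have h4 : HasFDerivAt (sphereIncl x) L a := hasMFDerivAt_iff_hasFDerivAt.1 h3
  rw [h4.fderiv]
  rfl

theorem symmDeriv_surjective (x : S2) (a : E2) : Function.Surjective (symmDeriv x a) := by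
  have ha : a ∈ (extChartAt (𝓡 2) x).target := by rw [extChartAt_target_S2]; trivial
  have h := isInvertible_mfderivWithin_extChartAt_symm (I := 𝓡 2) ha
  rw [ModelWithCorners.range_eq_univ, mfderivWithin_univ] at h
  exact h.surjective

theorem exists_fderiv_sphereIncl_eq (x : S2) (a : E2) (y : EuclideanSpace ℝ (Fin 3))
    (hy : inner ℝ (sphereIncl x a) y = 0) : ∃ u, fderiv ℝ (sphereIncl x) a u = y := by
  obtain ⟨u, hu⟩ := symmDeriv_surjective x a (ofAmbient ((extChartAt (𝓡 2) x).symm a) y)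
  refine ⟨u, ?_⟩
  rw [← ambient_symmDeriv, hu]
  exact ambient_ofAmbient _ _ hy

theorem tangentCoordChange_symmDeriv_self (x : S2) (a u : E2) :
    tangentCoordChange (𝓡 2) ((extChartAt (𝓡 2) x).symm a) x ((extChartAt (𝓡 2) x).symm a)
      (symmDeriv x a u) = u := by
  rw [tangentCoordChange_symmDeriv (extChartAt_symm_mem_source_S2 x a),
    ← tangentCoordChange_eq_fderiv]
  exact tangentCoordChange_self (extChartAt_symm_mem_source_S2 x a)

theorem chartMetric_center (g : Metric2) (x : S2) (u w : E2) :
    chartMetric g x (extChartAt (𝓡 2) x x) u w = g.inner x u w := by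
  have h := chartMetric_tangentCoordChange g (mem_extChartAt_source (I := 𝓡 2) x) u w
  rwa [tangentCoordChange_self (mem_extChartAt_source _),
    tangentCoordChange_self (mem_extChartAt_source _)] at h

/-- The vector which represents, with respect to `g`, the restriction of `⟪V, ·⟫` to the tangent
plane, in the preferred chart at `x`. -/
def chartSharp (g : Metric2) (x : S2) (a : E2) (V : EuclideanSpace ℝ (Fin 3)) : E2 :=
  WithLp.toLp 2 fun k => ∑ l, (metricMatrix g x a)⁻¹ k l *
    inner ℝ V (fderiv ℝ (sphereIncl x) a (e2 l))

theorem chartMetric_chartSharp (g : Metric2) (x : S2) (a : E2) (V : EuclideanSpace ℝ (Fin 3))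
    (u : E2) :
    chartMetric g x a (chartSharp g x a V) u = inner ℝ V (fderiv ℝ (sphereIncl x) a u) := by
  have hu : IsUnit (metricMatrix g x a).det := (det_metricMatrix_pos g x a).ne'.isUnit
  have h1 := Matrix.mul_nonsing_inv (metricMatrix g x a) hu
  have hm (i j : Fin 2) : ∑ k, metricCoeff g x i k a * (metricMatrix g x a)⁻¹ k j =
      (1 : Matrix (Fin 2) (Fin 2) ℝ) i j := by
    rw [← h1, Matrix.mul_apply]
    rfl
  rw [chartMetric_symm, chartMetric_apply]
  conv_rhs => rw [eq_sum_e2 u]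
  have h00 := hm 0 0
  have h01 := hm 0 1
  have h10 := hm 1 0
  have h11 := hm 1 1
  simp [Fin.sum_univ_two] at h00 h01 h10 h11
  simp only [chartSharp, Fin.sum_univ_two, map_add, map_smul, inner_add_right, inner_smul_right]
  generalize inner ℝ V (fderiv ℝ (sphereIncl x) a (e2 0)) = v0
  generalize inner ℝ V (fderiv ℝ (sphereIncl x) a (e2 1)) = v1
  linear_combination u 0 * v0 * h00 + u 0 * v1 * h01 + u 1 * v0 * h10 + u 1 * v1 * h11

theorem contDiff_chartSharp (g : Metric2) (x : S2) :
    ContDiff ℝ ∞ (fun y : E2 × EuclideanSpace ℝ (Fin 3) => chartSharp g x y.1 y.2) := by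
  rw [contDiff_euclidean]
  intro k
  change ContDiff ℝ ∞ (fun y : E2 × EuclideanSpace ℝ (Fin 3) => ∑ l,
    (metricMatrix g x y.1)⁻¹ k l * inner ℝ y.2 (fderiv ℝ (sphereIncl x) y.1 (e2 l)))
  refine ContDiff.sum fun l _ => ?_
  have hM : ContDiff ℝ ∞ (fun y : E2 × EuclideanSpace ℝ (Fin 3) =>
      (metricMatrix g x y.1)⁻¹ k l) := (contDiff_metricMatrix_inv g x k l).comp contDiff_fst
  refine hM.mul ?_
  have hV : ContDiff ℝ ∞ (fun y : E2 × EuclideanSpace ℝ (Fin 3) => y.2) := contDiff_snd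
  have hι : ContDiff ℝ ∞ (fun y : E2 × EuclideanSpace ℝ (Fin 3) =>
      fderiv ℝ (sphereIncl x) y.1 (e2 l)) :=
    (((contDiff_sphereIncl x).fderiv_right (m := ∞) (by simp)).comp contDiff_fst).clm_apply
      contDiff_const
  exact hV.inner ℝ hι

/-- The multiple of `chartSharp g x a V` of length one. -/
def unitChartSharp (g : Metric2) (x : S2) (a : E2) (V : EuclideanSpace ℝ (Fin 3)) : E2 :=
  (√(chartMetric g x a (chartSharp g x a V) (chartSharp g x a V)))⁻¹ • chartSharp g x a V

theorem contDiffAt_unitChartSharp (g : Metric2) (x : S2) (y : E2 × EuclideanSpace ℝ (Fin 3))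
    (hy : chartSharp g x y.1 y.2 ≠ 0) :
    ContDiffAt ℝ ∞ (fun y : E2 × EuclideanSpace ℝ (Fin 3) => unitChartSharp g x y.1 y.2) y := by
  have hpos := chartMetric_pos g x y.1 _ hy
  have hs := (contDiff_chartSharp g x).contDiffAt (x := y)
  have hG : ContDiffAt ℝ ∞ (fun y : E2 × EuclideanSpace ℝ (Fin 3) =>
      chartMetric g x y.1 (chartSharp g x y.1 y.2) (chartSharp g x y.1 y.2)) y :=
    (((contDiff_chartMetric g x).contDiffAt.comp y contDiffAt_fst).clm_apply hs).clm_apply hs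
  exact ((hG.sqrt hpos.ne').inv (Real.sqrt_pos.2 hpos).ne').smul hs

/-- The covector `⟪V, ·⟫` does not vanish: it takes the value `1` on the vector of the round
covering, which is `V` itself. -/
theorem gnorm_sharp_pos (g : Metric2) (Z : S3) :
    0 < gnorm g (coverBase Z) (sharp g (coverBase Z)
      (roundLegendre (coverBase Z) (roundCover Z).snd)) := by
  refine Real.sqrt_pos.2 (g.pos _ _ fun h => ?_)
  have h1 := inner_sharp g (coverBase Z) (roundLegendre (coverBase Z) (roundCover Z).snd)
  rw [h, map_zero] at h1
  have h2 : (0 : ℝ) = inner ℝ (ambient (coverBase Z) (roundCover Z).snd)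
      (ambient (coverBase Z) (roundCover Z).snd) :=
    congrArg (fun L : TangentSpace (𝓡 2) (coverBase Z) →L[ℝ] ℝ => L (roundCover Z).snd) h1
  rw [ambient_roundCover, imCoord_eq_hopfVec, inner_hopfVec_self, sum_sq_eq_one] at h2
  norm_num at h2

theorem inner_cover_snd (g : Metric2) (Z : S3) (u : TangentSpace (𝓡 2) (coverBase Z)) :
    g.inner (coverBase Z) (cover g Z).snd u =
      (gnorm g (coverBase Z) (sharp g (coverBase Z)
        (roundLegendre (coverBase Z) (roundCover Z).snd)))⁻¹ *
      inner ℝ (hopfVec Z) (ambient (coverBase Z) u) := by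
  have h := inner_sharp g (coverBase Z)
    (unitCovector g (coverBase Z) (roundLegendre (coverBase Z) (roundCover Z).snd))
  have h1 := congrArg (fun L : TangentSpace (𝓡 2) (coverBase Z) →L[ℝ] ℝ => L u) h
  refine h1.trans ?_
  change _ * inner ℝ (ambient (coverBase Z) (roundCover Z).snd) (ambient (coverBase Z) u) = _
  rw [ambient_roundCover, imCoord_eq_hopfVec]

theorem inner_injective (g : Metric2) (x : S2) {u w : TangentSpace (𝓡 2) x}
    (h : ∀ z, g.inner x u z = g.inner x w z) : u = w := by
  by_contra hne
  have h1 := g.pos x (u - w) (sub_ne_zero.2 hne)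
  have h2 : g.inner x (u - w) (u - w) = g.inner x u (u - w) - g.inner x w (u - w) := by
    rw [(g.inner x).map_sub, sub_apply]
  linarith [h (u - w)]

theorem inner_cover_self (g : Metric2) (Z : S3) :
    g.inner (coverBase Z) (cover g Z).snd (cover g Z).snd = 1 := by
  set s := sharp g (coverBase Z) (roundLegendre (coverBase Z) (roundCover Z).snd) with hs
  have hpos := gnorm_sharp_pos g Z
  rw [← hs] at hpos
  have hsharp (u : TangentSpace (𝓡 2) (coverBase Z)) : g.inner (coverBase Z) s u =
      inner ℝ (hopfVec Z) (ambient (coverBase Z) u) := by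
    rw [hs, inner_sharp, ← imCoord_eq_hopfVec, ← ambient_roundCover]
    rfl
  have e : (cover g Z).snd = (gnorm g (coverBase Z) s)⁻¹ • s := by
    refine inner_injective g (coverBase Z) fun u => ?_
    rw [inner_cover_snd, map_smul, smul_apply, hsharp, smul_eq_mul]
  have hsq : gnorm g (coverBase Z) s * gnorm g (coverBase Z) s = g.inner (coverBase Z) s s :=
    Real.mul_self_sqrt (Real.sqrt_pos.1 hpos).le
  have e2 : g.inner (coverBase Z) (cover g Z).snd (cover g Z).snd =
      (gnorm g (coverBase Z) s)⁻¹ * ((gnorm g (coverBase Z) s)⁻¹ * g.inner (coverBase Z) s s) := by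
    rw [e]
    simp only [map_smul, smul_apply, smul_eq_mul]
  rw [e2, ← hsq]
  field_simp

/-- The vector component of the covering, in the preferred chart at `x`. -/
def coverCoord (g : Metric2) (x : S2) (Z : S3) : E2 :=
  tangentCoordChange (𝓡 2) (coverBase Z) x (coverBase Z) (fiberCoord (cover g Z))

theorem chartMetric_coverCoord_self (g : Metric2) {x : S2} {Z : S3}
    (h : coverBase Z ∈ (extChartAt (𝓡 2) x).source) :
    chartMetric g x (extChartAt (𝓡 2) x (coverBase Z)) (coverCoord g x Z) (coverCoord g x Z) = 1 :=
  (chartMetric_tangentCoordChange g h _ _).trans (inner_cover_self g Z)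

/-- The defining property of `D_g`, that `v` is dual to a positive multiple of `⟪V, ·⟫`, in an
arbitrary chart. The multiple `r` stays anonymous, since `G v v = 1` determines it. -/
theorem exists_chartMetric_coverCoord (g : Metric2) {x : S2} {Z : S3}
    (h : coverBase Z ∈ (extChartAt (𝓡 2) x).source) :
    ∃ r : ℝ, 0 < r ∧ ∀ u, chartMetric g x (extChartAt (𝓡 2) x (coverBase Z)) (coverCoord g x Z) u =
      r * inner ℝ (hopfVec Z)
        (fderiv ℝ (sphereIncl x) (extChartAt (𝓡 2) x (coverBase Z)) u) := by
  refine ⟨_, inv_pos.2 (gnorm_sharp_pos g Z), fun u => ?_⟩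
  -- The tangent space depends on the point, so the foot point is replaced by a variable before it
  -- is rewritten as the image of its coordinates.
  have key : ∀ q a, q = coverBase Z → q = (extChartAt (𝓡 2) x).symm a →
      ∃ w : TangentSpace (𝓡 2) (coverBase Z),
        tangentCoordChange (𝓡 2) (coverBase Z) x (coverBase Z) w = u ∧
        ambient (coverBase Z) w = fderiv ℝ (sphereIncl x) a u := by
    intro q a h1 h2
    rw [← h1, h2]
    exact ⟨symmDeriv x a u, tangentCoordChange_symmDeriv_self x a u, ambient_symmDeriv x a u⟩
  obtain ⟨w, hw1, hw2⟩ := key _ (extChartAt (𝓡 2) x (coverBase Z)) rfl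
    ((extChartAt (𝓡 2) x).left_inv h).symm
  rw [← hw2, ← inner_cover_snd, ← hw1]
  exact chartMetric_tangentCoordChange g h _ _

/-- `cover` is defined through `Function.invFun`, which hides its smoothness. Two vectors of length
one that are dual to positive multiples of one covector coincide, and this gives a formula that is
visibly smooth. -/
theorem coverCoord_eq (g : Metric2) {x : S2} {Z : S3}
    (h : coverBase Z ∈ (extChartAt (𝓡 2) x).source) :
    chartSharp g x (extChartAt (𝓡 2) x (coverBase Z)) (hopfVec Z) ≠ 0 ∧
    coverCoord g x Z = unitChartSharp g x (extChartAt (𝓡 2) x (coverBase Z)) (hopfVec Z) := by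
  obtain ⟨r, hr, hN⟩ := exists_chartMetric_coverCoord g h
  have h1 := chartMetric_coverCoord_self g h
  set a := extChartAt (𝓡 2) x (coverBase Z)
  set s := chartSharp g x a (hopfVec Z) with hs
  have e : coverCoord g x Z = r • s := by
    refine (isLeviCivita_chart g x).eq_of_inner_eq (a := a) fun u => ?_
    rw [hN, map_smul, smul_apply, hs, chartMetric_chartSharp, smul_eq_mul]
  rw [e] at h1
  simp only [map_smul, smul_apply, smul_eq_mul] at h1
  have hs0 : s ≠ 0 := by
    intro h0
    rw [h0] at h1
    simp at h1
  refine ⟨hs0, ?_⟩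
  have hpos := chartMetric_pos g x a s hs0
  rw [e, unitChartSharp, ← hs]
  congr 1
  refine eq_inv_of_mul_eq_one_left ?_
  have h2 : r ^ 2 * chartMetric g x a s s = 1 := by linarith
  have h3 : √(r ^ 2 * chartMetric g x a s s) = 1 := by rw [h2, Real.sqrt_one]
  rwa [Real.sqrt_mul (sq_nonneg r), Real.sqrt_sq hr.le] at h3

theorem contMDiff_coe_S3 :
    ContMDiff (𝓡 3) 𝓘(ℝ, EuclideanSpace ℝ (Fin 4)) ∞
      (fun q : S3 => (q : EuclideanSpace ℝ (Fin 4))) :=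
  have := Fact.mk (@finrank_euclideanSpace_fin ℝ _ 4)
  contMDiff_coe_sphere (m := ∞) (n := 3) (E := EuclideanSpace ℝ (Fin 4))

theorem coe_coverBase (Z : S3) : (coverBase Z : EuclideanSpace ℝ (Fin 3)) = hopfBase Z :=
  imCoord_eq_hopfBase Z

theorem contMDiff_coverBase : ContMDiff (𝓡 3) (𝓡 2) ∞ coverBase := by
  have := Fact.mk (@finrank_euclideanSpace_fin ℝ _ 3)
  have h : ContMDiff (𝓡 3) 𝓘(ℝ, EuclideanSpace ℝ (Fin 3)) ∞ (fun Z : S3 => hopfBase Z) :=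
    contDiff_hopfBase.contMDiff.comp contMDiff_coe_S3
  have h2 : ∀ Z : S3, hopfBase Z ∈ Metric.sphere (0 : EuclideanSpace ℝ (Fin 3)) 1 := fun Z => by
    rw [← coe_coverBase]
    exact (coverBase Z).2
  have h3 := h.codRestrict_sphere (n := 2) h2
  have e : coverBase = Set.codRestrict (fun Z : S3 => hopfBase Z) _ h2 := by
    ext1 Z
    exact Subtype.ext (coe_coverBase Z)
  rw [e]
  exact h3

theorem eventually_coverBase_mem_source {x : S2} {Z : S3}
    (h : coverBase Z ∈ (extChartAt (𝓡 2) x).source) :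
    ∀ᶠ Z' in 𝓝 Z, coverBase Z' ∈ (extChartAt (𝓡 2) x).source :=
  contMDiff_coverBase.continuous.continuousAt.eventually ((isOpen_extChartAt_source x).mem_nhds h)

theorem contMDiffAt_coverCoord (g : Metric2) {x : S2} {Z : S3}
    (h : coverBase Z ∈ (extChartAt (𝓡 2) x).source) :
    ContMDiffAt (𝓡 3) 𝓘(ℝ, E2) ∞ (coverCoord g x) Z := by
  have h1 : ContMDiffAt (𝓡 3) 𝓘(ℝ, E2) ∞
      (fun Z' => extChartAt (𝓡 2) x (coverBase Z')) Z :=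
    (contMDiffAt_extChartAt' (by rwa [← extChartAt_source (𝓡 2)])).comp Z
      (contMDiff_coverBase Z)
  have h2 : ContMDiffAt (𝓡 3) 𝓘(ℝ, EuclideanSpace ℝ (Fin 3)) ∞ (fun Z' : S3 => hopfVec Z') Z :=
    (contDiff_hopfVec.contMDiff.comp contMDiff_coe_S3) Z
  have h3 := (contDiffAt_unitChartSharp g x
    (extChartAt (𝓡 2) x (coverBase Z), hopfVec Z) (coverCoord_eq g h).1).contMDiffAt.comp Z
    (h1.prodMk_space h2)
  exact h3.congr_of_eventuallyEq
    ((eventually_coverBase_mem_source h).mono fun Z' h' => (coverCoord_eq g h').2)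

theorem contMDiff_cover (g : Metric2) : ContMDiff (𝓡 3) (𝓡 2).tangent ∞ (cover g) := by
  intro Z
  rw [Bundle.contMDiffAt_totalSpace]
  exact ⟨contMDiff_coverBase Z, contMDiffAt_coverCoord g (mem_extChartAt_source (coverBase Z))⟩

end Cover

/-! ### The differential of the covering, the contact plane and the lifted frame. -/

section CoverDeriv

/-- The value of the differential of the covering, as a pair of coordinate vectors. -/
def coverVel (g : Metric2) (Z : S3) (ζ : EuclideanSpace ℝ (Fin 3)) : E2 × E2 := coverDeriv g Z ζ

/-- The foot point of the covering in the chart centred at `coverBase Z`. -/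
def baseCenter (Z : S3) : E2 := extChartAt (𝓡 2) (coverBase Z) (coverBase Z)

theorem coverCoord_center (g : Metric2) (Z : S3) :
    coverCoord g (coverBase Z) Z = fiberCoord (cover g Z) :=
  tangentCoordChange_self (mem_extChartAt_source _)

variable (g : Metric2) (Z : S3) (ζ : EuclideanSpace ℝ (Fin 3))

theorem hasDerivAt_cover_sphereCurve :
    HasDerivAt (fun ε => (extChartAt (𝓡 2) (coverBase Z) (coverBase (sphereCurve Z ζ ε)),
      coverCoord g (coverBase Z) (sphereCurve Z ζ ε))) (coverVel g Z ζ) 0 := by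
  have h := hasDerivAt_extChartAt_comp_sphereCurve (I := (𝓡 2).tangent)
    ((contMDiff_cover g Z).mdifferentiableAt (by simp)) (mem_extChartAt_source (cover g Z)) ζ
  have h2 := h.congr_deriv
    (tangentCoordChange_self (I := (𝓡 2).tangent) (mem_extChartAt_source (cover g Z)))
  exact h2

theorem hasDerivAt_base_sphereCurve :
    HasDerivAt (fun ε => extChartAt (𝓡 2) (coverBase Z) (coverBase (sphereCurve Z ζ ε)))
      (coverVel g Z ζ).1 0 :=
  (hasDerivAt_cover_sphereCurve g Z ζ).fst

theorem hasDerivAt_coverCoord_sphereCurve :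
    HasDerivAt (fun ε => coverCoord g (coverBase Z) (sphereCurve Z ζ ε)) (coverVel g Z ζ).2 0 :=
  (hasDerivAt_cover_sphereCurve g Z ζ).snd

theorem eventually_sphereCurve_mem_source :
    ∀ᶠ ε in 𝓝 (0 : ℝ), coverBase (sphereCurve Z ζ ε) ∈ (extChartAt (𝓡 2) (coverBase Z)).source := by
  have h := (contMDiff_sphereCurve Z ζ).continuous.tendsto 0
  rw [sphereCurve_zero] at h
  exact h.eventually (eventually_coverBase_mem_source (mem_extChartAt_source _))

theorem hasDerivAt_comp_base_sphereCurve {F : Type*} [NormedAddCommGroup F] [NormedSpace ℝ F]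
    {H : E2 → F} (hH : ContDiff ℝ ∞ H) :
    HasDerivAt (fun ε => H (extChartAt (𝓡 2) (coverBase Z) (coverBase (sphereCurve Z ζ ε))))
      (fderiv ℝ H (baseCenter Z) (coverVel g Z ζ).1) 0 := by
  have h1 : HasFDerivAt H (fderiv ℝ H (baseCenter Z))
      (extChartAt (𝓡 2) (coverBase Z) (coverBase (sphereCurve Z ζ 0))) := by
    rw [sphereCurve_zero]
    exact (hH.differentiable (by simp) _).hasFDerivAt
  exact HasFDerivAt.comp_hasDerivAt (0 : ℝ) h1 (hasDerivAt_base_sphereCurve g Z ζ)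

/-- Both sides are the velocity in `ℝ³` of the foot point along `sphereCurve Z ζ`. -/
theorem fderiv_sphereIncl_coverVel :
    fderiv ℝ (sphereIncl (coverBase Z)) (baseCenter Z) (coverVel g Z ζ).1 =
      hopfBaseDeriv Z (ambientS3 Z ζ) := by
  have h2 := hasDerivAt_comp_base_sphereCurve g Z ζ (contDiff_sphereIncl (coverBase Z))
  have h3 := hasDerivAt_hopfBase (hasDerivAt_coe_sphereCurve Z ζ)
  rw [sphereCurve_zero] at h3
  refine h2.unique (h3.congr_of_eventuallyEq ?_)
  filter_upwards [eventually_sphereCurve_mem_source Z ζ] with ε hε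
  rw [sphereIncl, (extChartAt (𝓡 2) (coverBase Z)).left_inv hε,
    coe_coverBase]

set_option maxSynthPendingDepth 10 in
/-- The metric in the chart centred at `coverBase Z` along a curve. -/
theorem hasDerivAt_chartMetric_sphereCurve :
    HasDerivAt (fun ε => chartMetric g (coverBase Z)
      (extChartAt (𝓡 2) (coverBase Z) (coverBase (sphereCurve Z ζ ε))))
      (fderiv ℝ (chartMetric g (coverBase Z)) (baseCenter Z) (coverVel g Z ζ).1) 0 :=
  hasDerivAt_comp_base_sphereCurve g Z ζ (contDiff_chartMetric g (coverBase Z))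

/-- The derivative of `G v v = 1`, in covariant form. -/
theorem chartMetric_connection_coverVel :
    chartMetric g (coverBase Z) (baseCenter Z) ((coverVel g Z ζ).2 +
      chartChristoffel g (coverBase Z) (baseCenter Z) (fiberCoord (cover g Z)) (coverVel g Z ζ).1)
      (fiberCoord (cover g Z)) = 0 := by
  have hLC := isLeviCivita_chart g (coverBase Z)
  have hN := hasDerivAt_coverCoord_sphereCurve g Z ζ
  have h := ((hasDerivAt_chartMetric_sphereCurve g Z ζ).clm_apply hN).clm_apply hN
  have h0 : HasDerivAt (fun _ : ℝ => (1 : ℝ)) 0 0 := hasDerivAt_const _ _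
  have h1 := h.unique (h0.congr_of_eventuallyEq (by
    filter_upwards [eventually_sphereCurve_mem_source Z ζ] with ε hε
    exact chartMetric_coverCoord_self g hε))
  rw [sphereCurve_zero, coverCoord_center] at h1
  change (fderiv ℝ (chartMetric g (coverBase Z)) (baseCenter Z) (coverVel g Z ζ).1
    (fiberCoord (cover g Z)) + chartMetric g (coverBase Z) (baseCenter Z) (coverVel g Z ζ).2)
    (fiberCoord (cover g Z)) + chartMetric g (coverBase Z) (baseCenter Z) (fiberCoord (cover g Z))
    (coverVel g Z ζ).2 = 0 at h1
  rw [add_apply, hLC.compat] at h1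
  rw [map_add, add_apply, hLC.christoffel_symm]
  have e1 := hLC.symm (baseCenter Z) (fiberCoord (cover g Z)) (coverVel g Z ζ).2
  have e2 := hLC.symm (baseCenter Z) (fiberCoord (cover g Z))
    (chartChristoffel g (coverBase Z) (baseCenter Z) (coverVel g Z ζ).1 (fiberCoord (cover g Z)))
  linarith

theorem exists_chartMetric_fiberCoord :
    ∃ r : ℝ, 0 < r ∧ ∀ u, chartMetric g (coverBase Z) (baseCenter Z) (fiberCoord (cover g Z)) u =
      r * inner ℝ (hopfVec Z) (fderiv ℝ (sphereIncl (coverBase Z)) (baseCenter Z) u) := by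
  have h := exists_chartMetric_coverCoord g (mem_extChartAt_source (I := 𝓡 2) (coverBase Z))
  rwa [coverCoord_center] at h

/-- Both sides are nonzero multiples of `⟪V, dX(ζ)⟫`. -/
theorem liouville_eq_zero_iff :
    liouville Z ζ = 0 ↔ chartMetric g (coverBase Z) (baseCenter Z) (fiberCoord (cover g Z))
      (coverVel g Z ζ).1 = 0 := by
  obtain ⟨r, hr, h⟩ := exists_chartMetric_fiberCoord g Z
  rw [h, fderiv_sphereIncl_coverVel, liouville_eq]
  simp [hr.ne']

theorem sphereIncl_baseCenter : sphereIncl (coverBase Z) (baseCenter Z) = hopfBase Z := by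
  rw [sphereIncl, baseCenter, extChartAt_to_inv, coe_coverBase]

-- If the foot point and `v` are stationary to first order, then so is the ray of the covector `⟪V,
-- ·⟫` on the tangent plane. As `V` has constant length, its velocity then has no component along
-- `hopfNormal`, and `eq_zero_of_hopf_deriv` applies.
variable {ζ} in
theorem eq_zero_of_coverVel (h : coverVel g Z ζ = 0) : ζ = 0 := by
  have hX := fderiv_sphereIncl_coverVel g Z ζ
  rw [h, Prod.fst_zero, map_zero] at hX
  set x := coverBase Z with hx
  have hG := hasDerivAt_chartMetric_sphereCurve g Z ζ
  have hN := hasDerivAt_coverCoord_sphereCurve g Z ζ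
  have ha := hasDerivAt_base_sphereCurve g Z ζ
  rw [h, Prod.fst_zero, map_zero] at hG
  rw [h, Prod.snd_zero] at hN
  rw [h, Prod.fst_zero] at ha
  have hι : HasDerivAt (fun ε => fderiv ℝ (sphereIncl x)
      (extChartAt (𝓡 2) x (coverBase (sphereCurve Z ζ ε)))) 0 0 := by
    have h1 : HasFDerivAt (fderiv ℝ (sphereIncl x)) _
        (extChartAt (𝓡 2) x (coverBase (sphereCurve Z ζ 0))) :=
      (((contDiff_sphereIncl x).fderiv_right (m := ∞) (by simp)).differentiable
        (by simp) _).hasFDerivAt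
    exact (HasFDerivAt.comp_hasDerivAt (0 : ℝ) h1 ha).congr_deriv (map_zero _)
  have hV := hasDerivAt_hopfVec (hasDerivAt_coe_sphereCurve Z ζ)
  obtain ⟨r, hr, hrN⟩ := exists_chartMetric_fiberCoord g Z
  set V' := hopfVecDeriv Z (ambientS3 Z ζ) with hV'
  -- Since `G v v = 1`, the unknown proportionality factor can be eliminated: `⟪V, U⟫ = G(v, U) ⟪V,
  -- v⟫` along the curve. In its derivative only the terms with `V'` survive.
  have key (U : E2) : inner ℝ V' (fderiv ℝ (sphereIncl x) (baseCenter Z) U) =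
      chartMetric g x (baseCenter Z) (fiberCoord (cover g Z)) U *
        inner ℝ V' (fderiv ℝ (sphereIncl x) (baseCenter Z) (fiberCoord (cover g Z))) := by
    have hU : HasDerivAt (fun _ : ℝ => U) 0 0 := hasDerivAt_const _ _
    have h1 := ((hG.clm_apply hN).clm_apply hU).mul (hV.inner ℝ (hι.clm_apply hN))
    have h2 := hV.inner ℝ (hι.clm_apply hU)
    have h3 := h2.unique (h1.congr_of_eventuallyEq (by
      filter_upwards [eventually_sphereCurve_mem_source Z ζ] with ε hε
      obtain ⟨s, hs, hsN⟩ := exists_chartMetric_coverCoord g hε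
      have h4 := chartMetric_coverCoord_self g hε
      rw [hsN] at h4
      simp only [Pi.mul_apply, hsN]
      linear_combination (-inner ℝ (hopfVec (sphereCurve Z ζ ε)) (fderiv ℝ (sphereIncl x)
        (extChartAt (𝓡 2) x (coverBase (sphereCurve Z ζ ε))) U)) * h4))
    simp only [sphereCurve_zero, ← hx, map_zero, add_zero, zero_apply, inner_zero_right,
      zero_add, zero_mul] at h3
    have hc : coverCoord g x Z = fiberCoord (cover g Z) := coverCoord_center g Z
    rw [hc] at h3
    exact h3
  set m := inner ℝ V' (fderiv ℝ (sphereIncl x) (baseCenter Z) (fiberCoord (cover g Z))) with hm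
  have hVV : inner ℝ (hopfVec Z) (hopfVec Z) = (1 : ℝ) := by
    rw [inner_hopfVec_self, sum_sq_eq_one, one_pow]
  have hVV' : inner ℝ V' (hopfVec Z) = (0 : ℝ) := by
    rw [hV', inner_hopfVec_hopfVecDeriv, ambientS3_orthogonal, mul_zero]
  -- Take for `U` the tangent vector `V`: then `⟪V', V⟫ = 0`, whereas `G(v, V) = r` is positive.
  have hm0 : m = 0 := by
    obtain ⟨U, hU⟩ := exists_fderiv_sphereIncl_eq x (baseCenter Z) (hopfVec Z)
      (by rw [sphereIncl_baseCenter, inner_hopfBase_hopfVec])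
    have h1 := key U
    rw [hrN, hU, hVV, hVV'] at h1
    have h2 : r * m = 0 := by linarith
    exact (mul_eq_zero.1 h2).resolve_left hr.ne'
  obtain ⟨U, hU⟩ := exists_fderiv_sphereIncl_eq x (baseCenter Z) (hopfNormal Z)
    (by rw [sphereIncl_baseCenter, inner_hopfBase_hopfNormal])
  have h1 := key U
  rw [hU, hm0, mul_zero] at h1
  exact eq_zero_of_ambientS3
    (eq_zero_of_hopf_deriv _ (sum_sq_eq_one Z) (ambientS3_orthogonal Z ζ) hX.symm h1)

theorem coverVel_add_smul (a b : ℝ) (ζ ζ' : TangentSpace (𝓡 3) Z) :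
    coverVel g Z (a • ζ + b • ζ') = a • coverVel g Z ζ + b • coverVel g Z ζ' := by
  have h : coverDeriv g Z (a • ζ + b • ζ') = a • coverDeriv g Z ζ + b • coverDeriv g Z ζ' := by
    rw [map_add, map_smul, map_smul]
  exact h

theorem coverVel_injective {ζ ζ' : TangentSpace (𝓡 3) Z}
    (h : coverVel g Z ζ = coverVel g Z ζ') : ζ = ζ' := by
  have h1 := coverVel_add_smul g Z 1 (-1) ζ ζ'
  rw [h, one_smul, one_smul, neg_one_smul, neg_one_smul, add_neg_cancel] at h1
  exact add_neg_eq_zero.1 (eq_zero_of_coverVel g Z h1)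

theorem chartMetric_fiberCoord_self : chartMetric g (coverBase Z) (baseCenter Z)
    (fiberCoord (cover g Z)) (fiberCoord (cover g Z)) = 1 := by
  have h := chartMetric_coverCoord_self g (mem_extChartAt_source (I := 𝓡 2) (coverBase Z))
  rwa [coverCoord_center] at h

/-- The image of the differential of the covering is the kernel of a linear form. -/
theorem exists_coverVel_eq {η : E2 × E2}
    (h : chartMetric g (coverBase Z) (baseCenter Z) (η.2 + chartChristoffel g (coverBase Z)
      (baseCenter Z) (fiberCoord (cover g Z)) η.1) (fiberCoord (cover g Z)) = 0) :
    ∃ ζ, coverVel g Z ζ = η := by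
  let L : EuclideanSpace ℝ (Fin 3) →L[ℝ] E2 × E2 := coverDeriv g Z
  let Φ : E2 × E2 →L[ℝ] ℝ := ((chartMetric g (coverBase Z) (baseCenter Z)).flip
    (fiberCoord (cover g Z))).comp (ContinuousLinearMap.snd ℝ E2 E2 +
      (chartChristoffel g (coverBase Z) (baseCenter Z) (fiberCoord (cover g Z))).comp
        (ContinuousLinearMap.fst ℝ E2 E2))
  have hle : LinearMap.range L.toLinearMap ≤ LinearMap.ker Φ.toLinearMap := by
    rintro _ ⟨ζ, rfl⟩
    exact chartMetric_connection_coverVel g Z ζ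
  have hinj : Function.Injective L.toLinearMap := fun _ _ h => coverVel_injective g Z h
  have hΦ : Φ (0, fiberCoord (cover g Z)) = 1 := by
    have e : Φ (0, fiberCoord (cover g Z)) = chartMetric g (coverBase Z) (baseCenter Z)
        (fiberCoord (cover g Z) + chartChristoffel g (coverBase Z) (baseCenter Z)
          (fiberCoord (cover g Z)) 0) (fiberCoord (cover g Z)) := rfl
    rw [e, map_zero, add_zero, chartMetric_fiberCoord_self]
  have hsurj : LinearMap.range Φ.toLinearMap = ⊤ := by
    refine LinearMap.range_eq_top.2 fun c => ⟨c • (0, fiberCoord (cover g Z)), ?_⟩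
    rw [map_smul]
    exact (congrArg (c • ·) hΦ).trans (mul_one c)
  -- The image has dimension `3` and lies in the kernel of a nonzero form on a space of dimension
  -- `4`.
  have h1 := LinearMap.finrank_range_of_inj hinj
  have h2 := LinearMap.finrank_range_add_finrank_ker Φ.toLinearMap
  rw [hsurj, finrank_top, Module.finrank_prod, finrank_euclideanSpace_fin,
    Module.finrank_self] at h2
  rw [finrank_euclideanSpace_fin] at h1
  have h3 : η ∈ LinearMap.range L.toLinearMap := by
    rw [Submodule.eq_of_le_of_finrank_eq hle (by omega)]
    exact h
  exact h3

variable (o : ℤˣ)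

/-- The vector `v^⊥` at the point `cover g Z`, as a coordinate vector. -/
def perpCoord : E2 := perp g o (coverBase Z) (cover g Z).snd

theorem chartMetric_perpCoord :
    chartMetric g (coverBase Z) (baseCenter Z) (perpCoord g Z o) (perpCoord g Z o) = 1 ∧
      chartMetric g (coverBase Z) (baseCenter Z) (perpCoord g Z o) (fiberCoord (cover g Z)) = 0 ∧
      0 < ((o : ℤ) : ℝ) * areaForm (coverBase Z) (cover g Z).snd
        (perp g o (coverBase Z) (cover g Z).snd) := by
  have hne : (cover g Z).snd ≠ 0 := by
    intro h
    have h1 := inner_cover_self g Z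
    have h2 : g.inner (coverBase Z) (cover g Z).snd (cover g Z).snd = 0 :=
      (congrArg (fun u : TangentSpace (𝓡 2) (coverBase Z) =>
        g.inner (coverBase Z) (cover g Z).snd u) h).trans (map_zero _)
    exact zero_ne_one (h2.symm.trans h1)
  have h := perp_spec g o (coverBase Z) (cover g Z).snd hne
  exact ⟨(chartMetric_center g _ _ _).trans h.1, (chartMetric_center g _ _ _).trans h.2.1, h.2.2⟩

theorem coverVel_liftedFrame_zero :
    coverVel g Z (liftedFrame g o Z 0) = (0, perpCoord g Z o) := by
  have h : ∃ ζ, coverVel g Z ζ = ((0 : E2), perpCoord g Z o) :=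
    exists_coverVel_eq g Z (by rw [map_zero, add_zero]; exact (chartMetric_perpCoord g Z o).2.1)
  exact Function.invFun_eq h

theorem coverVel_liftedFrame_one :
    coverVel g Z (liftedFrame g o Z 1) = (perpCoord g Z o,
      - chartChristoffel g (coverBase Z) (baseCenter Z) (fiberCoord (cover g Z))
        (perpCoord g Z o)) := by
  have e : (perpCoord g Z o, - chartChristoffel g (coverBase Z) (baseCenter Z)
      (fiberCoord (cover g Z)) (perpCoord g Z o)) = geodesicFrame g o (cover g Z) 1 :=
    Prod.ext rfl (congrArg Neg.neg (chartChristoffel_center g (coverBase Z) _ _))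
  refine (Function.invFun_eq (f := coverVel g Z) (b := geodesicFrame g o (cover g Z) 1) ?_).trans
    e.symm
  rw [← e]
  refine exists_coverVel_eq g Z ?_
  simp

theorem coverDeriv_liftedFrame (i : Fin 2) :
    coverDeriv g Z (liftedFrame g o Z i) = geodesicFrame g o (cover g Z) i := by
  obtain rfl | rfl : i = 0 ∨ i = 1 := by omega
  · exact coverVel_liftedFrame_zero g Z o
  · refine (coverVel_liftedFrame_one g Z o).trans ?_
    exact Prod.ext rfl (congrArg Neg.neg (chartChristoffel_center g (coverBase Z) _ _))

/-- The difference of the two sides is orthogonal to the orthonormal pair `v`, `n`, which spans the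
plane. -/
theorem IsLeviCivita.eq_smul_of_orthogonal {G : E2 → E2 →L[ℝ] E2 →L[ℝ] ℝ}
    {Γ : E2 → E2 →L[ℝ] E2 →L[ℝ] E2} (h : IsLeviCivita G Γ) {a v n u : E2} (hv : G a v v = 1)
    (hn : G a n n = 1) (hnv : G a n v = 0) (hu : G a u v = 0) : u = G a u n • n := by
  set w := u - G a u n • n with hw
  have hwv : G a w v = 0 := by
    rw [hw, (G a).map_sub, (G a).map_smul, sub_apply, smul_apply, hu, hnv, smul_zero, sub_zero]
  have hwn : G a w n = 0 := by
    rw [hw, (G a).map_sub, (G a).map_smul, sub_apply, smul_apply, hn, smul_eq_mul, mul_one,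
      sub_self]
  -- Cramer's rule: the linear relation between three vectors of a plane.
  have e : wedge v n • w = wedge w n • v + wedge v w • n := by
    ext i
    obtain rfl | rfl : i = 0 ∨ i = 1 := by omega
    · simp [wedge]
      ring
    · simp [wedge]
      ring
  have h1 : wedge v n * G a w w = 0 := by
    rw [← smul_eq_mul, ← map_smul, e, map_add, map_smul, map_smul, hwv, hwn]
    simp
  have h2 := wedge_sq_mul_gram (G a) v n
  rw [hv, hn, hnv] at h2
  have h3 : wedge v n ≠ 0 := by
    intro h0
    rw [h0] at h2
    norm_num at h2
  have h4 := (mul_eq_zero.1 h1).resolve_left h3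
  have h5 : w = 0 := by
    by_contra hne
    exact (h.pos a w hne).ne' h4
  exact sub_eq_zero.1 h5

theorem mem_contactPlane_iff {ζ : TangentSpace (𝓡 3) Z} :
    ζ ∈ contactPlane Z ↔ chartMetric g (coverBase Z) (baseCenter Z) (fiberCoord (cover g Z))
      (coverVel g Z ζ).1 = 0 :=
  LinearMap.mem_ker.trans (liouville_eq_zero_iff g Z ζ)

theorem coverVel_liftedFrame (a b : ℝ) :
    coverVel g Z (a • liftedFrame g o Z 0 + b • liftedFrame g o Z 1) =
      (b • perpCoord g Z o, a • perpCoord g Z o - b • chartChristoffel g (coverBase Z)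
        (baseCenter Z) (fiberCoord (cover g Z)) (perpCoord g Z o)) := by
  rw [coverVel_add_smul, coverVel_liftedFrame_zero, coverVel_liftedFrame_one]
  ext1
  · simp
  · simp [sub_eq_add_neg]

/-- The coordinates of a contact vector in the lifted geodesic frame. -/
theorem eq_liftedFrame_of_mem_contactPlane {ζ : TangentSpace (𝓡 3) Z}
    (hζ : ζ ∈ contactPlane Z) : ∃ a b : ℝ,
      ζ = a • liftedFrame g o Z 0 + b • liftedFrame g o Z 1 ∧
      (coverVel g Z ζ).2 + chartChristoffel g (coverBase Z) (baseCenter Z)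
        (fiberCoord (cover g Z)) (coverVel g Z ζ).1 = a • perpCoord g Z o ∧
      (coverVel g Z ζ).1 = b • perpCoord g Z o := by
  have hLC := isLeviCivita_chart g (coverBase Z)
  obtain ⟨hn, hnv, -⟩ := chartMetric_perpCoord g Z o
  -- The contact condition makes the horizontal part orthogonal to `v`; constant length does the
  -- same for the connection part. So both are multiples of `v^⊥`.
  have hJ := (mem_contactPlane_iff g Z).1 hζ
  rw [hLC.symm] at hJ
  have hJ' := hLC.eq_smul_of_orthogonal (chartMetric_fiberCoord_self g Z) hn hnv hJ
  have hK' := hLC.eq_smul_of_orthogonal (chartMetric_fiberCoord_self g Z) hn hnv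
    (chartMetric_connection_coverVel g Z ζ)
  refine ⟨_, _, ?_, hK', hJ'⟩
  refine coverVel_injective g Z ?_
  rw [coverVel_liftedFrame]
  refine Prod.ext hJ' ?_
  rw [← map_smul, ← hJ']
  exact eq_sub_of_add_eq hK'

theorem perpCoord_ne_zero : perpCoord g Z o ≠ 0 := by
  intro h
  have h1 := (chartMetric_perpCoord g Z o).1
  rw [h, map_zero] at h1
  exact zero_ne_one h1

theorem linearIndependent_liftedFrame : LinearIndependent ℝ (liftedFrame g o Z) := by
  rw [Fintype.linearIndependent_iff]
  intro c hc
  rw [Fin.sum_univ_two] at hc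
  have h := coverVel_liftedFrame g Z o (c 0) (c 1)
  have hz : coverVel g Z (0 : TangentSpace (𝓡 3) Z) = 0 := map_zero (coverDeriv g Z)
  rw [hc, hz] at h
  have h1 : c 1 = 0 := ((smul_eq_zero.1 (congrArg Prod.fst h).symm)).resolve_right
    (perpCoord_ne_zero g Z o)
  have h2 := congrArg Prod.snd h
  rw [h1, zero_smul, zero_smul, sub_zero] at h2
  have h0 : c 0 = 0 := (smul_eq_zero.1 h2.symm).resolve_right (perpCoord_ne_zero g Z o)
  intro i
  obtain rfl | rfl : i = 0 ∨ i = 1 := by omega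
  · exact h0
  · exact h1

theorem span_liftedFrame :
    Submodule.span ℝ (Set.range (liftedFrame g o Z)) = contactPlane Z := by
  refine le_antisymm (Submodule.span_le.2 ?_) fun ζ hζ => ?_
  · rintro _ ⟨i, rfl⟩
    have hLC := isLeviCivita_chart g (coverBase Z)
    refine (mem_contactPlane_iff g Z).2 ?_
    obtain rfl | rfl : i = 0 ∨ i = 1 := by omega
    · rw [coverVel_liftedFrame_zero, map_zero]
    · rw [coverVel_liftedFrame_one, hLC.symm]
      exact (chartMetric_perpCoord g Z o).2.1
  · obtain ⟨a, b, h, -⟩ := eq_liftedFrame_of_mem_contactPlane g Z o hζ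
    rw [h]
    exact add_mem (Submodule.smul_mem _ _ (Submodule.subset_span ⟨0, rfl⟩))
      (Submodule.smul_mem _ _ (Submodule.subset_span ⟨1, rfl⟩))

end CoverDeriv

/-! ### The lifted flow and its linearisation in a fixed chart. -/

section FlowCharts

/-- The covering, in the chart of the tangent bundle induced by the preferred chart at `x`. -/
def coverChart (g : Metric2) (x : S2) (W : S3) : E2 × E2 :=
  (extChartAt (𝓡 2) x (coverBase W), coverCoord g x W)

/-- The differential of the transition map from the preferred chart at `coverBase W` to the
preferred chart at `x`. -/
def chartChange (x : S2) (W : S3) : E2 →L[ℝ] E2 :=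
  tangentCoordChange (𝓡 2) (coverBase W) x (coverBase W)

/-- The covariant derivative of the vector component of the covering. -/
def connectionVel (g : Metric2) (W : S3) (η : EuclideanSpace ℝ (Fin 3)) : E2 :=
  (coverVel g W η).2 + chartChristoffel g (coverBase W) (baseCenter W) (fiberCoord (cover g W))
    (coverVel g W η).1

theorem contMDiffAt_coverChart (g : Metric2) {x : S2} {W : S3}
    (h : coverBase W ∈ (extChartAt (𝓡 2) x).source) :
    ContMDiffAt (𝓡 3) 𝓘(ℝ, E2 × E2) ∞ (coverChart g x) W := by
  have h1 : ContMDiffAt (𝓡 3) 𝓘(ℝ, E2) ∞ (fun W' => extChartAt (𝓡 2) x (coverBase W')) W :=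
    (contMDiffAt_extChartAt' (by rwa [← extChartAt_source (𝓡 2)])).comp W (contMDiff_coverBase W)
  exact h1.prodMk_space (contMDiffAt_coverCoord g h)

theorem chartMetric_chartChange (g : Metric2) {x : S2} {W : S3}
    (h : coverBase W ∈ (extChartAt (𝓡 2) x).source) (u w : E2) :
    chartMetric g x (extChartAt (𝓡 2) x (coverBase W)) (chartChange x W u) (chartChange x W w) =
      chartMetric g (coverBase W) (baseCenter W) u w :=
  (chartMetric_tangentCoordChange g h u w).trans (chartMetric_center g _ u w).symm

theorem tangentCoordChange_cover_connection (g : Metric2) (p : TS2) {W : S3}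
    (h : coverBase W ∈ (extChartAt (𝓡 2) p.1).source) (η : E2 × E2) :
    (tangentCoordChange (𝓡 2).tangent (cover g W) p (cover g W) η).1 = chartChange p.1 W η.1 ∧
    (tangentCoordChange (𝓡 2).tangent (cover g W) p (cover g W) η).2 +
      chartChristoffel g p.1 (coverChart g p.1 W).1 (coverChart g p.1 W).2
        (chartChange p.1 W η.1) =
      chartChange p.1 W (η.2 + chartChristoffel g (coverBase W) (baseCenter W)
        (fiberCoord (cover g W)) η.1) := by
  refine ⟨tangentCoordChange_TS2_fst h η, (tangentCoordChange_connectionMap g h η).trans ?_⟩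
  exact congrArg (fun u : E2 => chartChange p.1 W (η.2 + u))
    (chartChristoffel_center g (coverBase W) (fiberCoord (cover g W)) η.1).symm

/-- The geodesic equation: the generator is horizontal, and the vanishing of the connection map does
not depend on the chart. -/
theorem hasDerivAt_coverChart_flow {g : Metric2} {φ : Flow ℝ S3} (hφ : IsLiftedGeodesicFlow g φ)
    {x : S2} {W : S3} {s : ℝ} (h : coverBase (φ s W) ∈ (extChartAt (𝓡 2) x).source) :
    HasDerivAt (fun t => coverChart g x (φ t W)) ((coverChart g x (φ s W)).2,
      - chartChristoffel g x (coverChart g x (φ s W)).1 (coverChart g x (φ s W)).2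
        (coverChart g x (φ s W)).2) s := by
  -- Charts of the tangent bundle depend only on the foot point of their centre, so the vector `0`
  -- is an arbitrary choice.
  let p : TS2 := ⟨x, 0⟩
  have hq : cover g (φ s W) ∈ (extChartAt (𝓡 2).tangent p).source := mem_extChartAt_TS2_source.2 h
  rw [extChartAt_source] at hq
  have h1 := (hasMFDerivAt_extChartAt (I := (𝓡 2).tangent) hq).comp s (hφ.lift W s)
  rw [mfderiv_chartAt_eq_tangentCoordChange hq] at h1
  let η : E2 × E2 := geodesicField g (cover g (φ s W))
  let T : E2 × E2 →L[ℝ] E2 × E2 := tangentCoordChange (𝓡 2).tangent (cover g (φ s W)) p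
    (cover g (φ s W))
  have h2 : HasFDerivAt (fun t => coverChart g x (φ t W))
      (T.comp ((1 : ℝ →L[ℝ] ℝ).smulRight η)) s := hasMFDerivAt_iff_hasFDerivAt.1 h1
  have h3 : HasDerivAt (fun t => coverChart g x (φ t W)) (T η) s :=
    h2.hasDerivAt.congr_deriv (congrArg T (one_smul ℝ η))
  refine h3.congr_deriv ?_
  obtain ⟨h4, h5⟩ := tangentCoordChange_cover_connection g p h η
  have h6 : η.2 + chartChristoffel g (coverBase (φ s W)) (baseCenter (φ s W))
      (fiberCoord (cover g (φ s W))) η.1 = 0 := by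
    have e := congrArg (fun u : E2 => η.2 + u) (chartChristoffel_center g (coverBase (φ s W))
      (fiberCoord (cover g (φ s W))) η.1)
    exact e.trans (connectionMap_horizontalLift g (cover g (φ s W)) (cover g (φ s W)).snd)
  rw [h6, map_zero] at h5
  exact Prod.ext h4 (eq_neg_of_add_eq_zero_left h5)

/-- The linearised flow, on coordinate vectors. -/
def flowDeriv (φ : Flow ℝ S3) (t : ℝ) (Z : S3) :
    EuclideanSpace ℝ (Fin 3) →L[ℝ] EuclideanSpace ℝ (Fin 3) :=
  linearised φ t Z

theorem IsLiftedGeodesicFlow.contMDiff {g : Metric2} {φ : Flow ℝ S3}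
    (hφ : IsLiftedGeodesicFlow g φ) (t : ℝ) : ContMDiff (𝓡 3) (𝓡 3) ∞ (φ t) :=
  hφ.smooth.comp (contMDiff_const.prodMk contMDiff_id)

theorem hasDerivAt_coverChart_flow_sphereCurve {g : Metric2} {φ : Flow ℝ S3}
    (hφ : IsLiftedGeodesicFlow g φ) {x : S2} {Z : S3} {s : ℝ}
    (h : coverBase (φ s Z) ∈ (extChartAt (𝓡 2) x).source) (ζ : EuclideanSpace ℝ (Fin 3)) :
    ∃ η : E2 × E2, HasDerivAt (fun ε => coverChart g x (φ s (sphereCurve Z ζ ε))) η 0 ∧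
      η.1 = chartChange x (φ s Z) (coverVel g (φ s Z) (flowDeriv φ s Z ζ)).1 ∧
      η.2 + chartChristoffel g x (coverChart g x (φ s Z)).1 (coverChart g x (φ s Z)).2 η.1 =
        chartChange x (φ s Z) (connectionVel g (φ s Z) (flowDeriv φ s Z ζ)) := by
  let p : TS2 := ⟨x, 0⟩
  have hq : cover g (φ s Z) ∈ (extChartAt (𝓡 2).tangent p).source := mem_extChartAt_TS2_source.2 h
  have hc := (contMDiff_cover g (φ s Z)).mdifferentiableAt (by simp)
  have hf := (hφ.contMDiff s Z).mdifferentiableAt (by simp)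
  have h1 := hasDerivAt_extChartAt_comp_sphereCurve (I := (𝓡 2).tangent)
    (F := cover g ∘ φ s) (Z := Z) (hc.comp Z hf) hq ζ
  obtain ⟨h4, h5⟩ := tangentCoordChange_cover_connection g p h
    (coverVel g (φ s Z) (flowDeriv φ s Z ζ))
  have h2 : HasDerivAt (fun ε => coverChart g x (φ s (sphereCurve Z ζ ε)))
      (tangentCoordChange (𝓡 2).tangent (cover g (φ s Z)) p (cover g (φ s Z))
        (coverVel g (φ s Z) (flowDeriv φ s Z ζ))) 0 := by
    refine h1.congr_deriv ?_
    refine congrArg (tangentCoordChange (𝓡 2).tangent (cover g (φ s Z)) p (cover g (φ s Z))) ?_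
    rw [mfderiv_comp Z hc hf]
    rfl
  refine ⟨_, h2, h4, ?_⟩
  rw [h4]
  exact h5

theorem flowDeriv_zero (φ : Flow ℝ S3) (Z : S3) (ζ : EuclideanSpace ℝ (Fin 3)) :
    flowDeriv φ 0 Z ζ = ζ := by
  -- The target tangent space depends on `φ 0 Z`, which is only propositionally `Z`; the equation is
  -- therefore substituted for a variable map, with derivatives read as maps of coordinate vectors.
  have key : ∀ f : S3 → S3, f = id →
      (mfderiv (𝓡 3) (𝓡 3) f Z : EuclideanSpace ℝ (Fin 3) →L[ℝ] EuclideanSpace ℝ (Fin 3)) ζ = ζ := by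
    rintro _ rfl
    rw [mfderiv_id]
    rfl
  exact key (φ 0) (funext φ.map_zero_apply)

theorem flowDeriv_add {g : Metric2} {φ : Flow ℝ S3} (hφ : IsLiftedGeodesicFlow g φ) (s t : ℝ)
    (Z : S3) (ζ : EuclideanSpace ℝ (Fin 3)) :
    flowDeriv φ (s + t) Z ζ = flowDeriv φ s (φ t Z) (flowDeriv φ t Z ζ) := by
  have key : ∀ f : S3 → S3, f = φ s ∘ φ t →
      (mfderiv (𝓡 3) (𝓡 3) f Z : EuclideanSpace ℝ (Fin 3) →L[ℝ] EuclideanSpace ℝ (Fin 3)) ζ =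
        flowDeriv φ s (φ t Z) (flowDeriv φ t Z ζ) := by
    rintro _ rfl
    rw [mfderiv_comp Z ((hφ.contMDiff s (φ t Z)).mdifferentiableAt (by simp))
      ((hφ.contMDiff t Z).mdifferentiableAt (by simp))]
    rfl
  exact key _ (funext fun W => φ.map_add s t W)

/-- The variation of a trajectory of the lifted flow, in a chart of the tangent bundle. -/
def flowVariation (g : Metric2) (φ : Flow ℝ S3) (x : S2) (Z : S3) (ζ : EuclideanSpace ℝ (Fin 3))
    (q : ℝ × ℝ) : E2 × E2 :=
  coverChart g x (φ q.1 (sphereCurve Z ζ q.2))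

theorem contMDiff_flow_sphereCurve {g : Metric2} {φ : Flow ℝ S3}
    (hφ : IsLiftedGeodesicFlow g φ) (Z : S3) (ζ : EuclideanSpace ℝ (Fin 3)) :
    ContMDiff 𝓘(ℝ, ℝ × ℝ) (𝓡 3) ∞ (fun q : ℝ × ℝ => φ q.1 (sphereCurve Z ζ q.2)) :=
  hφ.smooth.comp ((contDiff_fst.contMDiff).prodMk
    ((contMDiff_sphereCurve Z ζ).comp contDiff_snd.contMDiff))

end FlowCharts

/-! ### Variations of trajectories. -/

section FlowVariation

theorem hasDerivAt_comp_line_fst {E : Type*} [NormedAddCommGroup E] [NormedSpace ℝ E]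
    {f : ℝ × ℝ → E} {q : ℝ × ℝ} (hf : DifferentiableAt ℝ f q) :
    HasDerivAt (fun t => f (t, q.2)) (fderiv ℝ f q (1, 0)) q.1 :=
  HasFDerivAt.comp_hasDerivAt (f := fun t : ℝ => (t, q.2)) q.1 hf.hasFDerivAt
    ((hasDerivAt_id q.1).prodMk (hasDerivAt_const q.1 q.2))

theorem hasDerivAt_comp_line_snd {E : Type*} [NormedAddCommGroup E] [NormedSpace ℝ E]
    {f : ℝ × ℝ → E} {q : ℝ × ℝ} (hf : DifferentiableAt ℝ f q) :
    HasDerivAt (fun t => f (q.1, t)) (fderiv ℝ f q (0, 1)) q.2 :=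
  HasFDerivAt.comp_hasDerivAt (f := fun t : ℝ => (q.1, t)) q.2 hf.hasFDerivAt
    ((hasDerivAt_const q.2 q.1).prodMk (hasDerivAt_id q.2))

theorem tendsto_line : Tendsto (fun s : ℝ => (s, (0 : ℝ))) (𝓝 0) (𝓝 0) :=
  (continuous_id.prodMk continuous_const).tendsto' 0 0 rfl

set_option maxSynthPendingDepth 10 in
theorem IsLeviCivita.hasDerivAt_metric {E : Type*} [NormedAddCommGroup E] [NormedSpace ℝ E]
    {G : E → E →L[ℝ] E →L[ℝ] ℝ} {Γ : E → E →L[ℝ] E →L[ℝ] E} (h : IsLeviCivita G Γ)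
    {x v w : ℝ → E} {x' v' w' : E} {t : ℝ} (hx : HasDerivAt x x' t) (hv : HasDerivAt v v' t)
    (hw : HasDerivAt w w' t) :
    HasDerivAt (fun s => G (x s) (v s) (w s)) (G (x t) (v' + Γ (x t) x' (v t)) (w t) +
      G (x t) (v t) (w' + Γ (x t) x' (w t))) t := by
  have hG : HasDerivAt (fun s => G (x s)) (fderiv ℝ G (x t) x') t :=
    HasFDerivAt.comp_hasDerivAt t (h.differentiableAt_metric (x t)).hasFDerivAt hx
  refine ((hG.clm_apply hv).clm_apply hw).congr_deriv ?_
  rw [add_apply, h.compat, map_add, map_add, add_apply]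
  ring

variable {g : Metric2} {φ : Flow ℝ S3}

/-- The first variation formula: `∇v = 0` and `∇J = K`, so `g(v, J)' = g(v, K)`. -/
theorem IsLeviCivita.hasDerivAt_inner_variation {E : Type*} [NormedAddCommGroup E]
    [NormedSpace ℝ E] {G : E → E →L[ℝ] E →L[ℝ] ℝ} {Γ : E → E →L[ℝ] E →L[ℝ] E}
    (h : IsLeviCivita G Γ) {f : ℝ × ℝ → E × E} (hf : ContDiffAt ℝ ∞ f 0)
    (hgeo : ∀ᶠ p in 𝓝 (0 : ℝ × ℝ),
      fderiv ℝ f p (1, 0) = ((f p).2, - Γ (f p).1 (f p).2 (f p).2)) :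
    HasDerivAt (fun s : ℝ => G (f (s, 0)).1 (f (s, 0)).2 (fderiv ℝ f (s, 0) (0, 1)).1)
      (G (f 0).1 (f 0).2 ((fderiv ℝ f 0 (0, 1)).2 +
        Γ (f 0).1 (f 0).2 (fderiv ℝ f 0 (0, 1)).1)) 0 := by
  obtain ⟨hx, hv, hξ, -⟩ := h.jacobi hf hgeo
  have e : ((0 : ℝ), (0 : ℝ)) = 0 := rfl
  refine (h.hasDerivAt_metric hx hv hξ).congr_deriv ?_
  rw [e, neg_add_cancel, map_zero, zero_apply, zero_add, sub_add_cancel]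

theorem contDiffAt_flowVariation (hφ : IsLiftedGeodesicFlow g φ) {x : S2} {Z : S3}
    {ζ : EuclideanSpace ℝ (Fin 3)} {q : ℝ × ℝ}
    (h : coverBase (φ q.1 (sphereCurve Z ζ q.2)) ∈ (extChartAt (𝓡 2) x).source) :
    ContDiffAt ℝ ∞ (flowVariation g φ x Z ζ) q := by
  rw [← contMDiffAt_iff_contDiffAt]
  exact (contMDiffAt_coverChart g h).comp q (contMDiff_flow_sphereCurve hφ Z ζ q)

theorem eventually_flow_mem_source (hφ : IsLiftedGeodesicFlow g φ) {x : S2} {Z : S3}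
    (h : coverBase (φ 0 Z) ∈ (extChartAt (𝓡 2) x).source) (ζ : EuclideanSpace ℝ (Fin 3)) :
    ∀ᶠ q in 𝓝 (0 : ℝ × ℝ),
      coverBase (φ q.1 (sphereCurve Z ζ q.2)) ∈ (extChartAt (𝓡 2) x).source := by
  have hc := (contMDiff_flow_sphereCurve hφ Z ζ).continuous.tendsto 0
  have e : φ (0 : ℝ × ℝ).1 (sphereCurve Z ζ (0 : ℝ × ℝ).2) = φ 0 Z := by
    rw [Prod.fst_zero, Prod.snd_zero, sphereCurve_zero]
  rw [e] at hc
  exact hc.eventually (eventually_coverBase_mem_source h)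

theorem flowVariation_zero (g : Metric2) (φ : Flow ℝ S3) (x : S2) (Z : S3)
    (ζ : EuclideanSpace ℝ (Fin 3)) (s : ℝ) :
    flowVariation g φ x Z ζ (s, 0) = coverChart g x (φ s Z) := by
  rw [flowVariation, sphereCurve_zero]

theorem fderiv_flowVariation_fst (hφ : IsLiftedGeodesicFlow g φ) {x : S2} {Z : S3}
    {ζ : EuclideanSpace ℝ (Fin 3)} {q : ℝ × ℝ}
    (h : coverBase (φ q.1 (sphereCurve Z ζ q.2)) ∈ (extChartAt (𝓡 2) x).source) :
    fderiv ℝ (flowVariation g φ x Z ζ) q (1, 0) = ((flowVariation g φ x Z ζ q).2,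
      - chartChristoffel g x (flowVariation g φ x Z ζ q).1 (flowVariation g φ x Z ζ q).2
        (flowVariation g φ x Z ζ q).2) := by
  have h1 := hasDerivAt_comp_line_fst ((contDiffAt_flowVariation hφ h).differentiableAt (by simp))
  have h2 := hasDerivAt_coverChart_flow hφ h
  have e (t ε : ℝ) : coverChart g x (φ t (sphereCurve Z ζ ε)) = flowVariation g φ x Z ζ (t, ε) :=
    rfl
  simp only [e] at h2
  exact h1.unique h2

/-- The variation field is the image of `Dφˢ ζ` under `dD_g`, carried from the chart at the moving
foot point to the fixed chart at `x`. -/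
theorem fderiv_flowVariation_snd (hφ : IsLiftedGeodesicFlow g φ) {x : S2} {Z : S3} {s : ℝ}
    (h : coverBase (φ s Z) ∈ (extChartAt (𝓡 2) x).source) (ζ : EuclideanSpace ℝ (Fin 3)) :
    (fderiv ℝ (flowVariation g φ x Z ζ) (s, 0) (0, 1)).1 =
      chartChange x (φ s Z) (coverVel g (φ s Z) (flowDeriv φ s Z ζ)).1 ∧
    (fderiv ℝ (flowVariation g φ x Z ζ) (s, 0) (0, 1)).2 +
      chartChristoffel g x (flowVariation g φ x Z ζ (s, 0)).1 (flowVariation g φ x Z ζ (s, 0)).2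
        (fderiv ℝ (flowVariation g φ x Z ζ) (s, 0) (0, 1)).1 =
      chartChange x (φ s Z) (connectionVel g (φ s Z) (flowDeriv φ s Z ζ)) := by
  obtain ⟨η, h1, h2, h3⟩ := hasDerivAt_coverChart_flow_sphereCurve hφ h ζ
  have h' : coverBase (φ s (sphereCurve Z ζ 0)) ∈ (extChartAt (𝓡 2) x).source := by
    rwa [sphereCurve_zero]
  have h4 := hasDerivAt_comp_line_snd
    ((contDiffAt_flowVariation (q := (s, 0)) hφ h').differentiableAt (by simp))
  have h5 : HasDerivAt (fun ε => flowVariation g φ x Z ζ (s, ε)) η 0 := h1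
  have h6 := h4.unique h5
  rw [h6, flowVariation_zero]
  exact ⟨h2, h3⟩

/-! ### The flow preserves the contact structure -/

/-- The value of the contact form of the unit tangent bundle on the image of a tangent vector. -/
def contactProduct (g : Metric2) (W : S3) (η : EuclideanSpace ℝ (Fin 3)) : ℝ :=
  chartMetric g (coverBase W) (baseCenter W) (fiberCoord (cover g W)) (coverVel g W η).1

/-- The first variation formula gives the derivative `g(v, K)`, which is zero because all the
vectors `v` have length one. -/
theorem hasDerivAt_contactProduct_zero (hφ : IsLiftedGeodesicFlow g φ) (Z : S3)
    (ζ : EuclideanSpace ℝ (Fin 3)) :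
    HasDerivAt (fun s => contactProduct g (φ s Z) (flowDeriv φ s Z ζ)) 0 0 := by
  set x := coverBase (φ 0 Z) with hx
  have h0 : coverBase (φ 0 Z) ∈ (extChartAt (𝓡 2) x).source := mem_extChartAt_source _
  have hev := eventually_flow_mem_source hφ h0 ζ
  have hLC := isLeviCivita_chart g x
  set f := flowVariation g φ x Z ζ with hf
  have hf0 : f 0 = coverChart g x (φ 0 Z) := flowVariation_zero g φ x Z ζ 0
  have hJ := hLC.hasDerivAt_inner_variation (f := f)
    (contDiffAt_flowVariation hφ hev.self_of_nhds)
    (hev.mono fun q hq => fderiv_flowVariation_fst hφ hq)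
  have hs := fderiv_flowVariation_snd hφ h0 ζ
  rw [← hf] at hs
  have hK : chartMetric g x (f 0).1 (f 0).2 ((fderiv ℝ f 0 (0, 1)).2 +
      chartChristoffel g x (f 0).1 (f 0).2 (fderiv ℝ f 0 (0, 1)).1) = 0 := by
    have h1 := hs.2
    change (fderiv ℝ f 0 (0, 1)).2 + chartChristoffel g x (f 0).1 (f 0).2
      (fderiv ℝ f 0 (0, 1)).1 = _ at h1
    rw [h1, hf0, hLC.symm]
    exact (chartMetric_chartChange g h0 _ _).trans (chartMetric_connection_coverVel g (φ 0 Z) _)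
  rw [hK] at hJ
  refine hJ.congr_of_eventuallyEq ?_
  filter_upwards [tendsto_line.eventually hev] with s hs
  simp only [sphereCurve_zero] at hs
  rw [hf, (fderiv_flowVariation_snd hφ hs ζ).1, flowVariation_zero]
  exact (chartMetric_chartChange g hs _ _).symm

theorem contactProduct_flowDeriv (hφ : IsLiftedGeodesicFlow g φ) (Z : S3)
    (ζ : EuclideanSpace ℝ (Fin 3)) (t : ℝ) :
    contactProduct g (φ t Z) (flowDeriv φ t Z ζ) = contactProduct g Z ζ := by
  -- The flow property carries the derivative at time zero, known at every point, to time `t`.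
  have hd (t : ℝ) : HasDerivAt (fun s => contactProduct g (φ s Z) (flowDeriv φ s Z ζ)) 0 t := by
    have h := hasDerivAt_contactProduct_zero hφ (φ t Z) (flowDeriv φ t Z ζ)
    have h' : HasDerivAt (fun s => contactProduct g (φ (s + t) Z) (flowDeriv φ (s + t) Z ζ)) 0 0 :=
      h.congr_of_eventuallyEq (Eventually.of_forall fun s => by
        beta_reduce
        rw [flowDeriv_add hφ, φ.map_add])
    have h2 := (hasDerivAt_id t).sub_const t
    have h3 : HasDerivAt (fun s => contactProduct g (φ (s + t) Z) (flowDeriv φ (s + t) Z ζ)) 0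
        (id t - t) := by rwa [id, sub_self]
    have h4 := HasDerivAt.comp (h := fun s : ℝ => id s - t) t h3 h2
    rw [mul_one] at h4
    refine h4.congr_of_eventuallyEq (Eventually.of_forall fun s => ?_)
    simp only [Function.comp_apply, id, sub_add_cancel]
  have h := is_const_of_deriv_eq_zero (fun t => (hd t).differentiableAt) (fun t => (hd t).deriv) t 0
  rwa [flowDeriv_zero, φ.map_zero_apply] at h

theorem linearised_mem_contactPlane (hφ : IsLiftedGeodesicFlow g φ) {Z : S3}
    {ζ : TangentSpace (𝓡 3) Z} (hζ : ζ ∈ contactPlane Z) (t : ℝ) :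
    linearised φ t Z ζ ∈ contactPlane (φ t Z) :=
  (mem_contactPlane_iff g (φ t Z)).2
    ((contactProduct_flowDeriv hφ Z ζ t).trans ((mem_contactPlane_iff g Z).1 hζ))

end FlowVariation

/-! ### Orientation and the angular velocity in the lifted frame. -/

section AngularVelocity

/-- The standard area of the coordinate vectors, in the preferred chart at `x`. -/
def chartArea (x : S2) (a : E2) : ℝ :=
  Matrix.det (Matrix.of ![fun i => sphereIncl x a i, fun i => fderiv ℝ (sphereIncl x) a (e2 0) i,
    fun i => fderiv ℝ (sphereIncl x) a (e2 1) i])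

theorem continuous_chartArea (x : S2) : Continuous (chartArea x) := by
  have h0 := (contDiff_sphereIncl x).continuous
  have h1 (i : Fin 2) : Continuous fun a => fderiv ℝ (sphereIncl x) a (e2 i) :=
    ((contDiff_sphereIncl x).continuous_fderiv (by simp)).clm_apply continuous_const
  have hc (j : Fin 3) {f : E2 → EuclideanSpace ℝ (Fin 3)} (hf : Continuous f) :
      Continuous fun a => f a j :=
    (EuclideanSpace.proj j : EuclideanSpace ℝ (Fin 3) →L[ℝ] ℝ).continuous.comp hf
  refine Continuous.matrix_det (continuous_matrix fun i j => ?_)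
  fin_cases i
  · exact hc j h0
  · exact hc j (h1 0)
  · exact hc j (h1 1)

theorem ambient_eq_fderiv_sphereIncl {x : S2} {W : S3}
    (h : coverBase W ∈ (extChartAt (𝓡 2) x).source) (u : TangentSpace (𝓡 2) (coverBase W)) :
    ambient (coverBase W) u = fderiv ℝ (sphereIncl x) (extChartAt (𝓡 2) x (coverBase W))
      (chartChange x W u) := by
  have key (q : S2) (hq : q ∈ (extChartAt (𝓡 2) x).source) (u : TangentSpace (𝓡 2) q) :
      ambient q u = fderiv ℝ (sphereIncl x) (extChartAt (𝓡 2) x q)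
        (tangentCoordChange (𝓡 2) q x q u) := by
    obtain ⟨a, rfl⟩ : ∃ a, q = (extChartAt (𝓡 2) x).symm a :=
      ⟨_, ((extChartAt (𝓡 2) x).left_inv hq).symm⟩
    obtain ⟨w, rfl⟩ := symmDeriv_surjective x a u
    rw [extChartAt_right_inv_S2, ambient_symmDeriv, tangentCoordChange_symmDeriv_self]
  exact key _ h u

/-- The standard area form is alternating, hence in a chart a multiple of `wedge`. This transfers
the orientation condition on `v^⊥` to the coordinate determinants. -/
theorem areaForm_eq_wedge {x : S2} {W : S3} (h : coverBase W ∈ (extChartAt (𝓡 2) x).source)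
    (u w : TangentSpace (𝓡 2) (coverBase W)) :
    areaForm (coverBase W) u w = wedge (chartChange x W u) (chartChange x W w) *
      chartArea x (extChartAt (𝓡 2) x (coverBase W)) := by
  have hx : (coverBase W : EuclideanSpace ℝ (Fin 3)) =
      sphereIncl x (extChartAt (𝓡 2) x (coverBase W)) := by
    rw [sphereIncl, (extChartAt (𝓡 2) x).left_inv h]
  rw [areaForm, ambient_eq_fderiv_sphereIncl h, ambient_eq_fderiv_sphereIncl h, hx, chartArea]
  generalize extChartAt (𝓡 2) x (coverBase W) = a
  generalize chartChange x W u = U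
  generalize chartChange x W w = V
  have e (U : E2) : fderiv ℝ (sphereIncl x) a U = U 0 • fderiv ℝ (sphereIncl x) a (e2 0) +
      U 1 • fderiv ℝ (sphereIncl x) a (e2 1) := by
    conv_lhs => rw [eq_sum_e2 U]
    simp only [map_add, map_smul]
  rw [e U, e V]
  simp [Matrix.det_fin_three, wedge]
  ring

theorem wedge_smul_right (c : ℝ) (u w : E2) : wedge u (c • w) = c * wedge u w := by
  simp [wedge]
  ring

/-- The angular velocity of a curve of vectors whose coordinates are known up to a factor of
constant sign. -/
theorem exists_hasAngularVelocityAt_of_coords {V : ℝ → Type*} [∀ s, AddCommGroup (V s)]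
    [∀ s, Module ℝ (V s)] {e : ∀ s, Fin 2 → V s} {ζ : ∀ s, V s} {A B σ ρ : ℝ → ℝ} {κ τ t : ℝ}
    (he : ∀ s, LinearIndependent ℝ (e s))
    (hζ : ∀ᶠ s in 𝓝 t, ∃ a b : ℝ, ζ s = a • e s 0 + b • e s 1 ∧ A s = a * σ s ∧ B s = b * σ s)
    (hne : ζ t ≠ 0) (hρ : ContinuousAt ρ t) (hρσ : ∀ᶠ s in 𝓝 t, 0 < ρ s * σ s)
    (hA : HasDerivAt A (- κ * B t - τ * A t) t) (hB : HasDerivAt B (A t - τ * B t) t) :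
    ∃ a b : ℝ, 0 < a ^ 2 + b ^ 2 ∧ HasAngularVelocityAt (fun s => circleCoord (e s) (ζ s))
      ((a ^ 2 + κ * b ^ 2) / (a ^ 2 + b ^ 2)) t := by
  have hρ0 : ρ t ≠ 0 := left_ne_zero_of_mul hρσ.self_of_nhds.ne'
  have hσ0 : σ t ≠ 0 := right_ne_zero_of_mul hρσ.self_of_nhds.ne'
  -- By continuity `ρ` keeps its sign near `t`, so it may be frozen at `ρ t`; the curves `ρ t * A`
  -- and `ρ t * B` are then differentiable though `ρ` is merely continuous.
  have hρev : ∀ᶠ s in 𝓝 t, 0 < ρ t * ρ s :=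
    (continuousAt_const.mul hρ).eventually (lt_mem_nhds (mul_self_pos.2 hρ0))
  have hpos : 0 < (ρ t * A t) ^ 2 + (ρ t * B t) ^ 2 := by
    obtain ⟨a, b, h1, h2, h3⟩ := hζ.self_of_nhds
    rw [h2, h3]
    have hab : a ≠ 0 ∨ b ≠ 0 := by
      by_contra! h
      rw [h.1, h.2, zero_smul, zero_smul, add_zero] at h1
      exact hne h1
    rcases hab with h | h
    · exact add_pos_of_pos_of_nonneg (by positivity) (by positivity)
    · exact add_pos_of_nonneg_of_pos (by positivity) (by positivity)
  refine ⟨ρ t * A t, ρ t * B t, hpos, ?_⟩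
  have hang := hasAngularVelocityAt_circleCoord (c := fun s => (ρ t * σ s)⁻¹) he (by
      filter_upwards [hζ, hρσ, hρev] with s ⟨a, b, h1, h2, h3⟩ hs hρs
      have hpos : 0 < ρ t * σ s := by
        have h1 : 0 < (ρ t * ρ s) * (ρ s * σ s) := mul_pos hρs hs
        have h2 : (ρ t * ρ s) * (ρ s * σ s) = ρ s ^ 2 * (ρ t * σ s) := by ring
        rw [h2] at h1
        exact pos_of_mul_pos_right h1 (sq_nonneg _)
      refine ⟨inv_pos.2 hpos, ?_⟩
      have ha : (ρ t * σ s)⁻¹ * (ρ t * A s) = a := by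
        rw [h2, inv_mul_eq_iff_eq_mul₀ hpos.ne']
        ring
      have hb : (ρ t * σ s)⁻¹ * (ρ t * B s) = b := by
        rw [h3, inv_mul_eq_iff_eq_mul₀ hpos.ne']
        ring
      rw [smul_add, smul_smul, smul_smul, ha, hb]
      exact h1)
    (hA.const_mul (ρ t)) (hB.const_mul (ρ t)) hpos
  -- The terms with `τ` cancel in `A B' - B A'`.
  convert hang using 2
  ring

theorem chartArea_mul_wedge_perpCoord_pos (g : Metric2) (o : ℤˣ) {x : S2} {W : S3}
    (h : coverBase W ∈ (extChartAt (𝓡 2) x).source) :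
    0 < ((o : ℤ) : ℝ) * chartArea x (coverChart g x W).1 *
      wedge (coverChart g x W).2 (chartChange x W (perpCoord g W o)) := by
  have h1 := (chartMetric_perpCoord g W o).2.2
  have h2 := areaForm_eq_wedge h (cover g W).snd (perp g o (coverBase W) (cover g W).snd)
  have h3 : 0 < ((o : ℤ) : ℝ) * (wedge (coverChart g x W).2 (chartChange x W (perpCoord g W o)) *
    chartArea x (coverChart g x W).1) := h1.trans_eq (congrArg _ h2)
  rwa [mul_comm (wedge _ _), ← mul_assoc] at h3

theorem continuousAt_comp_line {E : Type*} [TopologicalSpace E] {f : ℝ × ℝ → E}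
    (hf : ContinuousAt f 0) : ContinuousAt (fun s : ℝ => f (s, 0)) 0 :=
  hf.tendsto.comp tendsto_line

variable {g : Metric2} {φ : Flow ℝ S3}

theorem exists_coords_flowVariation (hφ : IsLiftedGeodesicFlow g φ) (o : ℤˣ) {x : S2} {Z : S3}
    {ζ : TangentSpace (𝓡 3) Z} (hζ : ζ ∈ contactPlane Z) {s : ℝ}
    (h : coverBase (φ s Z) ∈ (extChartAt (𝓡 2) x).source) :
    ∃ a b : ℝ,
      linearised φ s Z ζ = a • liftedFrame g o (φ s Z) 0 + b • liftedFrame g o (φ s Z) 1 ∧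
      (fderiv ℝ (flowVariation g φ x Z ζ) (s, 0) (0, 1)).2 +
        chartChristoffel g x (flowVariation g φ x Z ζ (s, 0)).1 (flowVariation g φ x Z ζ (s, 0)).2
          (fderiv ℝ (flowVariation g φ x Z ζ) (s, 0) (0, 1)).1 =
        a • chartChange x (φ s Z) (perpCoord g (φ s Z) o) ∧
      (fderiv ℝ (flowVariation g φ x Z ζ) (s, 0) (0, 1)).1 =
        b • chartChange x (φ s Z) (perpCoord g (φ s Z) o) := by
  obtain ⟨a, b, h1, h2, h3⟩ := eq_liftedFrame_of_mem_contactPlane g (φ s Z) o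
    (linearised_mem_contactPlane hφ hζ s)
  obtain ⟨h4, h5⟩ := fderiv_flowVariation_snd hφ h ζ
  have h2' : connectionVel g (φ s Z) (flowDeriv φ s Z ζ) = a • perpCoord g (φ s Z) o := h2
  have h3' : (coverVel g (φ s Z) (flowDeriv φ s Z ζ)).1 = b • perpCoord g (φ s Z) o := h3
  rw [h2', map_smul] at h5
  rw [h3', map_smul] at h4
  exact ⟨a, b, h1, h5, h4⟩

theorem eventually_flow_zero_mem_source (hφ : IsLiftedGeodesicFlow g φ) {x : S2} {Z : S3}
    (h : coverBase (φ 0 Z) ∈ (extChartAt (𝓡 2) x).source) :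
    ∀ᶠ s in 𝓝 (0 : ℝ), coverBase (φ s Z) ∈ (extChartAt (𝓡 2) x).source := by
  filter_upwards [tendsto_line.eventually (eventually_flow_mem_source hφ h 0)] with s hs
  simpa only [sphereCurve_zero] using hs

/-- The chart must be centred at the foot point at time zero: there `planeCurvature` is the Gaussian
curvature at that point. -/
theorem exists_hasDerivAt_wedge_flowVariation (hφ : IsLiftedGeodesicFlow g φ) (Z : S3)
    (ζ : EuclideanSpace ℝ (Fin 3)) {x : S2} (hx : coverBase (φ 0 Z) = x)
    {f : ℝ × ℝ → E2 × E2} (hf : f = flowVariation g φ x Z ζ) :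
    ContinuousAt (fun s : ℝ => f (s, 0)) 0 ∧ ∃ τ : ℝ,
      HasDerivAt (fun s => wedge (f (s, 0)).2 ((fderiv ℝ f (s, 0) (0, 1)).2 +
          chartChristoffel g x (f (s, 0)).1 (f (s, 0)).2 (fderiv ℝ f (s, 0) (0, 1)).1))
        (- gaussianCurvature g x * wedge (f (0, 0)).2 (fderiv ℝ f (0, 0) (0, 1)).1 -
          τ * wedge (f (0, 0)).2 ((fderiv ℝ f (0, 0) (0, 1)).2 +
            chartChristoffel g x (f (0, 0)).1 (f (0, 0)).2 (fderiv ℝ f (0, 0) (0, 1)).1)) 0 ∧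
      HasDerivAt (fun s => wedge (f (s, 0)).2 (fderiv ℝ f (s, 0) (0, 1)).1)
        (wedge (f (0, 0)).2 ((fderiv ℝ f (0, 0) (0, 1)).2 +
            chartChristoffel g x (f (0, 0)).1 (f (0, 0)).2 (fderiv ℝ f (0, 0) (0, 1)).1) -
          τ * wedge (f (0, 0)).2 (fderiv ℝ f (0, 0) (0, 1)).1) 0 := by
  have h0 : coverBase (φ 0 Z) ∈ (extChartAt (𝓡 2) x).source := hx ▸ mem_extChartAt_source _
  have hev := eventually_flow_mem_source hφ h0 ζ
  have hf0 : f 0 = coverChart g x (φ 0 Z) := hf ▸ flowVariation_zero g φ x Z ζ 0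
  have hdf : ContDiffAt ℝ ∞ f 0 := hf ▸ contDiffAt_flowVariation hφ hev.self_of_nhds
  have hgeo : ∀ᶠ p in 𝓝 (0 : ℝ × ℝ),
      fderiv ℝ f p (1, 0) = ((f p).2, - chartChristoffel g x (f p).1 (f p).2 (f p).2) := by
    rw [hf]
    exact hev.mono fun q hq => fderiv_flowVariation_fst hφ hq
  have hunit : chartMetric g x (f 0).1 (f 0).2 (f 0).2 = 1 := by
    rw [hf0]
    exact chartMetric_coverCoord_self g h0
  have hκ : planeCurvature (chartMetric g x) (chartChristoffel g x) (f 0).1 =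
      gaussianCurvature g x := by
    rw [hf0, ← planeCurvature_chart g x, coverChart, hx]
  have h := (isLeviCivita_chart g x).hasDerivAt_wedge_variation hdf hgeo hunit
  rw [hκ] at h
  exact ⟨continuousAt_comp_line hdf.continuousAt, h⟩

/-- Here `σ = v ∧ v^⊥` is the common factor of the coordinates, and `ρ`, the area density of the
chart times the orientation sign, makes `ρ σ` positive. -/
theorem exists_hasAngularVelocityAt (hφ : IsLiftedGeodesicFlow g φ) (o : ℤˣ) {Z : S3}
    {ζ : TangentSpace (𝓡 3) Z} (hζ : ζ ∈ contactPlane Z) (hne : ζ ≠ 0) :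
    ∃ a b : ℝ, 0 < a ^ 2 + b ^ 2 ∧ HasAngularVelocityAt
      (fun t : ℝ => circleCoord (liftedFrame g o (φ t Z)) (linearised φ t Z ζ))
      ((a ^ 2 + gaussianCurvature g (coverBase (φ 0 Z)) * b ^ 2) / (a ^ 2 + b ^ 2)) 0 := by
  obtain ⟨x, hx⟩ : ∃ x, coverBase (φ 0 Z) = x := ⟨_, rfl⟩
  obtain ⟨f, hf⟩ : ∃ f, f = flowVariation g φ x Z ζ := ⟨_, rfl⟩
  obtain ⟨hc, τ, hA, hB⟩ := exists_hasDerivAt_wedge_flowVariation hφ Z ζ hx hf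
  have hmem := eventually_flow_zero_mem_source hφ (x := x) (Z := Z)
    (hx ▸ mem_extChartAt_source _)
  have hfs (s : ℝ) : f (s, 0) = coverChart g x (φ s Z) := hf ▸ flowVariation_zero g φ x Z ζ s
  rw [hx]
  refine exists_hasAngularVelocityAt_of_coords
    (A := fun s => wedge (f (s, 0)).2 ((fderiv ℝ f (s, 0) (0, 1)).2 +
      chartChristoffel g x (f (s, 0)).1 (f (s, 0)).2 (fderiv ℝ f (s, 0) (0, 1)).1))
    (B := fun s => wedge (f (s, 0)).2 (fderiv ℝ f (s, 0) (0, 1)).1)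
    (σ := fun s => wedge (f (s, 0)).2 (chartChange x (φ s Z) (perpCoord g (φ s Z) o)))
    (ρ := fun s => ((o : ℤ) : ℝ) * chartArea x (f (s, 0)).1)
    (fun s => linearIndependent_liftedFrame g (φ s Z) o) ?_ ?_
    (continuousAt_const.mul ((continuous_chartArea x).continuousAt.comp hc.fst)) ?_ hA hB
  · filter_upwards [hmem] with s hs
    obtain ⟨a, b, h1, h2, h3⟩ := exists_coords_flowVariation hφ o hζ hs
    rw [← hf] at h2 h3
    refine ⟨a, b, h1, ?_, ?_⟩
    · rw [h2, wedge_smul_right]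
    · rw [h3, wedge_smul_right]
  · exact fun h => hne ((flowDeriv_zero φ Z ζ).symm.trans h)
  · filter_upwards [hmem] with s hs
    rw [hfs]
    exact chartArea_mul_wedge_perpCoord_pos g o hs

end AngularVelocity

end GeodesicLift

end

/-! ### The theorem. -/

theorem mainTheorem10 (g : GeodesicLift.Metric2) (o : ℤˣ) (φ : Flow ℝ GeodesicLift.S3)
    (hφ : GeodesicLift.IsLiftedGeodesicFlow g φ) (Kmin Kmax : ℝ)
    (hmin : IsLeast (Set.range (GeodesicLift.gaussianCurvature g)) Kmin)
    (hmax : IsGreatest (Set.range (GeodesicLift.gaussianCurvature g)) Kmax) :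
    -- the lifted geodesic frame lifts the geodesic frame and is a global frame of `ξ`
    (∀ Z : GeodesicLift.S3,
      (∀ i : Fin 2, GeodesicLift.coverDeriv g Z (GeodesicLift.liftedFrame g o Z i) =
        GeodesicLift.geodesicFrame g o (GeodesicLift.cover g Z) i) ∧
      LinearIndependent ℝ (GeodesicLift.liftedFrame g o Z) ∧
      Submodule.span ℝ (Set.range (GeodesicLift.liftedFrame g o Z)) =
        GeodesicLift.contactPlane Z) ∧
    -- the linearised flow preserves `ξ`, and its angular speed in the frame is pinched
    ∀ (Z : GeodesicLift.S3), ∀ ζ ∈ GeodesicLift.contactPlane Z, ζ ≠ 0 →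
      (∀ t : ℝ, GeodesicLift.linearised φ t Z ζ ∈ GeodesicLift.contactPlane (φ t Z)) ∧
      ∃ c : ℝ,
        GeodesicLift.HasAngularVelocityAt
          (fun t : ℝ => GeodesicLift.circleCoord (GeodesicLift.liftedFrame g o (φ t Z))
            (GeodesicLift.linearised φ t Z ζ)) c 0 ∧
        min 1 Kmin ≤ c ∧ c ≤ max 1 Kmax := by
  refine ⟨fun Z => ⟨GeodesicLift.coverDeriv_liftedFrame g Z o,
    GeodesicLift.linearIndependent_liftedFrame g Z o, GeodesicLift.span_liftedFrame g Z o⟩,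
    fun Z ζ hζ hne => ⟨GeodesicLift.linearised_mem_contactPlane hφ hζ, ?_⟩⟩
  obtain ⟨a, b, h0, h⟩ := GeodesicLift.exists_hasAngularVelocityAt hφ o hζ hne
  exact ⟨_, h, GeodesicLift.min_le_div_le_max h0 (hmin.2 ⟨_, rfl⟩) (hmax.2 ⟨_, rfl⟩)⟩
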